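/- **Setting.** Let $(\Omega,\mathcal F,\mathbb P)$ be a probability space, $T>0$, and let $\theta_t=(\nu_t,a_t,b_t)$, $t\in[0,T]$, be a process with values in $[0,\infty)^3$. Let $\overline N$ be a Poisson random measure on $\mathbb R^2$ with Lebesgue intensity measure, independent of $\theta$. Put $\mathcal F^\theta_t=\sigma(\theta_s:s\le t)$, $\mathcal F^{\overline N}_t=\sigma(\overline N(B):B\subseteq[0,t]\times\mathbb R\text{ Borel})$ and $\mathcal F_t=\mathcal F^\theta_t\vee\mathcal F^{\overline N}_t$. Assume that $\theta$ is $(\mathcal F_t)$-predictable. A *point process* $N$ on $[0,T]$ is a random measure on $[0,T]$ that is almost surely the counting measure of a finite set of pairwise distinct times in $(0,T]$; write $N_t=N([0,t])$. It is *adapted* to a filtration $(\mathcal G_t)$ if $N(B)$ is $\mathcal G_t$-measurable for all $t$ and all Borel sets $B\subseteq[0,t]$. A $[0,\infty]$-valued $(\mathcal G_t)$-predictable process $\lambda$ with $\int_0^T\lambda(s)\,ds<\infty$ a.s. is the *$(\mathcal G_t)$-intensity* of $N$ if $\mathbb E\int_0^T C_s\,dN_s=\mathbb E\int_0^T C_s\lambda(s)\,ds$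 for every $(\mathcal G_t)$-predictable $C\ge 0$. An adapted point process $N$ is a *doubly stochastic Hawkes process with parameter $\theta$* relative to $(\mathcal G_t)$ if its $(\mathcal G_t)$-intensity is $$\lambda(t)=\nu_t+\int_{[0,t)}a_s e^{-b_s(t-s)}\,dN_s ,\qquad t\in[0,T].$$ When $\theta=\tilde\theta$ is a deterministic function, $N$ is called a *Hawkes process with inhomogeneous deterministic parameter $\tilde\theta$*. **Theorem (Existence).** Assume that $\sup_{t\in[0,T]}a_t/b_t<1$ a.s. (where $x/0=\infty$ for $x>0$ and $0/0=0$) and $\int_0^T\nu_s\,ds<\infty$ a.s. Then there is a doubly stochastic Hawkes process $N$ with parameter $\theta$ relative to $(\mathcal F_t)$, that is, a point process adapted to $(\mathcal F_t)$ whose $(\mathcal F_t)$-intensity is $$\lambda(t)=\nu_t+\int_0^{t-}a_s e^{-b_s(t-s)}\,dN_s .$$ Moreover, conditionally on the path of $\theta$, $N$ is distributed as a Hawkes process with inhomogeneous deterministic parameter $\theta$: for almost every $\omega$ there is a Hawkes process with deterministic parameter $\tilde\theta=\theta_\cdot(\omega)$ (relative to $(\mathcal F^{\overline N}_t)$ on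 $(\Omega,\mathcal F,\mathbb P)$), and, for every bounded real function $f$ on the space of measures on $[0,T]$ that is measurable for the $\sigma$-algebra generated by the evaluations $\mu\mapsto\mu(B)$, for almost every $\omega$, $$\mathbb E\big[f(N)\,\big|\,\mathcal F^\theta_T\big](\omega)=\mathbb E\big[f(N^{\tilde\theta})\big]\Big|_{\tilde\theta=\theta_\cdot(\omega)}$$ for every Hawkes process $N^{\tilde\theta}$ with deterministic parameter $\tilde\theta$, on any probability space and relative to any filtration. -/

import Mathlib

open MeasureTheory ProbabilityTheory Set
open scoped NNReal ENNReal

namespace HawkesExistence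

/-- The time interval `[0, T]`, whose least and greatest elements are `⊥ = 0` and `⊤ = T`. -/
abbrev Horizon (T : ℝ≥0) : Type := Set.Iic T

/-- Lebesgue measure on `[0, T]`. -/
noncomputable def lebesgue (T : ℝ≥0) : Measure (Horizon T) :=
  (volume : Measure ℝ).comap (fun t => ((t : ℝ≥0) : ℝ))

/-- The parameter space of triples `(ν, a, b)` of nonnegative real numbers. -/
abbrev Param : Type := ℝ≥0 × ℝ≥0 × ℝ≥0

/-- A Poisson random measure with intensity measure `m`: a random locally finite measure whose
values on disjoint measurable sets are independent, and whose value on a measurable set `B` with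
`m B < ∞` has the Poisson law with mean `m B`. -/
structure IsPoissonRandomMeasure {Ω E : Type*} [MeasurableSpace Ω] [TopologicalSpace E]
    [MeasurableSpace E] (P : Measure Ω) (X : Ω → Measure E) (m : Measure E) : Prop where
  measurable : Measurable X
  locallyFinite : ∀ ω, IsLocallyFiniteMeasure (X ω)
  law : ∀ B : Set E, MeasurableSet B → m B ≠ ∞ →
    P.map (fun ω => X ω B) =
      (poissonMeasure (m B).toNNReal).map (fun k : ℕ => (k : ℝ≥0∞))
  indep : ∀ (n : ℕ) (B : Fin n → Set E), (∀ i, MeasurableSet (B i)) →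
    Pairwise (fun i j => Disjoint (B i) (B j)) → iIndepFun (fun i ω => X ω (B i)) P

theorem measurable_measure_restrict {E : Type*} [MeasurableSpace E] {A : Set E}
    (hA : MeasurableSet A) : Measurable (fun μ : Measure E => μ.restrict A) := by
  refine Measure.measurable_of_measurable_coe _ fun s hs => ?_
  simp_rw [Measure.restrict_apply hs]
  exact Measure.measurable_coe (hs.inter hA)

/-- The filtration `t ↦ σ(X(B) : B ⊆ [0, t] × ℝ Borel)` generated by a random measure `X` on
`ℝ × ℝ`, the first coordinate being time. -/
noncomputable def randomMeasureFiltration {Ω : Type*} [mΩ : MeasurableSpace Ω] (T : ℝ≥0)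
    (X : Ω → Measure (ℝ × ℝ)) (hX : Measurable X) : Filtration (Horizon T) mΩ where
  seq t := MeasurableSpace.comap
    (fun ω => (X ω).restrict (Set.Icc (0 : ℝ) (t : ℝ≥0) ×ˢ Set.univ)) inferInstance
  mono' := by
    intro s t hst
    have hS : MeasurableSet (Set.Icc (0 : ℝ) (s : ℝ≥0) ×ˢ (Set.univ : Set ℝ)) :=
      measurableSet_Icc.prod MeasurableSet.univ
    have hsub : Set.Icc (0 : ℝ) (s : ℝ≥0) ×ˢ (Set.univ : Set ℝ) ⊆
        Set.Icc (0 : ℝ) (t : ℝ≥0) ×ˢ (Set.univ : Set ℝ) :=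
      Set.prod_mono (Set.Icc_subset_Icc_right (by exact_mod_cast hst)) subset_rfl
    have heq : (fun ω => (X ω).restrict (Set.Icc (0 : ℝ) (s : ℝ≥0) ×ˢ Set.univ)) =
        (fun μ : Measure (ℝ × ℝ) => μ.restrict (Set.Icc (0 : ℝ) (s : ℝ≥0) ×ˢ Set.univ)) ∘
          (fun ω => (X ω).restrict (Set.Icc (0 : ℝ) (t : ℝ≥0) ×ˢ Set.univ)) := by
      funext ω
      simp only [Function.comp_apply]
      rw [Measure.restrict_restrict hS, Set.inter_eq_left.mpr hsub]
    change MeasurableSpace.comap _ _ ≤ MeasurableSpace.comap _ _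
    rw [heq, ← MeasurableSpace.comap_comp]
    exact MeasurableSpace.comap_mono (measurable_measure_restrict hS).comap_le
  le' t := ((measurable_measure_restrict
    (measurableSet_Icc.prod MeasurableSet.univ)).comp hX).comap_le

/-- A point process `N` on `[0, T]` adapted to `𝓕`, seen as a random measure: the restriction of
`N` to `[0, t]` is `𝓕 t`-measurable for every `t`, and almost surely `N` is the counting measure
of a finite set of (pairwise distinct) times, none of which is `0`. The associated counting
process is `N_t = N [0, t]`. -/
structure IsAdaptedPointProcess {Ω : Type*} [mΩ : MeasurableSpace Ω] {T : ℝ≥0} (P : Measure Ω)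
    (𝓕 : Filtration (Horizon T) mΩ) (N : Ω → Measure (Horizon T)) : Prop where
  adapted : ∀ t, Measurable[𝓕 t] (fun ω => (N ω).restrict (Set.Iic t))
  counting : ∀ᵐ ω ∂P, ∃ S : Finset (Horizon T), ⊥ ∉ S ∧ N ω = ∑ s ∈ S, Measure.dirac s

/-- `lam` is the (predictable) `𝓕`-intensity of the point process `N` on `[0, T]`: it is
`𝓕`-predictable, almost surely integrable on `[0, T]`, and
`E ∫ C_s dN_s = E ∫ C_s lam(s) ds` for all nonnegative `𝓕`-predictable processes `C`. -/
structure HasIntensity {Ω : Type*} [mΩ : MeasurableSpace Ω] {T : ℝ≥0} (P : Measure Ω)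
    (𝓕 : Filtration (Horizon T) mΩ) (N : Ω → Measure (Horizon T))
    (lam : Horizon T → Ω → ℝ≥0∞) : Prop where
  predictable : IsStronglyPredictable 𝓕 lam
  integrable : ∀ᵐ ω ∂P, (∫⁻ s, lam s ω ∂(lebesgue T)) < ∞
  compensator : ∀ C : Horizon T → Ω → ℝ≥0∞, IsStronglyPredictable 𝓕 C →
    ∫⁻ ω, ∫⁻ s, C s ω ∂(N ω) ∂P = ∫⁻ ω, ∫⁻ s, C s ω * lam s ω ∂(lebesgue T) ∂P

/-- The self-exciting intensity `ν_t + ∫_{[0, t)} a_s e^{- b_s (t - s)} dN_s` along one path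
`θ = (ν, a, b)` of the parameter and one realization `N` of the point process. -/
noncomputable def hawkesIntensity {T : ℝ≥0} (θ : Horizon T → Param) (N : Measure (Horizon T))
    (t : Horizon T) : ℝ≥0∞ :=
  (θ t).1 + ∫⁻ s in Set.Iio t, ((θ s).2.1 : ℝ≥0∞) *
    ENNReal.ofReal (Real.exp (-(((θ s).2.2 : ℝ) * (((t : ℝ≥0) : ℝ) - ((s : ℝ≥0) : ℝ))))) ∂N

/-- `N` is a doubly stochastic Hawkes process with parameter process `θ` relative to `𝓕`: an
`𝓕`-adapted point process whose `𝓕`-intensity is the self-exciting intensity driven by `θ`. -/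
structure IsHawkesProcess {Ω : Type*} [mΩ : MeasurableSpace Ω] {T : ℝ≥0} (P : Measure Ω)
    (𝓕 : Filtration (Horizon T) mΩ) (θ : Horizon T → Ω → Param)
    (N : Ω → Measure (Horizon T)) : Prop where
  pointProcess : IsAdaptedPointProcess P 𝓕 N
  intensity : HasIntensity P 𝓕 N (fun t ω => hawkesIntensity (fun s => θ s ω) (N ω) t)

end HawkesExistence

/-!
The process is built by thinning. Restrict the planar Poisson measure to `[0, T] × [0, ∞)`, the
second coordinate being a mark; given a rate `l`, keep the times of the points whose mark lies
strictly below `l`. A point process obtained in this way from a predictable rate has that rate as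
its intensity, by Campbell's formula for predictable integrands. So it suffices to find `l` with
`l = hawkesIntensity θ (thin x l)`, path by path. The Picard iterates started from `0` increase,
and their limit solves the equation because both thinning and the self-exciting intensity are
continuous along increasing sequences (`hawkesIntensity_hawkesPath`). Every event with parameters
`(a, b)` produces total excitation at most `a / b`, hence under a uniform bound `r < 1` on the
ratio the expected integrated rates satisfy `e ≤ K + r e` along the iteration, which bounds the
limit (`IsDrivingNoise.lintegral_limitRate_lt_top`). The almost sure hypotheses are reduced to
uniform ones by a predictable truncation of the parameter which is inactive on events exhausting
the space. This gives `IsDrivingNoise.isHawkesProcess`, for every filtration that contains the one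
of the noise and enlarges it by independent information only
(`IsPoissonRandomMeasure.isDrivingNoise`). Campbell's formula comes from the independence of the
noise after time `t` and the past of `t`, and the events of the process are pairwise distinct
because, for a fine subdivision of the time axis, no slice carries two points with bounded marks.

For the conditional law, the construction is a function `hawkesPath (θ ω) (x ω)` of two independent
variables, so conditioning on `θ` should amount to freezing its path. The evaluation of a path at a
time is not jointly measurable, so `θ` is first replaced, outside a `dt ⊗ dP`-null set, by a jointly
measurable function of time and path (`exists_measurable_of_path`). Such a change does not affect
the construction: with respect to the filtration that knows the whole path of `θ` from the start,
the two parameters are predictable, and by Campbell's formula the noise does not charge the set of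
times at which they differ (`IsDrivingNoise.ae_hawkesPath_congr`). With a frozen parameter path the
construction is a Hawkes process with deterministic parameter, and it remains to see that the law
of the latter is determined by the parameter (`IsHawkesProcess.map_eq_map`). The expectations of
functionals `F` of the past of such a process satisfy a linear evolution equation, obtained by
telescoping `F` along the events and by compensating the sums over the events. On functionals that
vanish when the total excitation exceeds `K`, the generator at time `t` is bounded by a multiple of
`ν t + K`, which is integrable, and Grönwall's lemma gives uniqueness; then `K → ∞`.
-/

namespace HawkesExistence

/-! ### Thinning and the Picard iteration along one path -/

/-- The mark space measure: Lebesgue measure on `[0, ∞)`. -/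
noncomputable def levelMeasure : Measure ℝ≥0 := (volume : Measure ℝ).comap (fun z : ℝ≥0 => (z : ℝ))

/-- The region below the graph of a rate function. -/
def belowGraph {T : ℝ≥0} (l : Horizon T → ℝ≥0∞) : Set (Horizon T × ℝ≥0) :=
  {p | (p.2 : ℝ≥0∞) < l p.1}

/-- Thinning: the time projection of the part of `x` lying strictly below the graph of `l`. -/
noncomputable def thin {T : ℝ≥0} (x : Measure (Horizon T × ℝ≥0)) (l : Horizon T → ℝ≥0∞) :
    Measure (Horizon T) :=
  (x.restrict (belowGraph l)).map Prod.fst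

/-- The Picard iterates of the self-consistency equation `l = hawkesIntensity θ (thin x l)`,
started from the zero rate. -/
noncomputable def picard {T : ℝ≥0} (θ : Horizon T → Param) (x : Measure (Horizon T × ℝ≥0)) :
    ℕ → Horizon T → ℝ≥0∞
  | 0 => 0
  | k + 1 => hawkesIntensity θ (thin x (picard θ x k))

/-- The limit of the (nondecreasing) Picard iterates. -/
noncomputable def limitRate {T : ℝ≥0} (θ : Horizon T → Param) (x : Measure (Horizon T × ℝ≥0)) :
    Horizon T → ℝ≥0∞ :=
  fun t => ⨆ k, picard θ x k t

/-- The Hawkes path driven by the parameter path `θ` and the planar configuration `x`: the minimal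
solution of the thinning equation. -/
noncomputable def hawkesPath {T : ℝ≥0} (θ : Horizon T → Param) (x : Measure (Horizon T × ℝ≥0)) :
    Measure (Horizon T) :=
  thin x (limitRate θ x)

/-- The excitation kernel `a e^{-b (t - s)}`, as a function of the parameter `q = (ν, a, b)` and of
the two times. -/
noncomputable def excitation {T : ℝ≥0} (q : Param) (t s : Horizon T) : ℝ≥0∞ :=
  (q.2.1 : ℝ≥0∞) *
    ENNReal.ofReal (Real.exp (-((q.2.2 : ℝ) * (((t : ℝ≥0) : ℝ) - ((s : ℝ≥0) : ℝ)))))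

variable {T : ℝ≥0}

theorem hawkesIntensity_eq (θ : Horizon T → Param) (N : Measure (Horizon T)) (t : Horizon T) :
    hawkesIntensity θ N t = (θ t).1 + ∫⁻ s in Iio t, excitation (θ s) t s ∂N := rfl

theorem measurable_excitation {α : Type*} [MeasurableSpace α] {q : α → Param}
    {t s : α → Horizon T} (hq : Measurable q) (ht : Measurable t) (hs : Measurable s) :
    Measurable fun y => excitation (q y) (t y) (s y) := by
  unfold excitation
  have h1 : Measurable fun y => ((t y : ℝ≥0) : ℝ) := measurable_subtype_coe.comp
    (measurable_subtype_coe.comp ht)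
  have h2 : Measurable fun y => ((s y : ℝ≥0) : ℝ) := measurable_subtype_coe.comp
    (measurable_subtype_coe.comp hs)
  fun_prop

theorem measurableSet_belowGraph {l : Horizon T → ℝ≥0∞} (hl : Measurable l) :
    MeasurableSet (belowGraph l) :=
  measurableSet_lt (measurable_snd.coe_nnreal_ennreal) (hl.comp measurable_fst)

theorem thin_apply (x : Measure (Horizon T × ℝ≥0)) (l : Horizon T → ℝ≥0∞)
    {B : Set (Horizon T)} (hB : MeasurableSet B) :
    thin x l B = x (B ×ˢ univ ∩ belowGraph l) := by
  rw [thin, Measure.map_apply measurable_fst hB, Measure.restrict_apply (measurable_fst hB)]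
  congr 1; ext p; simp

theorem lintegral_thin (x : Measure (Horizon T × ℝ≥0)) {l : Horizon T → ℝ≥0∞} (hl : Measurable l)
    {f : Horizon T → ℝ≥0∞} (hf : Measurable f) :
    ∫⁻ s, f s ∂(thin x l) = ∫⁻ p, (belowGraph l).indicator (fun p => f p.1) p ∂x := by
  rw [thin, lintegral_map hf measurable_fst, lintegral_indicator (measurableSet_belowGraph hl)]

theorem thin_mono (x : Measure (Horizon T × ℝ≥0)) {l l' : Horizon T → ℝ≥0∞} (h : l ≤ l') :
    thin x l ≤ thin x l' := by
  refine Measure.map_mono (Measure.restrict_mono (fun p hp => ?_) le_rfl) measurable_fst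
  exact lt_of_lt_of_le hp (h p.1)

instance (x : Measure (Horizon T × ℝ≥0)) [SFinite x] (l : Horizon T → ℝ≥0∞) :
    SFinite (thin x l) := by
  unfold thin; infer_instance

theorem hawkesIntensity_mono (θ : Horizon T → Param) {N N' : Measure (Horizon T)} (h : N ≤ N') :
    hawkesIntensity θ N ≤ hawkesIntensity θ N' := fun _ =>
  add_le_add le_rfl (lintegral_mono' (Measure.restrict_mono le_rfl h) le_rfl)

theorem measurable_hawkesIntensity {θ : Horizon T → Param} (hθ : Measurable θ)
    (N : Measure (Horizon T)) [SFinite N] : Measurable (hawkesIntensity θ N) := by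
  have h : hawkesIntensity θ N = fun t => ((θ t).1 : ℝ≥0∞) +
      ∫⁻ s, {p : Horizon T × Horizon T | p.2 < p.1}.indicator
        (fun p => excitation (θ p.2) p.1 p.2) (t, s) ∂N := by
    funext t
    rw [hawkesIntensity_eq, ← lintegral_indicator measurableSet_Iio]
    rfl
  rw [h]
  refine (hθ.fst.coe_nnreal_ennreal).add (Measurable.lintegral_prod_right' (ν := N) ?_)
  exact (measurable_excitation (hθ.comp measurable_snd) measurable_fst measurable_snd).indicator
    (measurableSet_lt measurable_snd measurable_fst)

theorem measurable_picard {θ : Horizon T → Param} (hθ : Measurable θ)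
    (x : Measure (Horizon T × ℝ≥0)) [SFinite x] (k : ℕ) : Measurable (picard θ x k) := by
  cases k with
  | zero => exact measurable_const
  | succ k => exact measurable_hawkesIntensity hθ _

theorem monotone_picard (θ : Horizon T → Param) (x : Measure (Horizon T × ℝ≥0)) :
    Monotone (picard θ x) := by
  refine monotone_nat_of_le_succ fun k => ?_
  induction k with
  | zero => exact fun _ => zero_le
  | succ k ih => exact hawkesIntensity_mono θ (thin_mono x ih)

/-- Thinning is continuous along nondecreasing sequences of rates. -/
theorem lintegral_thin_iSup (x : Measure (Horizon T × ℝ≥0)) {l : ℕ → Horizon T → ℝ≥0∞}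
    (hl : ∀ k, Measurable (l k)) (hmono : Monotone l) {f : Horizon T → ℝ≥0∞} (hf : Measurable f) :
    ∫⁻ s, f s ∂(thin x fun t => ⨆ k, l k t) = ⨆ k, ∫⁻ s, f s ∂(thin x (l k)) := by
  rw [lintegral_thin x (.iSup hl) hf]
  simp_rw [lintegral_thin x (hl _) hf]
  rw [← lintegral_iSup (f := fun k p => (belowGraph (l k)).indicator (fun p => f p.1) p)
    (fun k => (hf.comp measurable_fst).indicator (measurableSet_belowGraph (hl k)))]
  · refine lintegral_congr fun p => ?_
    by_cases hp : p ∈ belowGraph fun t => ⨆ k, l k t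
    · obtain ⟨k, hk⟩ := lt_iSup_iff.1 (show (p.2 : ℝ≥0∞) < ⨆ k, l k p.1 from hp)
      rw [indicator_of_mem hp]
      refine le_antisymm (le_iSup_of_le k ?_) (iSup_le fun j => indicator_le_self _ _ _)
      rw [indicator_of_mem (show p ∈ belowGraph (l k) from hk)]
    · rw [indicator_of_notMem hp]
      refine (ENNReal.iSup_eq_zero.2 fun k => indicator_of_notMem (fun h => hp ?_) _).symm
      exact lt_of_lt_of_le h (le_iSup (fun k => l k p.1) k)
  · intro i j hij p
    exact indicator_le_indicator_of_subset (fun q hq =>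
      lt_of_lt_of_le (show (q.2 : ℝ≥0∞) < l i q.1 from hq) (hmono hij q.1))
      (f := fun p => f p.1) (fun _ => zero_le) p

/-- The limit rate solves the self-consistency equation: thinning strictly below the rates makes
both sides continuous along the increasing Picard iterates. -/
theorem hawkesIntensity_hawkesPath {θ : Horizon T → Param} (hθ : Measurable θ)
    (x : Measure (Horizon T × ℝ≥0)) [SFinite x] :
    hawkesIntensity θ (hawkesPath θ x) = limitRate θ x := by
  funext t
  have hm : Measurable ((Iio t).indicator fun s => excitation (θ s) t s) :=
    (measurable_excitation hθ measurable_const measurable_id).indicator measurableSet_Iio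
  have key : hawkesIntensity θ (hawkesPath θ x) t = ⨆ k, picard θ x (k + 1) t := by
    rw [hawkesIntensity_eq, ← lintegral_indicator measurableSet_Iio]
    unfold hawkesPath limitRate
    rw [lintegral_thin_iSup x (measurable_picard hθ x) (monotone_picard θ x) hm,
      ENNReal.add_iSup]
    refine iSup_congr fun k => ?_
    rw [lintegral_indicator measurableSet_Iio]
    rfl
  rw [key]
  have hm : Monotone fun k => picard θ x k t := fun i j h => monotone_picard θ x h t
  exact hm.iSup_nat_add 1

theorem thin_congr {x : Measure (Horizon T × ℝ≥0)} {l l' : Horizon T → ℝ≥0∞} {Z : Set (Horizon T)}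
    (hx : x (Z ×ˢ univ) = 0) (h : ∀ t ∉ Z, l t = l' t) : thin x l = thin x l' := by
  unfold thin
  congr 1
  refine Measure.restrict_congr_set ?_
  have : ∀ᵐ p ∂x, p ∉ Z ×ˢ (univ : Set ℝ≥0) := measure_eq_zero_iff_ae_notMem.1 hx
  filter_upwards [this] with p hp
  have : p.1 ∉ Z := fun h => hp ⟨h, mem_univ _⟩
  have h2 := h p.1 this
  change ((p.2 : ℝ≥0∞) < l p.1) = ((p.2 : ℝ≥0∞) < l' p.1)
  rw [h2]

/-- Parameters that agree outside a set of times without noise have the same Picard iterates there: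
the excitation only involves the parameter at the times of events. -/
theorem picard_congr {θ θ' : Horizon T → Param} {x : Measure (Horizon T × ℝ≥0)}
    {Z : Set (Horizon T)} (hZm : MeasurableSet Z) (hx : x (Z ×ˢ univ) = 0)
    (h : ∀ t ∉ Z, θ t = θ' t) (k : ℕ) :
    ∀ t ∉ Z, picard θ x k t = picard θ' x k t := by
  induction k with
  | zero => exact fun t _ => rfl
  | succ k ih =>
    intro t ht
    change hawkesIntensity _ _ t = hawkesIntensity _ _ t
    rw [hawkesIntensity_eq, hawkesIntensity_eq, h t ht, thin_congr hx ih]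
    congr 1
    refine lintegral_congr_ae (ae_restrict_of_ae ?_)
    have hZ : thin x (picard θ' x k) Z = 0 := by
      rw [thin_apply _ _ hZm]
      exact measure_mono_null inter_subset_left hx
    filter_upwards [measure_eq_zero_iff_ae_notMem.1 hZ] with s hs
    rw [h s hs]

/-- The Hawkes path depends on the parameter only through its values at the times charged by the
driving configuration. -/
theorem hawkesPath_congr {θ θ' : Horizon T → Param} {x : Measure (Horizon T × ℝ≥0)}
    {Z : Set (Horizon T)} (hZm : MeasurableSet Z) (hx : x (Z ×ˢ univ) = 0)
    (h : ∀ t ∉ Z, θ t = θ' t) :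
    hawkesPath θ x = hawkesPath θ' x :=
  thin_congr hx fun t ht => iSup_congr fun k => picard_congr hZm hx h k t ht

/-! ### Predictable measurability -/

section Predictable

variable {Ω : Type*} [mΩ : MeasurableSpace Ω] {𝓕 : Filtration (Horizon T) mΩ}

theorem predictable_le_prod : 𝓕.predictable ≤ (inferInstance : MeasurableSpace (Horizon T × Ω)) :=
  measurableSpace_le_predictable_of_measurableSet
    (fun A hA => (measurableSet_singleton _).prod (𝓕.le _ A hA))
    (fun i A hA => measurableSet_Ioi.prod (𝓕.le i A hA))

theorem predictable_mono {𝓖 : Filtration (Horizon T) mΩ} (h : 𝓕 ≤ 𝓖) :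
    𝓕.predictable ≤ 𝓖.predictable :=
  measurableSpace_le_predictable_of_measurableSet
    (fun A hA => measurableSet_predictable_singleton_bot_prod (h _ A hA))
    (fun i A hA => measurableSet_predictable_Ioi_prod (h i A hA))

theorem measurable_fst_predictable :
    Measurable[𝓕.predictable] (Prod.fst : Horizon T × Ω → Horizon T) := by
  let : MeasurableSpace (Horizon T × Ω) := 𝓕.predictable
  refine measurable_of_Ioi fun i => ?_
  have : (Prod.fst : Horizon T × Ω → Horizon T) ⁻¹' Ioi i = Ioi i ×ˢ univ := by ext; simp
  rw [this]
  exact measurableSet_predictable_Ioi_prod MeasurableSet.univ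

/-- Stopping the time variable of a predictable process at `q` gives a function that is jointly
measurable with respect to `𝓕 q`. -/
theorem measurable_min_predictable (q : Horizon T) :
    @Measurable _ _ (Prod.instMeasurableSpace (m₂ := 𝓕 q)) 𝓕.predictable
      (fun p : Horizon T × Ω => (min p.1 q, p.2)) := by
  let : MeasurableSpace Ω := 𝓕 q
  have h : Measurable (fun p : Horizon T × Ω => ((⟨min p.1 q, mem_Iic.2 (min_le_right _ _)⟩ : Iic q), p.2)) :=
    ((measurable_fst.min measurable_const).subtype_mk).prodMk measurable_snd
  exact (measurable_inclusion_predictable (𝓕 := 𝓕) (i := q)).comp h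

/-- A jointly `𝓕 q`-measurable function, switched on after time `q`, is predictable. -/
theorem measurable_indicator_Ioi_predictable (q : Horizon T) {g : Horizon T × Ω → ℝ≥0∞}
    (hg : Measurable[Prod.instMeasurableSpace (m₂ := 𝓕 q)] g) :
    Measurable[𝓕.predictable] ((Ioi q ×ˢ univ).indicator g) := by
  let m : MeasurableSpace (Horizon T × Ω) := 𝓕.predictable
  have hS : MeasurableSet (Ioi q ×ˢ (univ : Set Ω)) :=
    measurableSet_predictable_Ioi_prod MeasurableSet.univ
  have hval : @Measurable (Ioi q ×ˢ (univ : Set Ω) : Set (Horizon T × Ω)) _ _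
      (Prod.instMeasurableSpace (m₂ := 𝓕 q)) Subtype.val := by
    have h1 : Measurable fun c : (Ioi q ×ˢ (univ : Set Ω) : Set (Horizon T × Ω)) => c.1.1 :=
      measurable_fst_predictable.comp measurable_subtype_coe
    refine @Measurable.prodMk _ _ _ _ _ (𝓕 q) _ _ h1 (fun A hA => ?_)
    have : (fun c : (Ioi q ×ˢ (univ : Set Ω) : Set (Horizon T × Ω)) => c.1.2) ⁻¹' A =
        Subtype.val ⁻¹' (Ioi q ×ˢ A) := by
      ext ⟨p, hp⟩
      simpa using fun _ => hp.1
    rw [this]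
    exact measurable_subtype_coe (measurableSet_predictable_Ioi_prod hA)
  refine measurable_of_restrict_of_restrict_compl hS ?_ ?_
  · have : (Ioi q ×ˢ (univ : Set Ω)).domRestrict ((Ioi q ×ˢ univ).indicator g) =
        fun p => g p.1 := by
      funext p
      exact indicator_of_mem p.2 _
    rw [this]
    exact hg.comp hval
  · have : (Ioi q ×ˢ (univ : Set Ω))ᶜ.domRestrict ((Ioi q ×ˢ univ).indicator g) = fun _ => 0 := by
      funext p
      exact indicator_of_notMem p.2 _
    rw [this]
    exact measurable_const

end Predictable

/-! ### Integrals against random measures -/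

/-- A form of Tonelli's theorem for measurable families of measures that are finite, without a
uniform bound, on the pieces of a fixed countable partition. -/
theorem measurable_lintegral_of_partition {α E : Type*} [MeasurableSpace α] [MeasurableSpace E]
    {K : α → Measure E} (hK : Measurable K) {A : ℕ → Set E} (hA : ∀ n, MeasurableSet (A n))
    (hdisj : Pairwise (Function.onFun Disjoint A)) (hcov : ⋃ n, A n = univ)
    (hfin : ∀ a n, K a (A n) < ∞) {f : α × E → ℝ≥0∞} (hf : Measurable f) :
    Measurable fun a => ∫⁻ e, f (a, e) ∂(K a) := by
  have hsum (a : α) : K a = Measure.sum fun n => (K a).restrict (A n) := by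
    rw [← Measure.restrict_iUnion hdisj hA, hcov, Measure.restrict_univ]
  have hint (a : α) : ∫⁻ e, f (a, e) ∂(K a) = ∑' n, ∫⁻ e in A n, f (a, e) ∂(K a) := by
    conv_lhs => rw [hsum a, lintegral_sum_measure]
  simp_rw [hint]
  refine Measurable.tsum fun n => ?_
  let κ : Kernel α E := ⟨fun a => (K a).restrict (A n), (measurable_measure_restrict (hA n)).comp hK⟩
  have hκ : ∀ a, IsFiniteMeasure (κ a) := fun a => ⟨by
    change (K a).restrict (A n) univ < ∞
    rw [Measure.restrict_apply_univ]
    exact hfin a n⟩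
  change Measurable fun a => ∫⁻ e, f (a, e) ∂(κ a)
  refine Measurable.ennreal_induction
    (motive := fun f => Measurable fun a => ∫⁻ e, f (a, e) ∂(κ a)) ?_ ?_ ?_ hf
  · intro c s hs
    have : (fun a => ∫⁻ e, s.indicator (fun _ => c) (a, e) ∂(κ a)) =
        fun a => c * κ a (Prod.mk a ⁻¹' s) := by
      funext a
      exact lintegral_indicator_const (measurable_prodMk_left hs) c
    rw [this]
    exact (Kernel.measurable_kernel_prodMk_left_of_finite hs hκ).const_mul c
  · intro f g _ hf hg ihf ihg
    have : (fun a => ∫⁻ e, (f + g) (a, e) ∂(κ a)) =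
        fun a => ∫⁻ e, f (a, e) ∂(κ a) + ∫⁻ e, g (a, e) ∂(κ a) := by
      funext a
      exact lintegral_add_left (hf.comp measurable_prodMk_left) _
    rw [this]
    exact ihf.add ihg
  · intro F hF hmono ih
    have : (fun a => ∫⁻ e, (⨆ n, F n (a, e)) ∂(κ a)) =
        fun a => ⨆ n, ∫⁻ e, F n (a, e) ∂(κ a) := by
      funext a
      exact lintegral_iSup (fun n => (hF n).comp measurable_prodMk_left)
        fun i j hij e => hmono hij (a, e)
    simp only
    rw [this]
    exact .iSup ih

/-- The horizontal strips `[0, T] × [n, n + 1)`. -/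
def strip (T : ℝ≥0) (n : ℕ) : Set (Horizon T × ℝ≥0) := univ ×ˢ Ico (n : ℝ≥0) (n + 1)

theorem measurableSet_strip (n : ℕ) : MeasurableSet (strip T n) :=
  MeasurableSet.univ.prod measurableSet_Ico

theorem mem_strip {p : Horizon T × ℝ≥0} {n : ℕ} : p ∈ strip T n ↔ ⌊p.2⌋₊ = n := by
  rw [Nat.floor_eq_iff zero_le]
  simp [strip]

theorem pairwise_disjoint_strip : Pairwise (Function.onFun Disjoint (strip T)) := by
  intro i j hij
  refine Set.disjoint_left.2 fun p hi hj => hij ?_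
  rw [← mem_strip.1 hi, ← mem_strip.1 hj]

theorem iUnion_strip : ⋃ n, strip T n = univ :=
  eq_univ_of_forall fun _ => mem_iUnion.2 ⟨_, mem_strip.2 rfl⟩

/-- A random configuration on `[0, T] × [0, ∞)` that is finite on strips and whose restriction to
`[0, t] × [0, ∞)` is known at time `t`. -/
structure IsAdaptedNoise {Ω : Type*} [mΩ : MeasurableSpace Ω] (𝓕 : Filtration (Horizon T) mΩ)
    (x : Ω → Measure (Horizon T × ℝ≥0)) : Prop where
  finite : ∀ ω n, x ω (strip T n) < ∞
  adapted : ∀ t, Measurable[𝓕 t] fun ω => (x ω).restrict (Iic t ×ˢ univ)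

theorem sFinite_of_strip {x : Measure (Horizon T × ℝ≥0)} (h : ∀ n, x (strip T n) < ∞) :
    SFinite x := by
  have hsum : x = Measure.sum fun n => x.restrict (strip T n) := by
    rw [← Measure.restrict_iUnion pairwise_disjoint_strip measurableSet_strip, iUnion_strip,
      Measure.restrict_univ]
  have (n : ℕ) : IsFiniteMeasure (x.restrict (strip T n)) :=
    ⟨by rw [Measure.restrict_apply_univ]; exact h n⟩
  rw [hsum]
  infer_instance

section Noise

variable {Ω : Type*} [mΩ : MeasurableSpace Ω] {𝓕 : Filtration (Horizon T) mΩ}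
  {x : Ω → Measure (Horizon T × ℝ≥0)}

theorem IsAdaptedNoise.sFinite (hx : IsAdaptedNoise 𝓕 x) (ω : Ω) : SFinite (x ω) :=
  sFinite_of_strip (hx.finite ω)

theorem IsAdaptedNoise.mono {𝓖 : Filtration (Horizon T) mΩ} (hx : IsAdaptedNoise 𝓕 x)
    (h : 𝓕 ≤ 𝓖) : IsAdaptedNoise 𝓖 x :=
  ⟨hx.finite, fun t => (hx.adapted t).mono (h t) le_rfl⟩

/-- Integrals over the past `[0, q]` against adapted noise are `𝓕 q`-measurable, also when the
integrand depends measurably on an auxiliary variable. -/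
theorem IsAdaptedNoise.measurable_lintegral (hx : IsAdaptedNoise 𝓕 x) (q : Horizon T)
    {α : Type*} {mα : MeasurableSpace α} {π : α → Ω} (hπ : Measurable[mα, 𝓕 q] π)
    {f : α × (Horizon T × ℝ≥0) → ℝ≥0∞} (hf : Measurable f) :
    Measurable fun a => ∫⁻ p in Iic q ×ˢ univ, f (a, p) ∂(x (π a)) := by
  refine measurable_lintegral_of_partition ((hx.adapted q).comp hπ) measurableSet_strip
    pairwise_disjoint_strip iUnion_strip (fun a n => ?_) hf
  exact lt_of_le_of_lt (Measure.restrict_apply_le _ _) (hx.finite _ n)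

/-- Joint measurability of a predictable mark condition on the past of `q`. -/
theorem measurableSet_belowGraph_min {l : Horizon T → Ω → ℝ≥0∞}
    (hl : Measurable[𝓕.predictable] (Function.uncurry l)) (q : Horizon T)
    {α : Type*} {mα : MeasurableSpace α} {π : α → Ω} (hπ : Measurable[mα, 𝓕 q] π) :
    MeasurableSet {y : α × (Horizon T × ℝ≥0) | (y.2.2 : ℝ≥0∞) < l (min y.2.1 q) (π y.1)} := by
  refine measurableSet_lt (measurable_snd.snd.coe_nnreal_ennreal) ?_
  have h1 := hl.comp (measurable_min_predictable (𝓕 := 𝓕) q)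
  have h2 : @Measurable _ _ _ (Prod.instMeasurableSpace (m₂ := 𝓕 q))
      (fun y : α × (Horizon T × ℝ≥0) => (y.2.1, π y.1)) :=
    @Measurable.prodMk _ _ _ _ _ (𝓕 q) _ _ measurable_snd.fst (hπ.comp measurable_fst)
  exact h1.comp h2

theorem IsAdaptedNoise.measurable_thin_restrict (hx : IsAdaptedNoise 𝓕 x)
    {l : Horizon T → Ω → ℝ≥0∞} (hl : Measurable[𝓕.predictable] (Function.uncurry l))
    (t : Horizon T) {α : Type*} {mα : MeasurableSpace α} {π : α → Ω}
    (hπ : Measurable[mα, 𝓕 t] π) :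
    Measurable fun a => (thin (x (π a)) fun s => l s (π a)).restrict (Iic t) := by
  refine Measure.measurable_of_measurable_coe _ fun B hB => ?_
  have h := hx.measurable_lintegral t hπ
    (f := ({y | (y.2.2 : ℝ≥0∞) < l (min y.2.1 t) (π y.1)} ∩ {y | y.2.1 ∈ B}).indicator 1)
    (measurable_one.indicator ((measurableSet_belowGraph_min hl t hπ).inter
      (measurable_snd.fst hB)))
  convert h using 2 with a
  have hs := ((measurableSet_belowGraph_min hl t hπ).inter
      ((measurable_snd.fst : Measurable fun y : α × (Horizon T × ℝ≥0) => y.2.1) hB))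
  have hs' : MeasurableSet (Prod.mk a ⁻¹' ({y : α × (Horizon T × ℝ≥0) |
      (y.2.2 : ℝ≥0∞) < l (min y.2.1 t) (π y.1)} ∩ {y | y.2.1 ∈ B})) :=
    measurable_prodMk_left hs
  rw [Measure.restrict_apply hB, thin_apply _ _ (hB.inter measurableSet_Iic)]
  have : (fun p : Horizon T × ℝ≥0 => ({y : α × (Horizon T × ℝ≥0) |
      (y.2.2 : ℝ≥0∞) < l (min y.2.1 t) (π y.1)} ∩ {y | y.2.1 ∈ B}).indicator
        (1 : α × (Horizon T × ℝ≥0) → ℝ≥0∞) (a, p)) =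
      (Prod.mk a ⁻¹' ({y : α × (Horizon T × ℝ≥0) |
      (y.2.2 : ℝ≥0∞) < l (min y.2.1 t) (π y.1)} ∩ {y | y.2.1 ∈ B})).indicator 1 := by
    funext p; rfl
  rw [this, lintegral_indicator_one hs', Measure.restrict_apply hs']
  congr 1
  ext p
  simp only [belowGraph, mem_inter_iff, mem_prod, mem_Iic, mem_univ, and_true, mem_ofPred_eq,
    mem_preimage]
  constructor
  · rintro ⟨⟨h1, h2⟩, h3⟩
    exact ⟨⟨by rwa [min_eq_left h2], h1⟩, h2⟩
  · rintro ⟨⟨h1, h2⟩, h3⟩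
    exact ⟨⟨h2, h3⟩, by rwa [min_eq_left h3] at h1⟩

/-- Thinning adapted noise below a predictable rate gives an adapted random measure. -/
theorem IsAdaptedNoise.thin_adapted (hx : IsAdaptedNoise 𝓕 x) {l : Horizon T → Ω → ℝ≥0∞}
    (hl : Measurable[𝓕.predictable] (Function.uncurry l)) (t : Horizon T) :
    Measurable[𝓕 t] fun ω => (thin (x ω) fun s => l s ω).restrict (Iic t) :=
  hx.measurable_thin_restrict hl t (mα := 𝓕 t) (π := id) measurable_id

/-- The contribution of the past `[0, q]` to the self-exciting intensity. -/
theorem IsAdaptedNoise.measurable_excitation_past (hx : IsAdaptedNoise 𝓕 x)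
    {θ : Horizon T → Ω → Param} (hθ : Measurable[𝓕.predictable] (Function.uncurry θ))
    {l : Horizon T → Ω → ℝ≥0∞} (hl : Measurable[𝓕.predictable] (Function.uncurry l))
    (q : Horizon T) {α : Type*} {mα : MeasurableSpace α} {π : α → Ω}
    (hπ : Measurable[mα, 𝓕 q] π) {τ : α → Horizon T} (hτ : Measurable τ) :
    Measurable fun a => ∫⁻ p in Iic q ×ˢ univ,
      {p : Horizon T × ℝ≥0 | (p.2 : ℝ≥0∞) < l (min p.1 q) (π a)}.indicator
        (fun p => excitation (θ (min p.1 q) (π a)) (τ a) p.1) p ∂(x (π a)) := by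
  refine hx.measurable_lintegral q hπ (f := fun y =>
    {y : α × (Horizon T × ℝ≥0) | (y.2.2 : ℝ≥0∞) < l (min y.2.1 q) (π y.1)}.indicator
    (fun y => excitation (θ (min y.2.1 q) (π y.1)) (τ y.1) y.2.1) y) ?_
  refine Measurable.indicator ?_ (measurableSet_belowGraph_min hl q hπ)
  refine measurable_excitation ?_ (hτ.comp measurable_fst) measurable_snd.fst
  have h1 := hθ.comp (measurable_min_predictable (𝓕 := 𝓕) q)
  have h2 : @Measurable _ _ _ (Prod.instMeasurableSpace (m₂ := 𝓕 q))
      (fun y : α × (Horizon T × ℝ≥0) => (y.2.1, π y.1)) :=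
    @Measurable.prodMk _ _ _ _ _ (𝓕 q) _ _ measurable_snd.fst (hπ.comp measurable_fst)
  exact h1.comp h2

/-- An integral over `[0, t)` is the supremum of the integrals over `[0, q]`, for `q < t` in a
countable dense set. -/
theorem setLIntegral_Iio_eq_iSup {D : Set (Horizon T)} (hD : Dense D) (hDc : D.Countable)
    (N : Measure (Horizon T)) {f : Horizon T → ℝ≥0∞} (hf : Measurable f) (t : Horizon T) :
    ∫⁻ s in Iio t, f s ∂N = ⨆ q : D, if (q : Horizon T) < t then ∫⁻ s in Iic (q : Horizon T), f s ∂N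
      else 0 := by
  have : Countable D := hDc
  have h1 (q : D) : (if (q : Horizon T) < t then ∫⁻ s in Iic (q : Horizon T), f s ∂N else 0) =
      ∫⁻ s, (if (q : Horizon T) < t then (Iic (q : Horizon T)).indicator f s else 0) ∂N := by
    split_ifs
    · rw [lintegral_indicator measurableSet_Iic]
    · simp
  simp_rw [h1]
  rw [← lintegral_indicator measurableSet_Iio, ← lintegral_iSup_directed]
  · refine lintegral_congr fun s => ?_
    by_cases hs : s < t
    · obtain ⟨q, hq, hsq, hqt⟩ := hD.exists_between hs
      rw [indicator_of_mem (mem_Iio.2 hs)]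
      refine le_antisymm (le_iSup_of_le ⟨q, hq⟩ ?_) (iSup_le fun q => ?_)
      · rw [if_pos hqt, indicator_of_mem (mem_Iic.2 hsq.le)]
      · split_ifs
        · exact indicator_le_self (M := ℝ≥0∞) _ _ _
        · exact zero_le
    · rw [indicator_of_notMem (by simpa using hs)]
      refine (ENNReal.iSup_eq_zero.2 fun q => ?_).symm
      split_ifs with hq
      · exact indicator_of_notMem (M := ℝ≥0∞) (fun h : s ∈ Iic (q : Horizon T) => hs (lt_of_le_of_lt h hq)) _
      · rfl
  · intro q
    split_ifs
    · exact (hf.indicator measurableSet_Iic).aemeasurable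
    · exact aemeasurable_const
  · intro q q'
    by_cases hq : (q : Horizon T) < t
    · by_cases hq' : (q' : Horizon T) < t
      · rcases le_total q q' with h | h
        · refine ⟨q', fun s => ?_, le_rfl⟩
          simp only [if_pos hq, if_pos hq']
          exact indicator_le_indicator_of_subset (f := f)
            (Iic_subset_Iic.2 (Subtype.coe_le_coe.2 h)) (fun _ => zero_le) s
        · refine ⟨q, le_rfl, fun s => ?_⟩
          simp only [if_pos hq, if_pos hq']
          exact indicator_le_indicator_of_subset (f := f)
            (Iic_subset_Iic.2 (Subtype.coe_le_coe.2 h)) (fun _ => zero_le) s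
      · refine ⟨q, le_rfl, fun s => ?_⟩
        simp only [if_neg hq']
        exact zero_le
    · refine ⟨q', fun s => ?_, le_rfl⟩
      simp only [if_neg hq]
      exact zero_le

theorem measurable_section_of_predictable {β : Type*} [MeasurableSpace β] {u : Horizon T → Ω → β}
    (hu : Measurable[𝓕.predictable] (Function.uncurry u)) (ω : Ω) : Measurable fun s => u s ω :=
  (hu.mono predictable_le_prod le_rfl).comp measurable_prodMk_right

/-- The self-exciting intensity driven by a predictable parameter and by a predictable thinning of
adapted noise is predictable. -/
theorem IsAdaptedNoise.measurable_hawkesIntensity_thin (hx : IsAdaptedNoise 𝓕 x)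
    {θ : Horizon T → Ω → Param} (hθ : Measurable[𝓕.predictable] (Function.uncurry θ))
    {l : Horizon T → Ω → ℝ≥0∞} (hl : Measurable[𝓕.predictable] (Function.uncurry l)) :
    Measurable[𝓕.predictable] fun p : Horizon T × Ω =>
      hawkesIntensity (fun s => θ s p.2) (thin (x p.2) fun s => l s p.2) p.1 := by
  obtain ⟨D, hDc, hD⟩ := TopologicalSpace.exists_countable_dense (Horizon T)
  have : Countable D := hDc
  have key : (fun p : Horizon T × Ω =>
      hawkesIntensity (fun s => θ s p.2) (thin (x p.2) fun s => l s p.2) p.1) = fun p =>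
      ((θ p.1 p.2).1 : ℝ≥0∞) + ⨆ q : D, (Ioi (q : Horizon T) ×ˢ univ).indicator
        (fun p : Horizon T × Ω => ∫⁻ r in Iic (q : Horizon T) ×ˢ univ,
          {r : Horizon T × ℝ≥0 | (r.2 : ℝ≥0∞) < l (min r.1 q) p.2}.indicator
          (fun r => excitation (θ (min r.1 q) p.2) p.1 r.1) r ∂(x p.2)) p := by
    funext p
    have hlm := measurable_section_of_predictable hl p.2
    have hθm := measurable_section_of_predictable hθ p.2
    have hem : Measurable fun s => excitation (θ s p.2) p.1 s :=
      measurable_excitation hθm measurable_const measurable_id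
    rw [hawkesIntensity_eq, setLIntegral_Iio_eq_iSup hD hDc _ hem]
    congr 1
    refine iSup_congr fun q => ?_
    by_cases hq : (q : Horizon T) < p.1
    · rw [if_pos hq, indicator_of_mem (by simpa using hq), ← lintegral_indicator measurableSet_Iic,
        lintegral_thin _ hlm (hem.indicator measurableSet_Iic),
        ← lintegral_indicator (measurableSet_Iic.prod MeasurableSet.univ)]
      refine lintegral_congr fun r => ?_
      by_cases hr : r.1 ≤ q
      · simp [indicator, belowGraph, hr]
      · simp [indicator, hr]
    · rw [if_neg hq, indicator_of_notMem (by simpa using hq)]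
  rw [key]
  refine Measurable.add (m := 𝓕.predictable) (hθ.fst.coe_nnreal_ennreal) ?_
  refine Measurable.iSup (mδ := 𝓕.predictable) fun q => ?_
  refine measurable_indicator_Ioi_predictable _ ?_
  exact hx.measurable_excitation_past hθ hl q (mα := Prod.instMeasurableSpace (m₂ := 𝓕 q))
    (π := Prod.snd) (@measurable_snd _ _ _ (𝓕 q)) (@measurable_fst _ _ _ (𝓕 q))

/-- All the rates of the Picard iteration driven by a predictable parameter are predictable. -/
theorem IsAdaptedNoise.measurable_picard_predictable (hx : IsAdaptedNoise 𝓕 x)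
    {θ : Horizon T → Ω → Param} (hθ : Measurable[𝓕.predictable] (Function.uncurry θ)) (k : ℕ) :
    Measurable[𝓕.predictable] (Function.uncurry fun s ω => picard (fun t => θ t ω) (x ω) k s) := by
  induction k with
  | zero => exact @measurable_const _ _ _ 𝓕.predictable _
  | succ k ih => exact hx.measurable_hawkesIntensity_thin hθ ih

theorem IsAdaptedNoise.measurable_limitRate_predictable (hx : IsAdaptedNoise 𝓕 x)
    {θ : Horizon T → Ω → Param} (hθ : Measurable[𝓕.predictable] (Function.uncurry θ)) :
    Measurable[𝓕.predictable]
      (Function.uncurry fun s ω => limitRate (fun t => θ t ω) (x ω) s) :=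
  Measurable.iSup (mδ := 𝓕.predictable)
    fun k => hx.measurable_picard_predictable hθ k

end Noise

/-! ### Lebesgue measure on the horizon and on the mark space -/

theorem measurableEmbedding_coe_nnreal : MeasurableEmbedding (fun z : ℝ≥0 => (z : ℝ)) :=
  MeasurableEmbedding.subtype_coe measurableSet_Ici

theorem measurableEmbedding_coe_horizon :
    MeasurableEmbedding (fun t : Horizon T => ((t : ℝ≥0) : ℝ)) :=
  measurableEmbedding_coe_nnreal.comp (MeasurableEmbedding.subtype_coe measurableSet_Iic)

theorem lebesgue_apply (B : Set (Horizon T)) :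
    lebesgue T B = volume ((fun t : Horizon T => ((t : ℝ≥0) : ℝ)) '' B) :=
  measurableEmbedding_coe_horizon.comap_apply _ _

theorem levelMeasure_apply (B : Set ℝ≥0) :
    levelMeasure B = volume ((fun z : ℝ≥0 => (z : ℝ)) '' B) :=
  measurableEmbedding_coe_nnreal.comap_apply _ _

theorem image_coe_Ioc_horizon (s t : Horizon T) :
    (fun t : Horizon T => ((t : ℝ≥0) : ℝ)) '' Ioc s t = Ioc ((s : ℝ≥0) : ℝ) ((t : ℝ≥0) : ℝ) := by
  ext u
  constructor
  · rintro ⟨v, hv, rfl⟩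
    exact ⟨by exact_mod_cast hv.1, by exact_mod_cast hv.2⟩
  · rintro ⟨h1, h2⟩
    have h0 : 0 ≤ u := le_trans s.1.2 h1.le
    have hT : (⟨u, h0⟩ : ℝ≥0) ≤ T := le_trans (show (⟨u, h0⟩ : ℝ≥0) ≤ (t : ℝ≥0) from h2) t.2
    exact ⟨⟨⟨u, h0⟩, hT⟩, ⟨h1, h2⟩, rfl⟩

theorem lebesgue_Ioc (s t : Horizon T) :
    lebesgue T (Ioc s t) = ENNReal.ofReal (((t : ℝ≥0) : ℝ) - ((s : ℝ≥0) : ℝ)) := by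
  rw [lebesgue_apply, image_coe_Ioc_horizon, Real.volume_Ioc]

instance : NullSingletonClass (lebesgue T) :=
  ⟨fun t => by rw [lebesgue_apply, image_singleton]; exact measure_singleton _⟩

instance : IsFiniteMeasure (lebesgue T) := ⟨by
  have h : (univ : Set (Horizon T)) ⊆ {⊥} ∪ Ioc ⊥ ⊤ := fun t _ => by
    rcases eq_or_lt_of_le (bot_le : ⊥ ≤ t) with h | h
    · exact Or.inl h.symm
    · exact Or.inr ⟨h, le_top⟩
  refine lt_of_le_of_lt (measure_mono h) (lt_of_le_of_lt (measure_union_le _ _) ?_)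
  rw [measure_singleton, lebesgue_Ioc, zero_add]
  exact ENNReal.ofReal_lt_top⟩

theorem levelMeasure_Ico (a b : ℝ≥0) : levelMeasure (Ico a b) = b - a := by
  have : (fun z : ℝ≥0 => (z : ℝ)) '' Ico a b = Ico (a : ℝ) b := by
    ext u
    constructor
    · rintro ⟨v, hv, rfl⟩
      exact ⟨by exact_mod_cast hv.1, by exact_mod_cast hv.2⟩
    · rintro ⟨h1, h2⟩
      exact ⟨⟨u, le_trans a.2 h1⟩, ⟨h1, h2⟩, rfl⟩
  rw [levelMeasure_apply, this, Real.volume_Ico, ENNReal.ofReal_sub _ a.coe_nonneg]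
  simp

/-- The length of the set of marks below the level `c` is `c`. -/
theorem levelMeasure_lt (c : ℝ≥0∞) : levelMeasure {z | (z : ℝ≥0∞) < c} = c := by
  induction c with
  | top =>
    have : (fun z : ℝ≥0 => (z : ℝ)) '' {z | (z : ℝ≥0∞) < ∞} = Ici (0 : ℝ) := by
      ext u
      constructor
      · rintro ⟨v, _, rfl⟩
        exact v.2
      · intro h
        exact ⟨⟨u, h⟩, ENNReal.coe_lt_top, rfl⟩
    rw [levelMeasure_apply, this, Real.volume_Ici]
  | coe c =>
    have : {z : ℝ≥0 | (z : ℝ≥0∞) < c} = Ico 0 c := by ext z; simp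
    rw [this, levelMeasure_Ico]
    simp

instance : SFinite levelMeasure := by
  have hcov : ⋃ n : ℕ, Iio (n : ℝ≥0) = univ := eq_univ_of_forall fun z => by
    obtain ⟨n, hn⟩ := exists_nat_gt z
    exact mem_iUnion.2 ⟨n, hn⟩
  have : SigmaFinite levelMeasure := ⟨⟨⟨fun n => Iio (n : ℝ≥0), fun _ => trivial, fun n => by
    have : Iio (n : ℝ≥0) = Ico 0 (n : ℝ≥0) := by ext; simp
    rw [this, levelMeasure_Ico]
    simp, hcov⟩⟩⟩
  infer_instance

theorem lintegral_lebesgue_le (h : ℝ → ℝ≥0∞) :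
    ∫⁻ t : Horizon T, h ((t : ℝ≥0) : ℝ) ∂(lebesgue T) ≤ ∫⁻ u, h u := by
  rw [← measurableEmbedding_coe_horizon.lintegral_map (μ := lebesgue T) h]
  refine lintegral_mono' ?_ le_rfl
  rw [lebesgue, measurableEmbedding_coe_horizon.map_comap]
  exact Measure.restrict_le_self

theorem lintegral_exp_decay {b : ℝ} (hb : 0 < b) (s : ℝ) :
    ∫⁻ u in Ioi s, ENNReal.ofReal (Real.exp (-(b * (u - s)))) = ENNReal.ofReal b⁻¹ := by
  have h1 : (fun u => Real.exp (-(b * (u - s)))) =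
      fun u => Real.exp (b * s) * Real.exp (-b * u) := by
    funext u
    rw [← Real.exp_add]
    ring_nf
  have hint : IntegrableOn (fun u => Real.exp (-(b * (u - s)))) (Ioi s) := by
    rw [h1]
    exact (integrableOn_exp_mul_Ioi (neg_lt_zero.2 hb) s).const_mul _
  rw [← ofReal_integral_eq_lintegral_ofReal hint (ae_of_all _ fun u => (Real.exp_pos _).le), h1,
    integral_const_mul, integral_exp_mul_Ioi (neg_lt_zero.2 hb)]
  congr 1
  rw [neg_div_neg_eq, mul_div_assoc', ← Real.exp_add]
  simp

/-- The total excitation produced by one event is at most the ratio of its parameters. -/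
theorem lintegral_excitation_le {q : Param} {r : ℝ≥0} (h : q.2.1 ≤ r * q.2.2) (s : Horizon T) :
    ∫⁻ t in Ioi s, excitation q t s ∂(lebesgue T) ≤ r := by
  unfold excitation
  by_cases hb : q.2.2 = 0
  · have : q.2.1 = 0 := by simpa [hb] using h
    simp [this]
  have hb' : (0 : ℝ) < q.2.2 := by positivity
  have hm : Measurable fun u : ℝ =>
      ENNReal.ofReal (Real.exp (-((q.2.2 : ℝ) * (u - ((s : ℝ≥0) : ℝ))))) := by fun_prop
  rw [← lintegral_indicator measurableSet_Ioi]
  have hle := lintegral_lebesgue_le (T := T)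
    (h := (Ioi ((s : ℝ≥0) : ℝ)).indicator fun u => (q.2.1 : ℝ≥0∞) *
      ENNReal.ofReal (Real.exp (-((q.2.2 : ℝ) * (u - ((s : ℝ≥0) : ℝ))))))
  refine le_trans (le_of_eq ?_) (hle.trans ?_)
  · refine lintegral_congr fun t => ?_
    by_cases ht : s < t
    · rw [indicator_of_mem (mem_Ioi.2 ht), indicator_of_mem]
      exact_mod_cast ht
    · rw [indicator_of_notMem (by simpa using ht), indicator_of_notMem]
      simpa using ht
  · rw [lintegral_indicator measurableSet_Ioi, lintegral_const_mul _ hm, lintegral_exp_decay hb',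
      ← ENNReal.ofReal_coe_nnreal, ← ENNReal.ofReal_mul (NNReal.coe_nonneg _), ← ENNReal.ofReal_coe_nnreal]
    refine ENNReal.ofReal_le_ofReal ?_
    rw [← div_eq_mul_inv, div_le_iff₀ hb']
    exact_mod_cast h

/-- With excitation ratio at most `r`, the integrated intensity is at most the integrated base rate
plus `r` times the number of events, by exchanging the order of integration. -/
theorem lintegral_hawkesIntensity_le {θ : Horizon T → Param} (hθ : Measurable θ)
    (N : Measure (Horizon T)) [SFinite N] {r : ℝ≥0} (h : ∀ s, (θ s).2.1 ≤ r * (θ s).2.2) :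
    ∫⁻ t, hawkesIntensity θ N t ∂(lebesgue T) ≤
      ∫⁻ t, ((θ t).1 : ℝ≥0∞) ∂(lebesgue T) + r * N univ := by
  simp_rw [hawkesIntensity_eq]
  rw [lintegral_add_left hθ.fst.coe_nnreal_ennreal]
  gcongr
  have hm : Measurable fun p : Horizon T × Horizon T =>
      {p : Horizon T × Horizon T | p.2 < p.1}.indicator
        (fun p => excitation (θ p.2) p.1 p.2) p :=
    (measurable_excitation (hθ.comp measurable_snd) measurable_fst measurable_snd).indicator
      (measurableSet_lt measurable_snd measurable_fst)
  calc ∫⁻ t, ∫⁻ s in Iio t, excitation (θ s) t s ∂N ∂(lebesgue T)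
      = ∫⁻ t, ∫⁻ s, {p : Horizon T × Horizon T | p.2 < p.1}.indicator
        (fun p => excitation (θ p.2) p.1 p.2) (t, s) ∂N ∂(lebesgue T) := by
        refine lintegral_congr fun t => ?_
        rw [← lintegral_indicator measurableSet_Iio]
        rfl
    _ = ∫⁻ s, ∫⁻ t, {p : Horizon T × Horizon T | p.2 < p.1}.indicator
        (fun p => excitation (θ p.2) p.1 p.2) (t, s) ∂(lebesgue T) ∂N :=
        lintegral_lintegral_swap hm.aemeasurable
    _ = ∫⁻ s, ∫⁻ t in Ioi s, excitation (θ s) t s ∂(lebesgue T) ∂N := by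
        refine lintegral_congr fun s => ?_
        rw [← lintegral_indicator measurableSet_Ioi]
        rfl
    _ ≤ ∫⁻ _, r ∂N := lintegral_mono fun s => lintegral_excitation_le (h s) s
    _ = r * N univ := by rw [lintegral_const]

/-- An atomless measure, stopped when its mass exceeds `K`, keeps mass at most `K`. -/
theorem measure_setOf_Iio_le (m : Measure (Horizon T)) [NullSingletonClass m] (K : ℝ≥0∞) :
    m {s | m (Iio s) ≤ K} ≤ K := by
  set S := {s | m (Iio s) ≤ K}
  obtain ⟨D, hDc, hD⟩ := TopologicalSpace.exists_countable_dense (Horizon T)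
  have hcover : S ⊆ {s | s ∈ S ∧ ∀ s' ∈ S, s' ≤ s} ∪ ⋃ q : ↥(D ∩ S), Iio (q : Horizon T) := by
    intro s hs
    by_cases h : ∀ s' ∈ S, s' ≤ s
    · exact Or.inl ⟨hs, h⟩
    · push Not at h
      obtain ⟨s', hs', hlt⟩ := h
      obtain ⟨q, hq, hsq, hqs⟩ := hD.exists_between hlt
      refine Or.inr (mem_iUnion.2 ⟨⟨q, hq, ?_⟩, hsq⟩)
      exact le_trans (measure_mono (Iio_subset_Iio hqs.le)) hs'
  have hsub : {s | s ∈ S ∧ ∀ s' ∈ S, s' ≤ s}.Subsingleton := fun s hs s' hs' =>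
    le_antisymm (hs'.2 s hs.1) (hs.2 s' hs'.1)
  have : Countable ↥(D ∩ S) := hDc.mono inter_subset_left
  calc m S ≤ m {s | s ∈ S ∧ ∀ s' ∈ S, s' ≤ s} + m (⋃ q : ↥(D ∩ S), Iio (q : Horizon T)) :=
        (measure_mono hcover).trans (measure_union_le _ _)
    _ = m (⋃ q : ↥(D ∩ S), Iio (q : Horizon T)) := by
        rw [hsub.measure_zero m, zero_add]
    _ = ⨆ q : ↥(D ∩ S), m (Iio (q : Horizon T)) := by
        refine Directed.measure_iUnion fun q q' => ?_
        rcases le_total q q' with h | h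
        · exact ⟨q', Iio_subset_Iio h, subset_rfl⟩
        · exact ⟨q, subset_rfl, Iio_subset_Iio h⟩
    _ ≤ K := iSup_le fun q => q.2.2

/-! ### Thinning Poisson noise -/

/-- The properties of a unit rate Poisson random measure on `[0, T] × [0, ∞)` relative to a
filtration that the thinning construction uses: adaptedness, Campbell's formula for predictable
integrands, and almost sure simplicity of the time projection on bounded mark sets. -/
structure IsDrivingNoise {Ω : Type*} [mΩ : MeasurableSpace Ω] (P : Measure Ω)
    (𝓕 : Filtration (Horizon T) mΩ) (x : Ω → Measure (Horizon T × ℝ≥0)) : Prop extends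
    IsAdaptedNoise 𝓕 x where
  campbell : ∀ C : (Horizon T × Ω) × ℝ≥0 → ℝ≥0∞,
    Measurable[Prod.instMeasurableSpace (m₁ := 𝓕.predictable)] C →
    ∫⁻ ω, ∫⁻ p, C ((p.1, ω), p.2) ∂(x ω) ∂P =
      ∫⁻ ω, ∫⁻ s, ∫⁻ z, C ((s, ω), z) ∂levelMeasure ∂(lebesgue T) ∂P
  simple : ∀ᵐ ω ∂P, ∀ m : ℕ, ∃ S : Finset (Horizon T × ℝ≥0),
    Set.InjOn Prod.fst (S : Set (Horizon T × ℝ≥0)) ∧ (∀ p ∈ S, p.1 ≠ ⊥) ∧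
      (x ω).restrict (univ ×ˢ Iio (m : ℝ≥0)) = ∑ p ∈ S, Measure.dirac p

/-- A simple configuration whose thinning has finite mass thins to the counting measure of a
finite set. -/
theorem exists_finset_thin {x : Measure (Horizon T × ℝ≥0)}
    (hx : ∀ m : ℕ, ∃ S : Finset (Horizon T × ℝ≥0),
      Set.InjOn Prod.fst (S : Set (Horizon T × ℝ≥0)) ∧ (∀ p ∈ S, p.1 ≠ ⊥) ∧
        x.restrict (univ ×ˢ Iio (m : ℝ≥0)) = ∑ p ∈ S, Measure.dirac p)
    {l : Horizon T → ℝ≥0∞} (hl : Measurable l) (hfin : thin x l univ < ∞) :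
    ∃ S : Finset (Horizon T), ⊥ ∉ S ∧ thin x l = ∑ s ∈ S, Measure.dirac s := by
  classical
  choose S hinj hbot hS using hx
  let R : ℕ → Finset (Horizon T) := fun m => ((S m).filter (· ∈ belowGraph l)).image Prod.fst
  have hR (m : ℕ) (B : Set (Horizon T)) (hB : MeasurableSet B) :
      (∑ s ∈ R m, Measure.dirac s) B =
        x (B ×ˢ univ ∩ belowGraph l ∩ univ ×ˢ Iio (m : ℝ≥0)) := by
    have hBm : MeasurableSet (B ×ˢ (univ : Set ℝ≥0) ∩ belowGraph l) :=
      (hB.prod MeasurableSet.univ).inter (measurableSet_belowGraph hl)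
    rw [← Measure.restrict_apply hBm, hS m, Finset.sum_image, Finset.sum_filter]
    · simp only [Measure.coe_finsetSum, Finset.sum_apply]
      refine Finset.sum_congr rfl fun p _ => ?_
      rw [Measure.dirac_apply' _ hBm]
      by_cases hp : p ∈ belowGraph l
      · simp only [hp, if_true, Measure.dirac_apply' _ hB]
        simp [indicator, hp]
      · simp [indicator, hp]
    · exact (hinj m).mono fun p hp => (Finset.mem_filter.1 hp).1
  have hRmono : Monotone R := by
    intro m n hmn s hs
    have h1 : (1 : ℝ≥0∞) ≤ (∑ s ∈ R n, Measure.dirac s) {s} := by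
      rw [hR n _ (measurableSet_singleton s)]
      refine le_trans ?_ (measure_mono (inter_subset_inter_right _
        (prod_mono subset_rfl (Iio_subset_Iio (Nat.cast_le.2 hmn)))))
      rw [← hR m _ (measurableSet_singleton s)]
      simp [Measure.coe_finsetSum, hs]
    by_contra hns
    simp [Measure.coe_finsetSum, hns] at h1
  have hcard (m : ℕ) : ((R m).card : ℝ≥0∞) ≤ thin x l univ := by
    have := hR m univ MeasurableSet.univ
    simp only [Measure.coe_finsetSum, Finset.sum_apply, measure_univ, Finset.sum_const,
      nsmul_eq_mul, mul_one] at this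
    rw [this, thin_apply _ _ MeasurableSet.univ]
    exact measure_mono inter_subset_left
  obtain ⟨n, hn⟩ := ENNReal.exists_nat_gt hfin.ne
  have hbdd : BddAbove (range fun m => (R m).card) := ⟨n, by
    rintro _ ⟨m, rfl⟩
    exact_mod_cast (hcard m).trans hn.le⟩
  -- The cardinalities stabilise, hence so do the sets.
  obtain ⟨M, hM⟩ := Nat.sSup_mem (range_nonempty _) hbdd
  have hstab (m : ℕ) : R m ⊆ R M := by
    rcases le_total m M with h | h
    · exact hRmono h
    · refine (Finset.eq_of_subset_of_card_le (hRmono h) ?_).symm.subset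
      have := le_csSup hbdd (mem_range_self m)
      exact this.trans hM.symm.le
  refine ⟨R M, ?_, Measure.ext fun B hB => ?_⟩
  · intro h
    obtain ⟨p, hp, hp'⟩ := Finset.mem_image.1 h
    exact hbot M p (Finset.mem_filter.1 hp).1 hp'
  · have hU : B ×ˢ univ ∩ belowGraph l =
        ⋃ m : ℕ, B ×ˢ univ ∩ belowGraph l ∩ univ ×ˢ Iio (m : ℝ≥0) := by
      rw [← inter_iUnion, eq_comm, inter_eq_left]
      intro p _
      obtain ⟨m, hm⟩ := exists_nat_gt p.2
      exact mem_iUnion.2 ⟨m, mem_univ _, hm⟩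
    have hmono : Monotone fun m : ℕ => B ×ˢ univ ∩ belowGraph l ∩
        (univ : Set (Horizon T)) ×ˢ Iio (m : ℝ≥0) := fun i j hij =>
      inter_subset_inter_right _ (prod_mono subset_rfl (Iio_subset_Iio (Nat.cast_le.2 hij)))
    rw [thin_apply _ _ hB, hU, hmono.measure_iUnion]
    simp_rw [← hR _ B hB]
    refine le_antisymm (iSup_le fun m => ?_) (le_iSup (fun m => (∑ s ∈ R m, Measure.dirac s) B) M)
    simp only [Measure.coe_finsetSum, Finset.sum_apply]
    exact Finset.sum_le_sum_of_subset (hstab m)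

section Construction

variable {Ω : Type*} [mΩ : MeasurableSpace Ω] {P : Measure Ω} {𝓕 : Filtration (Horizon T) mΩ}
  {x : Ω → Measure (Horizon T × ℝ≥0)}

/-- Campbell's formula for a predictable thinning. -/
theorem IsDrivingNoise.lintegral_thin (hx : IsDrivingNoise P 𝓕 x) {l C : Horizon T → Ω → ℝ≥0∞}
    (hl : Measurable[𝓕.predictable] (Function.uncurry l))
    (hC : Measurable[𝓕.predictable] (Function.uncurry C)) :
    ∫⁻ ω, ∫⁻ s, C s ω ∂(thin (x ω) fun s => l s ω) ∂P =
      ∫⁻ ω, ∫⁻ s, C s ω * l s ω ∂(lebesgue T) ∂P := by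
  let F : (Horizon T × Ω) × ℝ≥0 → ℝ≥0∞ :=
    {y | (y.2 : ℝ≥0∞) < l y.1.1 y.1.2}.indicator fun y => C y.1.1 y.1.2
  have hF : Measurable[Prod.instMeasurableSpace (m₁ := 𝓕.predictable)] F := by
    let _ : MeasurableSpace (Horizon T × Ω) := 𝓕.predictable
    refine Measurable.indicator (hC.comp measurable_fst) ?_
    exact measurableSet_lt (measurable_snd.coe_nnreal_ennreal) (hl.comp measurable_fst)
  have h := hx.campbell F hF
  convert h using 1
  · refine lintegral_congr fun ω => ?_
    rw [HawkesExistence.lintegral_thin _ (measurable_section_of_predictable hl ω)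
      (measurable_section_of_predictable hC ω)]
    rfl
  · refine lintegral_congr fun ω => lintegral_congr fun s => ?_
    have hs : MeasurableSet {z : ℝ≥0 | (z : ℝ≥0∞) < l s ω} :=
      measurableSet_lt measurable_coe_nnreal_ennreal measurable_const
    have : (fun z => F ((s, ω), z)) = {z : ℝ≥0 | (z : ℝ≥0∞) < l s ω}.indicator fun _ => C s ω :=
      rfl
    rw [this, lintegral_indicator_const hs, levelMeasure_lt]

/-- Subcriticality: if the excitation ratio is at most `r < 1` and the integrated base rate at most
`K`, then the expected integrated rate satisfies `e ≤ K + r e` along the Picard iteration, so it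
stays below `K / (1 - r)`. -/
theorem IsDrivingNoise.lintegral_limitRate_lt_top [IsProbabilityMeasure P]
    (hx : IsDrivingNoise P 𝓕 x) {θ : Horizon T → Ω → Param}
    (hθ : Measurable[𝓕.predictable] (Function.uncurry θ)) {r K : ℝ≥0} (hr : r < 1)
    (hratio : ∀ ω s, (θ s ω).2.1 ≤ r * (θ s ω).2.2)
    (hbase : ∀ ω, ∫⁻ s, ((θ s ω).1 : ℝ≥0∞) ∂(lebesgue T) ≤ K) :
    ∫⁻ ω, ∫⁻ s, limitRate (fun t => θ t ω) (x ω) s ∂(lebesgue T) ∂P < ∞ := by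
  have hpm (k : ℕ) : Measurable (Function.uncurry fun ω s => picard (fun t => θ t ω) (x ω) k s) :=
    ((hx.measurable_picard_predictable hθ k).mono predictable_le_prod le_rfl).comp measurable_swap
  have hstep (k : ℕ) : ∫⁻ ω, ∫⁻ s, picard (fun t => θ t ω) (x ω) (k + 1) s ∂(lebesgue T) ∂P ≤
      K + r * ∫⁻ ω, ∫⁻ s, picard (fun t => θ t ω) (x ω) k s ∂(lebesgue T) ∂P := by
    have hc := hx.lintegral_thin (hx.measurable_picard_predictable hθ k) (C := fun _ _ => 1)
      (@measurable_const _ _ _ 𝓕.predictable _)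
    simp only [lintegral_const, one_mul] at hc
    rw [← hc]
    calc ∫⁻ ω, ∫⁻ s, picard (fun t => θ t ω) (x ω) (k + 1) s ∂(lebesgue T) ∂P
        ≤ ∫⁻ ω, (K + r * thin (x ω) (picard (fun t => θ t ω) (x ω) k) univ) ∂P := by
          refine lintegral_mono fun ω => ?_
          have := hx.sFinite ω
          refine (lintegral_hawkesIntensity_le (measurable_section_of_predictable hθ ω) _
            (hratio ω)).trans ?_
          gcongr
          exact hbase ω
      _ = K + r * ∫⁻ ω, thin (x ω) (picard (fun t => θ t ω) (x ω) k) univ ∂P := by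
          rw [lintegral_add_left measurable_const, lintegral_const_mul' _ _ ENNReal.coe_ne_top]
          simp
  have hbound (k : ℕ) : ∫⁻ ω, ∫⁻ s, picard (fun t => θ t ω) (x ω) k s ∂(lebesgue T) ∂P ≤
      ((K / (1 - r) : ℝ≥0) : ℝ≥0∞) := by
    induction k with
    | zero => simp [picard]
    | succ k ih =>
      refine (hstep k).trans ?_
      have hfix : K + r * (K / (1 - r)) = K / (1 - r) := by
        have h1 : (1 - r : ℝ≥0) ≠ 0 := (tsub_pos_of_lt hr).ne'
        have h2 : K = (1 - r) * (K / (1 - r)) := by field_simp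
        calc K + r * (K / (1 - r)) = (1 - r) * (K / (1 - r)) + r * (K / (1 - r)) := by
              conv_lhs => rw [h2]
              field_simp
          _ = ((1 - r) + r) * (K / (1 - r)) := by ring
          _ = K / (1 - r) := by rw [tsub_add_cancel_of_le hr.le, one_mul]
      rw [← hfix]
      push_cast
      gcongr
  have hsup : ∫⁻ ω, ∫⁻ s, limitRate (fun t => θ t ω) (x ω) s ∂(lebesgue T) ∂P =
      ⨆ k, ∫⁻ ω, ∫⁻ s, picard (fun t => θ t ω) (x ω) k s ∂(lebesgue T) ∂P := by
    rw [← lintegral_iSup]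
    · refine lintegral_congr fun ω => ?_
      unfold limitRate
      exact lintegral_iSup (fun k => (hpm k).comp measurable_prodMk_left) (monotone_picard _ _)
    · exact fun k => (hpm k).lintegral_prod_right
    · exact fun i j hij ω => lintegral_mono (monotone_picard _ _ hij)
  rw [hsup]
  exact lt_of_le_of_lt (iSup_le hbound) ENNReal.coe_lt_top

/-- The integral of a predictable nonnegative process up to (and excluding) time `t` is
predictable. -/
theorem measurable_setLIntegral_Iio_predictable {u : Horizon T → Ω → ℝ≥0∞}
    (hu : Measurable[𝓕.predictable] (Function.uncurry u)) :
    Measurable[𝓕.predictable]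
      fun p : Horizon T × Ω => ∫⁻ s in Iio p.1, u s p.2 ∂(lebesgue T) := by
  obtain ⟨D, hDc, hD⟩ := TopologicalSpace.exists_countable_dense (Horizon T)
  have : Countable D := hDc
  have key : (fun p : Horizon T × Ω => ∫⁻ s in Iio p.1, u s p.2 ∂(lebesgue T)) = fun p =>
      ⨆ q : D, (Ioi (q : Horizon T) ×ˢ univ).indicator
        (fun p : Horizon T × Ω => ∫⁻ s in Iic (q : Horizon T), u (min s q) p.2 ∂(lebesgue T)) p := by
    funext p
    rw [setLIntegral_Iio_eq_iSup hD hDc _ (measurable_section_of_predictable hu p.2)]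
    refine iSup_congr fun q => ?_
    by_cases hq : (q : Horizon T) < p.1
    · rw [if_pos hq, indicator_of_mem (by simpa using hq)]
      exact setLIntegral_congr_fun measurableSet_Iic fun s hs => by rw [min_eq_left hs]
    · rw [if_neg hq, indicator_of_notMem (by simpa using hq)]
  rw [key]
  refine Measurable.iSup (mδ := 𝓕.predictable) fun q => measurable_indicator_Ioi_predictable _ ?_
  have h1 := hu.comp (measurable_min_predictable (𝓕 := 𝓕) (q : Horizon T))
  have h2 := @Measurable.lintegral_prod_left' _ _ _ (𝓕 q)
    ((lebesgue T).restrict (Iic (q : Horizon T))) _ _ h1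
  exact h2.comp (@measurable_snd _ _ _ (𝓕 q))

/-- Almost surely, the limit rate of the Picard iteration is integrable. -/
theorem IsDrivingNoise.ae_lintegral_limitRate_lt_top [IsProbabilityMeasure P]
    (hx : IsDrivingNoise P 𝓕 x) {θ : Horizon T → Ω → Param}
    (hθ : Measurable[𝓕.predictable] (Function.uncurry θ))
    (hratio : ∀ᵐ ω ∂P, (⨆ t, ((θ t ω).2.1 : ℝ≥0∞) / ((θ t ω).2.2 : ℝ≥0∞)) < 1)
    (hbase : ∀ᵐ ω ∂P, (∫⁻ t, ((θ t ω).1 : ℝ≥0∞) ∂(lebesgue T)) < ∞) :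
    ∀ᵐ ω ∂P, ∫⁻ s, limitRate (fun t => θ t ω) (x ω) s ∂(lebesgue T) < ∞ ∧
      hawkesPath (fun t => θ t ω) (x ω) univ < ∞ := by
  -- Truncation at the levels `r` and `K`; it leaves the path unchanged on the event that the ratio
  -- is at most `r` and that the integrated base rate is at most `K`.
  let base : Horizon T → Ω → ℝ≥0∞ := fun t ω => ∫⁻ s in Iio t, ((θ s ω).1 : ℝ≥0∞) ∂(lebesgue T)
  let θ' : ℝ≥0 → ℝ≥0 → Horizon T → Ω → Param := fun r K t ω =>
    (if base t ω ≤ K then (θ t ω).1 else 0,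
      if (θ t ω).2.1 ≤ r * (θ t ω).2.2 then (θ t ω).2.1 else 0, (θ t ω).2.2)
  have hbasem : Measurable[𝓕.predictable] (Function.uncurry base) :=
    measurable_setLIntegral_Iio_predictable (u := fun s ω => ((θ s ω).1 : ℝ≥0∞))
      hθ.fst.coe_nnreal_ennreal
  have hθ' (r K : ℝ≥0) : Measurable[𝓕.predictable] (Function.uncurry (θ' r K)) := by
    let _ : MeasurableSpace (Horizon T × Ω) := 𝓕.predictable
    refine Measurable.prodMk ?_ (Measurable.prodMk ?_ hθ.snd.snd)
    · exact Measurable.ite (measurableSet_le hbasem measurable_const) hθ.fst measurable_const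
    · exact Measurable.ite (measurableSet_le hθ.snd.fst (hθ.snd.snd.const_mul r)) hθ.snd.fst
        measurable_const
  have hfin (r K : ℝ≥0) (hr : r < 1) : ∀ᵐ ω ∂P,
      ∫⁻ s, limitRate (fun t => θ' r K t ω) (x ω) s ∂(lebesgue T) < ∞ ∧
        hawkesPath (fun t => θ' r K t ω) (x ω) univ < ∞ := by
    have hI := hx.lintegral_limitRate_lt_top (hθ' r K) (K := K) hr (fun ω s => by
        by_cases h : (θ s ω).2.1 ≤ r * (θ s ω).2.2 <;> simp [θ', h]) (fun ω => by
        have hν : Measurable fun s => ((θ s ω).1 : ℝ≥0∞) :=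
          (measurable_section_of_predictable hθ ω).fst.coe_nnreal_ennreal
        let m := (lebesgue T).withDensity fun s => ((θ s ω).1 : ℝ≥0∞)
        have hm : NullSingletonClass m :=
          ⟨fun s => withDensity_absolutelyContinuous _ _ (measure_singleton s)⟩
        have hbase_eq (t : Horizon T) : m (Iio t) = base t ω := withDensity_apply _ measurableSet_Iio
        have hset : MeasurableSet {s | m (Iio s) ≤ K} := by
          simp_rw [hbase_eq]
          exact measurableSet_le (measurable_section_of_predictable hbasem ω) measurable_const
        refine le_trans (le_of_eq ?_) (measure_setOf_Iio_le m K)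
        rw [withDensity_apply _ hset, ← lintegral_indicator hset]
        refine lintegral_congr fun s => ?_
        by_cases h : base s ω ≤ K
        · rw [indicator_of_mem (show s ∈ {s | m (Iio s) ≤ K} by
            change m (Iio s) ≤ K
            rwa [hbase_eq])]
          simp [θ', h]
        · rw [indicator_of_notMem (show s ∉ {s | m (Iio s) ≤ K} by
            change ¬ m (Iio s) ≤ K
            rwa [hbase_eq])]
          simp [θ', h])
    have hlm := hx.measurable_limitRate_predictable (hθ' r K)
    have hN := hx.lintegral_thin hlm (C := fun _ _ => 1) (@measurable_const _ _ _ 𝓕.predictable _)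
    simp only [lintegral_const, one_mul] at hN
    have hlm' : Measurable (Function.uncurry fun ω s => limitRate (fun t => θ' r K t ω) (x ω) s) :=
      (hlm.mono predictable_le_prod le_rfl).comp measurable_swap
    have hNm : Measurable fun ω => hawkesPath (fun t => θ' r K t ω) (x ω) univ := by
      have h1 := (hx.thin_adapted hlm ⊤).mono (𝓕.le ⊤) le_rfl
      simp only [Iic_top, Measure.restrict_univ] at h1
      exact (Measure.measurable_coe MeasurableSet.univ).comp h1
    filter_upwards [ae_lt_top hlm'.lintegral_prod_right hI.ne,
      ae_lt_top hNm (by rw [← hN] at hI; exact hI.ne)] with ω h1 h2 using ⟨h1, h2⟩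
  have hall : ∀ᵐ ω ∂P, ∀ (q : ℚ) (K : ℕ), (q : ℝ).toNNReal < 1 →
      ∫⁻ s, limitRate (fun t => θ' (q : ℝ).toNNReal K t ω) (x ω) s ∂(lebesgue T) < ∞ ∧
        hawkesPath (fun t => θ' (q : ℝ).toNNReal K t ω) (x ω) univ < ∞ := by
    refine ae_all_iff.2 fun q => ae_all_iff.2 fun K => ?_
    by_cases hq : (q : ℝ).toNNReal < 1
    · filter_upwards [hfin _ K hq] with ω h _ using h
    · exact ae_of_all _ fun ω h => absurd h hq
  filter_upwards [hall, hratio, hbase] with ω h1 h2 h3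
  obtain ⟨q, _, hq1, hq2⟩ := ENNReal.lt_iff_exists_rat_btwn.1 h2
  obtain ⟨K, hK⟩ := ENNReal.exists_nat_gt h3.ne
  have hq2' : (q : ℝ).toNNReal < 1 := by exact_mod_cast hq2
  have heq : (fun t => θ' (q : ℝ).toNNReal K t ω) = fun t => θ t ω := by
    funext t
    have hb : base t ω ≤ (K : ℝ≥0) := by
      refine (setLIntegral_le_lintegral _ _).trans ?_
      exact_mod_cast hK.le
    have hr : (θ t ω).2.1 ≤ (q : ℝ).toNNReal * (θ t ω).2.2 := by
      have h4 := (le_iSup (fun t => ((θ t ω).2.1 : ℝ≥0∞) / ((θ t ω).2.2 : ℝ≥0∞)) t).trans hq1.le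
      have h5 := (ENNReal.div_le_iff_le_mul (Or.inr ENNReal.coe_ne_top)
        (Or.inl ENNReal.coe_ne_top)).1 h4
      exact_mod_cast h5
    have hb' : base t ω ≤ (K : ℝ≥0∞) := by exact_mod_cast hb
    simp [θ', hb', hr]
  have h6 := h1 q K hq2'
  rwa [heq] at h6

/-- The thinning construction yields a doubly stochastic Hawkes process. -/
theorem IsDrivingNoise.isHawkesProcess [IsProbabilityMeasure P]
    (hx : IsDrivingNoise P 𝓕 x) {θ : Horizon T → Ω → Param}
    (hθ : Measurable[𝓕.predictable] (Function.uncurry θ))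
    (hratio : ∀ᵐ ω ∂P, (⨆ t, ((θ t ω).2.1 : ℝ≥0∞) / ((θ t ω).2.2 : ℝ≥0∞)) < 1)
    (hbase : ∀ᵐ ω ∂P, (∫⁻ t, ((θ t ω).1 : ℝ≥0∞) ∂(lebesgue T)) < ∞) :
    IsHawkesProcess P 𝓕 θ fun ω => hawkesPath (fun t => θ t ω) (x ω) := by
  have hlm := hx.measurable_limitRate_predictable hθ
  have hfin := hx.ae_lintegral_limitRate_lt_top hθ hratio hbase
  have hfix (ω : Ω) : hawkesIntensity (fun s => θ s ω) (hawkesPath (fun t => θ t ω) (x ω)) =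
      limitRate (fun t => θ t ω) (x ω) := by
    have := hx.sFinite ω
    exact hawkesIntensity_hawkesPath (measurable_section_of_predictable hθ ω) (x ω)
  refine ⟨⟨hx.thin_adapted hlm, ?_⟩, ?_, ?_, ?_⟩
  · filter_upwards [hfin, hx.simple] with ω h1 h2
    exact exists_finset_thin h2 (measurable_section_of_predictable hlm ω) h1.2
  · simp_rw [hfix]
    exact hlm.stronglyMeasurable
  · simp_rw [hfix]
    filter_upwards [hfin] with ω h using h.1
  · intro C hC
    simp_rw [hfix]
    exact hx.lintegral_thin hlm hC.measurable

end Construction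

/-! ### Poisson random measures -/

/-- The Poisson weights satisfy `(n + 1) p (n + 1) = r p n`. -/
theorem poissonMeasure_singleton_succ (r : ℝ≥0) (n : ℕ) :
    poissonMeasure r {n + 1} * ((n + 1 : ℕ) : ℝ≥0∞) = r * poissonMeasure r {n} := by
  rw [poissonMeasure_singleton, poissonMeasure_singleton, ← ENNReal.ofReal_natCast,
    ← ENNReal.ofReal_coe_nnreal, ← ENNReal.ofReal_mul (by positivity),
    ← ENNReal.ofReal_mul (NNReal.coe_nonneg _)]
  congr 1
  rw [Nat.factorial_succ, pow_succ]
  push_cast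
  have : ((n : ℝ) + 1) ≠ 0 := by positivity
  have : (n.factorial : ℝ) ≠ 0 := by positivity
  field_simp

theorem tsum_poissonMeasure_singleton (r : ℝ≥0) : ∑' n : ℕ, poissonMeasure r {n} = 1 := by
  have := lintegral_countable' (μ := poissonMeasure r) (fun _ => 1)
  simpa using this.symm

theorem lintegral_poissonMeasure (r : ℝ≥0) : ∫⁻ k : ℕ, (k : ℝ≥0∞) ∂(poissonMeasure r) = r := by
  rw [lintegral_countable', tsum_eq_zero_add' ENNReal.summable]
  simp_rw [mul_comm _ (poissonMeasure r {_}), poissonMeasure_singleton_succ]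
  rw [ENNReal.tsum_mul_left, tsum_poissonMeasure_singleton]
  simp

theorem poissonMeasure_two_le (r : ℝ≥0) : poissonMeasure r {k | 2 ≤ k} ≤ (r : ℝ≥0∞) ^ 2 := by
  have hset : {k : ℕ | 2 ≤ k} = ⋃ n : ℕ, {n + 2} := by
    ext k
    simp only [mem_ofPred_eq, mem_iUnion, mem_singleton_iff]
    exact ⟨fun h => ⟨k - 2, by omega⟩, fun ⟨n, hn⟩ => by omega⟩
  have hterm (n : ℕ) : poissonMeasure r {n + 2} ≤ (r : ℝ≥0∞) ^ 2 * poissonMeasure r {n} := by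
    have hone (j : ℕ) : poissonMeasure r {j + 1} ≤ r * poissonMeasure r {j} := by
      rw [← poissonMeasure_singleton_succ]
      exact le_mul_of_one_le_right zero_le (by exact_mod_cast Nat.le_add_left 1 j)
    calc poissonMeasure r {n + 2} ≤ r * poissonMeasure r {n + 1} := hone (n + 1)
      _ ≤ r * (r * poissonMeasure r {n}) := by gcongr; exact hone n
      _ = (r : ℝ≥0∞) ^ 2 * poissonMeasure r {n} := by ring
  calc poissonMeasure r {k | 2 ≤ k} ≤ ∑' n : ℕ, poissonMeasure r {n + 2} := by
        rw [hset]
        exact measure_iUnion_le _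
    _ ≤ ∑' n : ℕ, (r : ℝ≥0∞) ^ 2 * poissonMeasure r {n} := ENNReal.tsum_le_tsum hterm
    _ = (r : ℝ≥0∞) ^ 2 := by rw [ENNReal.tsum_mul_left, tsum_poissonMeasure_singleton, mul_one]

section PoissonRandomMeasure

variable {Ω E : Type*} [mΩ : MeasurableSpace Ω] [TopologicalSpace E] [MeasurableSpace E]
  {P : Measure Ω} {X : Ω → Measure E} {m : Measure E}

theorem IsPoissonRandomMeasure.measurable_apply (hX : IsPoissonRandomMeasure P X m) {B : Set E}
    (hB : MeasurableSet B) : Measurable fun ω => X ω B :=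
  (Measure.measurable_coe hB).comp hX.measurable

theorem IsPoissonRandomMeasure.lintegral_apply (hX : IsPoissonRandomMeasure P X m) {B : Set E}
    (hB : MeasurableSet B) (hfin : m B ≠ ∞) : ∫⁻ ω, X ω B ∂P = m B := by
  have h1 : ∫⁻ ω, X ω B ∂P = ∫⁻ y, y ∂(P.map fun ω => X ω B) :=
    (lintegral_map measurable_id (hX.measurable_apply hB)).symm
  rw [h1, hX.law B hB hfin, lintegral_map (f := fun y => y) measurable_id
    (measurable_of_countable _)]
  rw [lintegral_poissonMeasure, ENNReal.coe_toNNReal hfin]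

theorem IsPoissonRandomMeasure.ae_exists_nat (hX : IsPoissonRandomMeasure P X m) {B : Set E}
    (hB : MeasurableSet B) (hfin : m B ≠ ∞) : ∀ᵐ ω ∂P, ∃ k : ℕ, X ω B = k := by
  have hm : MeasurableSet {y : ℝ≥0∞ | ∃ k : ℕ, y = k} := by
    have : {y : ℝ≥0∞ | ∃ k : ℕ, y = k} = range fun k : ℕ => (k : ℝ≥0∞) := by
      ext y; simp [eq_comm]
    rw [this]
    exact (countable_range _).measurableSet
  have h : ∀ᵐ y ∂(P.map fun ω => X ω B), ∃ k : ℕ, y = (k : ℝ≥0∞) := by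
    rw [hX.law B hB hfin, ae_map_iff (measurable_of_countable _).aemeasurable hm]
    exact ae_of_all _ fun k => ⟨k, rfl⟩
  exact ae_of_ae_map (hX.measurable_apply hB).aemeasurable h

/-- Two points in a set of small intensity are a second order event. -/
theorem IsPoissonRandomMeasure.measure_one_lt_le (hX : IsPoissonRandomMeasure P X m) {B : Set E}
    (hB : MeasurableSet B) (hfin : m B ≠ ∞) : P {ω | 1 < X ω B} ≤ (m B) ^ 2 := by
  have h1 : P {ω | 1 < X ω B} = P.map (fun ω => X ω B) (Ioi (1 : ℝ≥0∞)) :=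
    (Measure.map_apply (hX.measurable_apply hB) measurableSet_Ioi).symm
  have h3 : Measurable fun k : ℕ => (k : ℝ≥0∞) := measurable_of_countable _
  rw [h1, hX.law B hB hfin, Measure.map_apply h3 measurableSet_Ioi]
  have h2 : (fun k : ℕ => (k : ℝ≥0∞)) ⁻¹' Ioi (1 : ℝ≥0∞) = {k | 2 ≤ k} := by
    ext k
    simp only [mem_preimage, mem_Ioi, mem_ofPred_eq]
    exact_mod_cast Iff.rfl
  rw [h2]
  refine (poissonMeasure_two_le _).trans ?_
  rw [ENNReal.coe_toNNReal hfin]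

/-- The values of a Poisson random measure on countably many disjoint sets are independent. -/
theorem IsPoissonRandomMeasure.iIndepFun_of_disjoint (hX : IsPoissonRandomMeasure P X m)
    {ι : Type*} {B : ι → Set E} (hB : ∀ i, MeasurableSet (B i))
    (hdisj : Pairwise fun i j => Disjoint (B i) (B j)) : iIndepFun (fun i ω => X ω (B i)) P := by
  rw [iIndepFun_iff_finset]
  intro s
  have h := hX.indep s.card (fun k => B (s.equivFin.symm k)) (fun k => hB _)
    (fun k l hkl => hdisj fun h => hkl (s.equivFin.symm.injective (Subtype.ext h)))
  have h2 := h.precomp s.equivFin.injective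
  have h3 : (fun i : s => (fun k ω => X ω (B (s.equivFin.symm k))) (s.equivFin i)) =
      s.restrict fun i ω => X ω (B i) := by
    funext i
    simp
  rw [← h3]
  exact h2

/-- Complete independence: the restriction of a Poisson random measure to a set is independent of
its values on disjoint sets. The σ-algebra of the restriction is the directed union, over countable
measurable partitions, of the σ-algebras generated by the values on the cells. -/
theorem IsPoissonRandomMeasure.indep_restrict [IsProbabilityMeasure P]
    (hX : IsPoissonRandomMeasure P X m) {A B : Set E} (hA : MeasurableSet A)
    (hB : MeasurableSet B) (hAB : Disjoint A B) :
    Indep (MeasurableSpace.comap (fun ω => (X ω).restrict A) inferInstance)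
      (MeasurableSpace.comap (fun ω => X ω B) inferInstance) P := by
  let 𝒮 : {g : E → ℕ // Measurable g} → MeasurableSpace Ω := fun g =>
    ⨆ k : ℕ, MeasurableSpace.comap (fun ω => X ω (g.1 ⁻¹' {k} ∩ A)) inferInstance
  have hcell (g : {g : E → ℕ // Measurable g}) (k : ℕ) : MeasurableSet (g.1 ⁻¹' {k} ∩ A) :=
    (g.2 (measurableSet_singleton k)).inter hA
  have hle (g) : 𝒮 g ≤ mΩ := iSup_le fun k => (hX.measurable_apply (hcell g k)).comap_le
  have hind (g) : Indep (𝒮 g) (MeasurableSpace.comap (fun ω => X ω B) inferInstance) P := by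
    let F : Option ℕ → Set E := fun o => o.elim B fun k => g.1 ⁻¹' {k} ∩ A
    have hF (o) : MeasurableSet (F o) := by
      cases o with
      | none => exact hB
      | some k => exact hcell g k
    have hd : Pairwise fun i j => Disjoint (F i) (F j) := by
      intro i j hij
      cases i with
      | none => cases j with
        | none => exact absurd rfl hij
        | some j => exact (hAB.mono_left inter_subset_right).symm
      | some i => cases j with
        | none => exact hAB.mono_left inter_subset_right
        | some j =>
          refine (Disjoint.preimage g.1 (disjoint_singleton.2 fun h => hij (by rw [h]))).mono
            inter_subset_left inter_subset_left
    have h1 := (hX.iIndepFun_of_disjoint hF hd).iIndep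
    have h2 := indep_iSup_of_disjoint (S := range some) (T := {none})
      (fun o => (hX.measurable_apply (hF o)).comap_le) h1 (by simp)
    refine indep_of_indep_of_le_left (indep_of_indep_of_le_right h2 ?_) ?_
    · exact le_iSup₂_of_le none rfl le_rfl
    · exact iSup_le fun k => le_iSup₂_of_le (some k) ⟨k, rfl⟩ le_rfl
  have hdir : Directed (· ≤ ·) 𝒮 := by
    have key (g g' : {g : E → ℕ // Measurable g}) (π : ℕ → ℕ) (h : ∀ y, g.1 y = π (g'.1 y)) :
        𝒮 g ≤ 𝒮 g' := by
      refine iSup_le fun k => Measurable.comap_le ?_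
      have h1 (ω : Ω) : X ω (g.1 ⁻¹' {k} ∩ A) =
          ∑' j : π ⁻¹' {k}, X ω (g'.1 ⁻¹' {(j : ℕ)} ∩ A) := by
        have hU : g.1 ⁻¹' {k} ∩ A = ⋃ j : π ⁻¹' {k}, g'.1 ⁻¹' {(j : ℕ)} ∩ A := by
          ext y
          simp [h y]
        rw [hU, measure_iUnion _ fun j => hcell g' _]
        intro i j hij
        exact (Disjoint.preimage g'.1 (disjoint_singleton.2
          fun h => hij (Subtype.ext h))).mono inter_subset_left inter_subset_left
      simp_rw [h1]
      refine @Measurable.tsum Ω _ _ (𝒮 g') _ _ _ _ _ _ _ _ _ _ _ _ fun j => ?_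
      exact Measurable.mono (comap_measurable _) (le_iSup (fun k => MeasurableSpace.comap
        (fun ω => X ω (g'.1 ⁻¹' {k} ∩ A)) inferInstance) (j : ℕ)) le_rfl
    intro g g'
    refine ⟨⟨fun y => Nat.pair (g.1 y) (g'.1 y), ?_⟩, key _ _ (fun n => n.unpair.1) ?_,
      key _ _ (fun n => n.unpair.2) ?_⟩
    · exact (measurable_of_countable (Function.uncurry Nat.pair)).comp (g.2.prodMk g'.2)
    · intro y; simp
    · intro y; simp
  refine indep_of_indep_of_le_left (indep_iSup_of_directed_le hind hle
    (hX.measurable_apply hB).comap_le hdir) ?_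
  refine Measurable.comap_le (Measure.measurable_of_measurable_coe _ fun C hC => ?_)
  classical
  let g : {g : E → ℕ // Measurable g} :=
    ⟨C.indicator 1, measurable_one.indicator hC⟩
  have hg : g.1 ⁻¹' {1} = C := by
    ext y
    simp [g, indicator]
  have h1 (ω : Ω) : (X ω).restrict A C = X ω (g.1 ⁻¹' {1} ∩ A) := by
    rw [Measure.restrict_apply hC, hg]
  simp_rw [h1]
  exact Measurable.mono (comap_measurable _) ((le_iSup (fun k => MeasurableSpace.comap
    (fun ω => X ω (g.1 ⁻¹' {k} ∩ A)) inferInstance) 1).trans (le_iSup 𝒮 g)) le_rfl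

end PoissonRandomMeasure

/-- If `𝒢` is independent of a σ-algebra containing `𝒜` and `ℬ`, and if `𝒜` and `ℬ` are
independent, then `𝒢 ⊔ 𝒜` is independent of `ℬ`. -/
theorem indep_sup_of_indep {Ω : Type*} {mΩ : MeasurableSpace Ω} {P : Measure Ω}
    [IsProbabilityMeasure P] {𝒢 𝒜 ℬ 𝒳 : MeasurableSpace Ω} (h𝒢 : 𝒢 ≤ mΩ) (h𝒳 : 𝒳 ≤ mΩ)
    (h𝒜 : 𝒜 ≤ 𝒳) (hℬ : ℬ ≤ 𝒳) (h1 : Indep 𝒢 𝒳 P) (h2 : Indep 𝒜 ℬ P) : Indep (𝒢 ⊔ 𝒜) ℬ P := by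
  let p : Set (Set Ω) := {s | ∃ A B, MeasurableSet[𝒢] A ∧ MeasurableSet[𝒜] B ∧ s = A ∩ B}
  have hp : IsPiSystem p := by
    rintro _ ⟨A, B, hA, hB, rfl⟩ _ ⟨A', B', hA', hB', rfl⟩ -
    exact ⟨A ∩ A', B ∩ B', hA.inter hA', hB.inter hB', inter_inter_inter_comm _ _ _ _⟩
  have hgen : 𝒢 ⊔ 𝒜 = MeasurableSpace.generateFrom p := by
    refine le_antisymm (sup_le (fun A hA => ?_) fun B hB => ?_)
      (MeasurableSpace.generateFrom_le ?_)
    · exact MeasurableSpace.measurableSet_generateFrom ⟨A, univ, hA, MeasurableSet.univ, by simp⟩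
    · exact MeasurableSpace.measurableSet_generateFrom ⟨univ, B, MeasurableSet.univ, hB, by simp⟩
    · rintro _ ⟨A, B, hA, hB, rfl⟩
      exact MeasurableSet.inter (le_sup_left (a := 𝒢) (b := 𝒜) A hA)
        (le_sup_right (a := 𝒢) (b := 𝒜) B hB)
  refine IndepSets.indep (sup_le h𝒢 (h𝒜.trans h𝒳)) (hℬ.trans h𝒳) hp
    (@MeasurableSpace.isPiSystem_measurableSet _ ℬ) hgen
    (@MeasurableSpace.generateFrom_measurableSet _ ℬ).symm ?_
  rw [IndepSets_iff]
  rintro _ C ⟨A, B, hA, hB, rfl⟩ hC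
  rw [inter_assoc, Indep_iff _ _ _ |>.1 h1 A (B ∩ C) hA ((h𝒜 B hB).inter (hℬ C hC)),
    Indep_iff _ _ _ |>.1 h2 B C hB hC, Indep_iff _ _ _ |>.1 h1 A B hA (h𝒜 B hB), mul_assoc]

/-! ### Campbell's formula -/

/-- Two random measures whose expected integrals agree on a generating π-system have the same
expected integrals against all integrands measurable for the generated σ-algebra. The map `φ` and
the auxiliary space `Y` allow for σ-algebras smaller than the product σ-algebra. -/
theorem lintegral_lintegral_ext {Ω E Y : Type*} [MeasurableSpace Ω] [MeasurableSpace E]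
    [mY : MeasurableSpace Y] {P : Measure Ω} {K K' : Ω → Measure E} (hK : Measurable K)
    (hK' : Measurable K') {A : ℕ → Set E} (hA : ∀ n, MeasurableSet (A n))
    (hdisj : Pairwise (Function.onFun Disjoint A)) (hcov : ⋃ n, A n = univ)
    (hfin : ∀ ω n, K ω (A n) < ∞) (hfin' : ∀ ω n, K' ω (A n) < ∞)
    {φ : Ω × E → Y} (hφ : Measurable φ) {S 𝒯 : Set (Set Y)}
    (hgen : mY = MeasurableSpace.generateFrom S) (hS : IsPiSystem S) (h𝒯c : 𝒯.Countable)
    (h𝒯m : ∀ t ∈ 𝒯, MeasurableSet t) (h𝒯 : ⋃₀ 𝒯 = univ)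
    (htop : ∀ t ∈ 𝒯, ∫⁻ ω, K ω {e | φ (ω, e) ∈ t} ∂P ≠ ∞)
    (hS𝒯 : ∀ t ∈ 𝒯, ∀ s ∈ S, ∫⁻ ω, K ω {e | φ (ω, e) ∈ s ∩ t} ∂P =
      ∫⁻ ω, K' ω {e | φ (ω, e) ∈ s ∩ t} ∂P)
    (h𝒯eq : ∀ t ∈ 𝒯, ∫⁻ ω, K ω {e | φ (ω, e) ∈ t} ∂P = ∫⁻ ω, K' ω {e | φ (ω, e) ∈ t} ∂P)
    {C : Y → ℝ≥0∞} (hC : Measurable C) :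
    ∫⁻ ω, ∫⁻ e, C (φ (ω, e)) ∂(K ω) ∂P = ∫⁻ ω, ∫⁻ e, C (φ (ω, e)) ∂(K' ω) ∂P := by
  have hφω (ω : Ω) : Measurable fun e => φ (ω, e) := hφ.comp measurable_prodMk_left
  have hmap {L : Ω → Measure E} (hL : Measurable L) (hLfin : ∀ ω n, L ω (A n) < ∞) :
      Measurable fun ω => (L ω).map fun e => φ (ω, e) := by
    refine Measure.measurable_of_measurable_coe _ fun s hs => ?_
    have h := measurable_lintegral_of_partition hL hA hdisj hcov hLfin
      (f := (φ ⁻¹' s).indicator 1) (measurable_one.indicator (hφ hs))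
    convert h using 2 with ω
    rw [Measure.map_apply (hφω ω) hs]
    exact (lintegral_indicator_one (hφω ω hs)).symm
  have hbind {L : Ω → Measure E} (hL : Measurable L) (hLfin : ∀ ω n, L ω (A n) < ∞) :
      ∫⁻ y, C y ∂(P.bind fun ω => (L ω).map fun e => φ (ω, e)) =
        ∫⁻ ω, ∫⁻ e, C (φ (ω, e)) ∂(L ω) ∂P := by
    rw [Measure.lintegral_bind (hmap hL hLfin).aemeasurable hC.aemeasurable]
    exact lintegral_congr fun ω => lintegral_map hC (hφω ω)
  have happ {L : Ω → Measure E} (hL : Measurable L) (hLfin : ∀ ω n, L ω (A n) < ∞) {s : Set Y}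
      (hs : MeasurableSet s) : (P.bind fun ω => (L ω).map fun e => φ (ω, e)) s =
        ∫⁻ ω, L ω {e | φ (ω, e) ∈ s} ∂P := by
    rw [Measure.bind_apply hs (hmap hL hLfin).aemeasurable]
    exact lintegral_congr fun ω => Measure.map_apply (hφω ω) hs
  rw [← hbind hK hfin, ← hbind hK' hfin']
  congr 1
  refine Measure.ext_of_generateFrom_of_cover hgen h𝒯c hS h𝒯 (fun t ht => ?_)
    (fun t ht s hs => ?_) fun t ht => ?_
  · rw [happ hK hfin (h𝒯m t ht)]
    exact htop t ht
  · have hsm : MeasurableSet s := by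
      rw [hgen]
      exact MeasurableSpace.measurableSet_generateFrom hs
    rw [happ hK hfin (hsm.inter (h𝒯m t ht)), happ hK' hfin' (hsm.inter (h𝒯m t ht))]
    exact hS𝒯 t ht s hs
  · rw [happ hK hfin (h𝒯m t ht), happ hK' hfin' (h𝒯m t ht)]
    exact h𝒯eq t ht

/-- Campbell's formula for predictable integrands, from the mean measure and from the independence
of the future of the noise and the past of the filtration. -/
theorem campbell_of_indep {Ω : Type*} [mΩ : MeasurableSpace Ω] {P : Measure Ω}
    [IsProbabilityMeasure P] {𝓕 : Filtration (Horizon T) mΩ} {x : Ω → Measure (Horizon T × ℝ≥0)}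
    (hx : IsAdaptedNoise 𝓕 x) (hxm : Measurable x)
    (hmean : ∀ S D, MeasurableSet S → MeasurableSet D → levelMeasure D ≠ ∞ →
      ∫⁻ ω, x ω (S ×ˢ D) ∂P = lebesgue T S * levelMeasure D)
    (hind : ∀ i D, MeasurableSet D →
      Indep (𝓕 i) (MeasurableSpace.comap (fun ω => x ω (Ioi i ×ˢ D)) inferInstance) P)
    {C : (Horizon T × Ω) × ℝ≥0 → ℝ≥0∞}
    (hC : Measurable[Prod.instMeasurableSpace (m₁ := 𝓕.predictable)] C) :
    ∫⁻ ω, ∫⁻ p, C ((p.1, ω), p.2) ∂(x ω) ∂P =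
      ∫⁻ ω, ∫⁻ s, ∫⁻ z, C ((s, ω), z) ∂levelMeasure ∂(lebesgue T) ∂P := by
  let G : Set (Set (Horizon T × Ω)) := {s | ∃ A, MeasurableSet[𝓕 ⊥] A ∧ s = {⊥} ×ˢ A} ∪
    {s | ∃ i A, MeasurableSet[𝓕 i] A ∧ s = Set.Ioi i ×ˢ A}
  let mY : MeasurableSpace ((Horizon T × Ω) × ℝ≥0) :=
    Prod.instMeasurableSpace (m₁ := 𝓕.predictable)
  have hle : mY ≤ Prod.instMeasurableSpace (m₁ := Prod.instMeasurableSpace) :=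
    sup_le_sup (MeasurableSpace.comap_mono predictable_le_prod) le_rfl
  let φ : Ω × (Horizon T × ℝ≥0) → (Horizon T × Ω) × ℝ≥0 := fun y => ((y.2.1, y.1), y.2.2)
  have hφ : Measurable[_, mY] φ :=
    Measurable.mono (mb := Prod.instMeasurableSpace)
      ((measurable_snd.fst.prodMk measurable_fst).prodMk measurable_snd.snd) le_rfl hle
  have hGpi : IsPiSystem G := by
    rintro _ (⟨A, hA, rfl⟩ | ⟨i, A, hA, rfl⟩) _ (⟨B, hB, rfl⟩ | ⟨j, B, hB, rfl⟩) hne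
    · exact Or.inl ⟨A ∩ B, hA.inter hB, by rw [prod_inter_prod, inter_self]⟩
    · obtain ⟨⟨t, ω⟩, ⟨h1, _⟩, ⟨h2, _⟩⟩ := hne
      rw [mem_singleton_iff.1 h1] at h2
      exact absurd (show j < ⊥ from h2) not_lt_bot
    · obtain ⟨⟨t, ω⟩, ⟨h2, _⟩, ⟨h1, _⟩⟩ := hne
      rw [mem_singleton_iff.1 h1] at h2
      exact absurd (show i < ⊥ from h2) not_lt_bot
    · refine Or.inr ⟨i ⊔ j, A ∩ B, ?_, by rw [prod_inter_prod, Ioi_inter_Ioi]⟩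
      exact MeasurableSet.inter (𝓕.mono le_sup_left _ hA) (𝓕.mono le_sup_right _ hB)
  have hGspan : IsCountablySpanning G := by
    refine ⟨fun n => if n = 0 then {⊥} ×ˢ univ else Ioi ⊥ ×ˢ univ, fun n => ?_, ?_⟩
    · by_cases hn : n = 0
      · simp only [hn, if_true]
        exact Or.inl ⟨univ, MeasurableSet.univ, rfl⟩
      · simp only [hn, if_false]
        exact Or.inr ⟨⊥, univ, MeasurableSet.univ, rfl⟩
    · refine eq_univ_of_forall fun p => ?_
      rcases eq_or_lt_of_le (bot_le : ⊥ ≤ p.1) with h | h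
      · exact mem_iUnion.2 ⟨0, by simp [← h]⟩
      · exact mem_iUnion.2 ⟨1, by simpa using h⟩
  have hgen : mY = MeasurableSpace.generateFrom
      (image2 (· ×ˢ ·) G {D : Set ℝ≥0 | MeasurableSet D}) := by
    have hDspan : IsCountablySpanning {D : Set ℝ≥0 | MeasurableSet D} :=
      ⟨fun _ => univ, fun _ => mem_ofPred_eq.mpr MeasurableSet.univ, iUnion_const _⟩
    rw [← generateFrom_prod_eq hGspan hDspan]
    have h : (inferInstance : MeasurableSpace ℝ≥0) =
        MeasurableSpace.generateFrom {D : Set ℝ≥0 | MeasurableSet D} :=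
      MeasurableSpace.generateFrom_measurableSet.symm
    exact congrArg (fun m : MeasurableSpace ℝ≥0 =>
      @Prod.instMeasurableSpace _ _ 𝓕.predictable m) h
  have hfin' (n : ℕ) : ((lebesgue T).prod levelMeasure) (strip T n) < ∞ := by
    rw [strip, Measure.prod_prod, levelMeasure_Ico]
    exact ENNReal.mul_lt_top (measure_lt_top _ _) (by simp)
  -- Both random measures factorise on a product of a past event and a rectangle.
  have hrect (S : Set (Horizon T)) (hS : MeasurableSet S) (A : Set Ω) (hA : MeasurableSet A)
      (D : Set ℝ≥0) (hD : MeasurableSet D) (hDfin : levelMeasure D ≠ ∞)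
      (h : ∫⁻ ω, A.indicator 1 ω * x ω (S ×ˢ D) ∂P = P A * ∫⁻ ω, x ω (S ×ˢ D) ∂P) :
      ∫⁻ ω, x ω {e | φ (ω, e) ∈ (S ×ˢ A) ×ˢ D} ∂P =
        ∫⁻ ω, ((lebesgue T).prod levelMeasure) {e | φ (ω, e) ∈ (S ×ˢ A) ×ˢ D} ∂P := by
    have hset (μ : Measure (Horizon T × ℝ≥0)) (ω : Ω) :
        μ {e | φ (ω, e) ∈ (S ×ˢ A) ×ˢ D} = A.indicator 1 ω * μ (S ×ˢ D) := by
      by_cases hω : ω ∈ A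
      · rw [indicator_of_mem hω, Pi.one_apply, one_mul]
        congr 1
        ext e
        simp [φ, hω]
      · rw [indicator_of_notMem hω, zero_mul]
        have : {e | φ (ω, e) ∈ (S ×ˢ A) ×ˢ D} = ∅ := by
          ext e
          simp [φ, hω]
        rw [this, measure_empty]
    simp_rw [hset]
    rw [h, hmean S D hS hD hDfin, lintegral_mul_const _ (measurable_one.indicator hA),
      lintegral_indicator_one hA, Measure.prod_prod]
  let 𝒯 : Set (Set ((Horizon T × Ω) × ℝ≥0)) :=
    range fun n : ℕ => (univ ×ˢ univ) ×ˢ Ico (n : ℝ≥0) (n + 1)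
  have hIco (n : ℕ) (D : Set ℝ≥0) : levelMeasure (D ∩ Ico (n : ℝ≥0) (n + 1)) ≠ ∞ :=
    (lt_of_le_of_lt (measure_mono inter_subset_right) (by rw [levelMeasure_Ico]; simp)).ne
  have hunivrect (n : ℕ) : ∫⁻ ω, x ω {e | φ (ω, e) ∈
      ((univ : Set (Horizon T)) ×ˢ (univ : Set Ω)) ×ˢ Ico (n : ℝ≥0) (n + 1)} ∂P =
      ∫⁻ ω, ((lebesgue T).prod levelMeasure) {e | φ (ω, e) ∈
        ((univ : Set (Horizon T)) ×ˢ (univ : Set Ω)) ×ˢ Ico (n : ℝ≥0) (n + 1)} ∂P :=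
    hrect univ MeasurableSet.univ univ MeasurableSet.univ _ measurableSet_Ico
      (by simpa using hIco n univ) (by simp)
  have hmain := @lintegral_lintegral_ext Ω (Horizon T × ℝ≥0) _ _ _ mY P x
    (fun _ => (lebesgue T).prod levelMeasure) hxm measurable_const (strip T) measurableSet_strip
    pairwise_disjoint_strip iUnion_strip hx.finite (fun _ => hfin') φ hφ
    (image2 (· ×ˢ ·) G {D : Set ℝ≥0 | MeasurableSet D}) 𝒯 hgen
    (hGpi.prod MeasurableSpace.isPiSystem_measurableSet) (countable_range _) ?_ ?_ ?_ ?_ ?_ C hC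
  · refine hmain.trans (lintegral_congr fun ω => ?_)
    have hCω : Measurable fun p : Horizon T × ℝ≥0 => C ((p.1, ω), p.2) :=
      (hC.comp hφ).comp measurable_prodMk_left
    exact lintegral_prod _ hCω.aemeasurable
  · rintro _ ⟨n, rfl⟩
    simp only [univ_prod_univ]
    exact @MeasurableSet.prod _ _ 𝓕.predictable _ univ _ MeasurableSet.univ measurableSet_Ico
  · refine eq_univ_of_forall fun y => ?_
    refine mem_sUnion.2 ⟨_, ⟨⌊y.2⌋₊, rfl⟩, ⟨mem_univ _, mem_univ _⟩, ?_, ?_⟩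
    · exact Nat.floor_le zero_le
    · exact Nat.lt_floor_add_one _
  · rintro _ ⟨n, rfl⟩
    have h : (fun ω : Ω => ((lebesgue T).prod levelMeasure) {e | φ (ω, e) ∈
        ((univ : Set (Horizon T)) ×ˢ (univ : Set Ω)) ×ˢ Ico (n : ℝ≥0) (n + 1)}) =
        fun _ => ((lebesgue T).prod levelMeasure) (strip T n) := by
      funext ω
      congr 1
      ext e
      simp [φ, strip]
    rw [hunivrect n, h, lintegral_const, measure_univ, mul_one]
    exact (hfin' n).ne
  · rintro _ ⟨n, rfl⟩ _ ⟨g, hg, D, hD, rfl⟩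
    rw [prod_inter_prod, univ_prod_univ, inter_univ]
    have hDm : MeasurableSet (D ∩ Ico (n : ℝ≥0) (n + 1)) := MeasurableSet.inter hD measurableSet_Ico
    rcases hg with ⟨A, hA, rfl⟩ | ⟨i, A, hA, rfl⟩
    · refine hrect _ (measurableSet_singleton _) A (𝓕.le _ A hA) _ hDm (hIco n D) ?_
      have h0 : ∫⁻ ω, x ω ({⊥} ×ˢ (D ∩ Ico (n : ℝ≥0) (n + 1))) ∂P = 0 := by
        rw [hmean _ _ (measurableSet_singleton _) hDm (hIco n D), measure_singleton, zero_mul]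
      rw [h0, mul_zero, ← nonpos_iff_eq_zero, ← h0]
      refine lintegral_mono fun ω => ?_
      by_cases hω : ω ∈ A <;> simp [hω]
    · refine hrect _ measurableSet_Ioi A (𝓕.le _ A hA) _ hDm (hIco n D) ?_
      have hxD : Measurable fun ω => x ω (Ioi i ×ˢ (D ∩ Ico (n : ℝ≥0) (n + 1))) :=
        (Measure.measurable_coe (measurableSet_Ioi.prod hDm)).comp hxm
      rw [lintegral_mul_eq_lintegral_mul_lintegral_of_independent_measurableSpace (𝓕.le i)
        hxD.comap_le (hind i _ hDm) (Measurable.indicator (m := 𝓕 i) (f := (1 : Ω → ℝ≥0∞))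
          (@measurable_const _ _ _ (𝓕 i) 1) hA) (comap_measurable _),
        lintegral_indicator_one (𝓕.le _ A hA)]
  · rintro _ ⟨n, rfl⟩
    exact hunivrect n

/-! ### Simplicity of Poisson noise -/

instance : StandardBorelSpace (Horizon T) := MeasurableSet.standardBorel measurableSet_Iic

/-- A finite measure which is at most one, and integer valued on a generating family, is either
zero or a Dirac mass. -/
theorem eq_zero_or_exists_dirac {E : Type*} [mE : MeasurableSpace E] [StandardBorelSpace E]
    {μ : Measure E} {𝒞 : Set (Set E)} (hgen : mE = MeasurableSpace.generateFrom 𝒞)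
    (huniv : μ univ ≤ 1) (hint_univ : ∃ k : ℕ, μ univ = k)
    (hint : ∀ B ∈ 𝒞, ∃ k : ℕ, μ B = k) : μ = 0 ∨ ∃ p, μ = Measure.dirac p := by
  have hnat (B : Set E) (h : ∃ k : ℕ, μ B = k) : μ B = 0 ∨ μ B = 1 := by
    obtain ⟨k, hk⟩ := h
    have h1 : (k : ℝ≥0∞) ≤ 1 := hk ▸ (measure_mono (subset_univ B)).trans huniv
    have h2 : k ≤ 1 := by exact_mod_cast h1
    interval_cases k
    · exact Or.inl (by simpa using hk)
    · exact Or.inr (by simpa using hk)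
  rcases hnat univ hint_univ with h0 | h1
  · exact Or.inl (Measure.measure_univ_eq_zero.1 h0)
  have : IsProbabilityMeasure μ := ⟨h1⟩
  have h01 : IsZeroOneMeasure μ := by
    refine ⟨fun s hs => ?_⟩
    rw [hgen] at hs
    have key : MeasurableSet[mE] s ∧ (μ s = 0 ∨ μ s = 1) := by
      induction s, hs using MeasurableSpace.generateFrom_induction with
      | hC B hB _ =>
        exact ⟨by rw [hgen]; exact MeasurableSpace.measurableSet_generateFrom hB,
          hnat B (hint B hB)⟩
      | empty => exact ⟨MeasurableSet.empty, Or.inl measure_empty⟩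
      | compl B _ ih =>
        refine ⟨ih.1.compl, ?_⟩
        rw [prob_compl_eq_one_sub ih.1]
        rcases ih.2 with h | h <;> simp [h]
      | iUnion B _ ih =>
        refine ⟨MeasurableSet.iUnion fun n => (ih n).1, ?_⟩
        by_cases h : ∃ n, μ (B n) = 1
        · obtain ⟨n, hn⟩ := h
          exact Or.inr (le_antisymm prob_le_one (hn ▸ measure_mono (subset_iUnion B n)))
        · push Not at h
          exact Or.inl (measure_iUnion_null fun n => (ih n).2.resolve_right (h n))
    exact key.2
  have : NeZero μ := ⟨IsProbabilityMeasure.ne_zero μ⟩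
  exact Or.inr IsZeroOneMeasure.exists_eq_dirac

/-- The `i`-th of `n + 1` vertical slices of `(0, T] × [0, m)`. -/
def cell (T : ℝ≥0) (m n i : ℕ) : Set (Horizon T × ℝ≥0) :=
  {t : Horizon T | T * i / (n + 1) < (t : ℝ≥0) ∧ (t : ℝ≥0) ≤ T * (i + 1) / (n + 1)} ×ˢ Iio (m : ℝ≥0)

theorem measurableSet_cell (m n i : ℕ) : MeasurableSet (cell T m n i) := by
  refine MeasurableSet.prod ?_ measurableSet_Iio
  have hm : Measurable fun t : Horizon T => (t : ℝ≥0) := measurable_subtype_coe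
  exact hm measurableSet_Ioc

theorem disjoint_cell_time {n i j : ℕ} (hij : i ≠ j) {t : Horizon T}
    (hi : T * i / (n + 1) < (t : ℝ≥0) ∧ (t : ℝ≥0) ≤ T * (i + 1) / (n + 1))
    (hj : T * j / (n + 1) < (t : ℝ≥0) ∧ (t : ℝ≥0) ≤ T * (j + 1) / (n + 1)) : False := by
  wlog h : i < j generalizing i j
  · exact this hij.symm hj hi (lt_of_le_of_ne (not_lt.1 h) hij.symm)
  have h1 : T * ((i : ℝ≥0) + 1) / (n + 1) ≤ T * j / (n + 1) := by
    gcongr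
    exact_mod_cast h
  exact absurd (lt_of_lt_of_le hj.1 hi.2) (not_lt.2 h1)

theorem exists_mem_cell_time (n : ℕ) {t : Horizon T} (ht : t ≠ ⊥) :
    ∃ i < n + 1, T * i / (n + 1) < (t : ℝ≥0) ∧ (t : ℝ≥0) ≤ T * (i + 1) / (n + 1) := by
  have ht0 : 0 < (t : ℝ≥0) := by
    refine lt_of_le_of_ne zero_le fun h => ht (Subtype.ext ?_)
    exact h.symm
  have htT : (t : ℝ≥0) ≤ T := t.2
  have hex : ∃ i : ℕ, (t : ℝ≥0) ≤ T * (i + 1) / (n + 1) := ⟨n, by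
    rw [mul_div_assoc, div_self (by positivity), mul_one]; exact htT⟩
  refine ⟨Nat.find hex, ?_, ?_, Nat.find_spec hex⟩
  · refine Nat.lt_succ_of_le (Nat.find_min' hex ?_)
    rw [mul_div_assoc, div_self (by positivity), mul_one]; exact htT
  · rcases h : Nat.find hex with _ | k
    · simpa using ht0
    · have := Nat.find_min hex (m := k) (by omega)
      push Not at this
      push_cast
      exact this

theorem measure_cell_le (m n i : ℕ) :
    ((lebesgue T).prod levelMeasure) (cell T m n i) ≤ ((T * m / (n + 1) : ℝ≥0) : ℝ≥0∞) := by
  have hIio : Iio (m : ℝ≥0) = Ico 0 (m : ℝ≥0) := by ext; simp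
  rw [cell, Measure.prod_prod, hIio, levelMeasure_Ico, lebesgue_apply]
  have hsub : (fun t : Horizon T => ((t : ℝ≥0) : ℝ)) ''
      {t : Horizon T | T * i / (n + 1) < (t : ℝ≥0) ∧ (t : ℝ≥0) ≤ T * (i + 1) / (n + 1)} ⊆
      Ioc (((T * i / (n + 1) : ℝ≥0)) : ℝ) ((T * (i + 1) / (n + 1) : ℝ≥0) : ℝ) := by
    rintro _ ⟨t, ht, rfl⟩
    exact ⟨by exact_mod_cast ht.1, by exact_mod_cast ht.2⟩
  have hlen : volume (Ioc (((T * i / (n + 1) : ℝ≥0)) : ℝ) ((T * (i + 1) / (n + 1) : ℝ≥0) : ℝ)) =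
      ((T / (n + 1) : ℝ≥0) : ℝ≥0∞) := by
    rw [Real.volume_Ioc, ← ENNReal.ofReal_coe_nnreal]
    congr 1
    push_cast
    field_simp
    ring
  calc volume ((fun t : Horizon T => ((t : ℝ≥0) : ℝ)) ''
        {t : Horizon T | T * i / (n + 1) < (t : ℝ≥0) ∧ (t : ℝ≥0) ≤ T * (i + 1) / (n + 1)}) *
        (((m : ℝ≥0) : ℝ≥0∞) - ((0 : ℝ≥0) : ℝ≥0∞))
      ≤ ((T / (n + 1) : ℝ≥0) : ℝ≥0∞) * ((m : ℝ≥0) : ℝ≥0∞) := by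
        gcongr
        · exact (measure_mono hsub).trans hlen.le
        · exact tsub_le_self
    _ = ((T * m / (n + 1) : ℝ≥0) : ℝ≥0∞) := by
        rw [← ENNReal.coe_mul]
        congr 1
        ring

/-- A configuration that is integer valued on a generating family, with at most one point in each
cell, restricts to a finite sum of Dirac masses at distinct positive times. -/
theorem exists_finset_restrict {x : Measure (Horizon T × ℝ≥0)} {𝒞 : Set (Set (Horizon T × ℝ≥0))}
    (hgen : (inferInstance : MeasurableSpace (Horizon T × ℝ≥0)) = MeasurableSpace.generateFrom 𝒞)
    {m n : ℕ} (hone : ∀ i < n + 1, x (cell T m n i) ≤ 1)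
    (hint_univ : ∀ i, ∃ k : ℕ, x (cell T m n i) = k)
    (hint : ∀ i, ∀ B ∈ 𝒞, ∃ k : ℕ, x (B ∩ cell T m n i) = k)
    (hbot : x ({⊥} ×ˢ Iio (m : ℝ≥0)) = 0) :
    ∃ S : Finset (Horizon T × ℝ≥0), Set.InjOn Prod.fst (S : Set (Horizon T × ℝ≥0)) ∧
      (∀ p ∈ S, p.1 ≠ ⊥) ∧ x.restrict (univ ×ˢ Iio (m : ℝ≥0)) = ∑ p ∈ S, Measure.dirac p := by
  classical
  have hdirac (i : ℕ) (hi : i < n + 1) : x.restrict (cell T m n i) = 0 ∨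
      ∃ p ∈ cell T m n i, x.restrict (cell T m n i) = Measure.dirac p := by
    have h := eq_zero_or_exists_dirac (μ := x.restrict (cell T m n i)) hgen
      (by rw [Measure.restrict_apply_univ]; exact hone i hi)
      (by rw [Measure.restrict_apply_univ]; exact hint_univ i)
      (fun B hB => by
        rw [Measure.restrict_apply]
        · exact hint i B hB
        · rw [show (Prod.instMeasurableSpace : MeasurableSpace (Horizon T × ℝ≥0)) = _ from hgen]
          exact MeasurableSpace.measurableSet_generateFrom hB)
    rcases h with h | ⟨p, hp⟩
    · exact Or.inl h
    · refine Or.inr ⟨p, ?_, hp⟩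
      by_contra hpc
      have h1 : x.restrict (cell T m n i) (cell T m n i)ᶜ = 0 := by
        rw [Measure.restrict_apply (measurableSet_cell m n i).compl, compl_inter_self,
          measure_empty]
      rw [hp, Measure.dirac_apply' _ (measurableSet_cell m n i).compl,
        indicator_of_mem (show p ∈ (cell T m n i)ᶜ from hpc)] at h1
      exact one_ne_zero h1
  have hdirac' (i : ℕ) : ∃ p : Horizon T × ℝ≥0, i < n + 1 →
      x.restrict (cell T m n i) ≠ 0 →
      p ∈ cell T m n i ∧ x.restrict (cell T m n i) = Measure.dirac p := by
    by_cases h : i < n + 1 ∧ x.restrict (cell T m n i) ≠ 0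
    · obtain ⟨p, hp⟩ := (hdirac i h.1).resolve_left h.2
      exact ⟨p, fun _ _ => hp⟩
    · exact ⟨(⊥, 0), fun h1 h2 => absurd ⟨h1, h2⟩ h⟩
  choose p hp using hdirac'
  let I : Finset ℕ := (Finset.range (n + 1)).filter fun i => x.restrict (cell T m n i) ≠ 0
  have hI {i : ℕ} (hi : i ∈ I) : p i ∈ cell T m n i ∧
      x.restrict (cell T m n i) = Measure.dirac (p i) := by
    obtain ⟨h1, h2⟩ := Finset.mem_filter.1 hi
    exact hp i (Finset.mem_range.1 h1) h2
  have hinj {i j : ℕ} (hi : i ∈ I) (hj : j ∈ I) (h : (p i).1 = (p j).1) : i = j := by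
    by_contra hij
    have h2 := (hI hj).1.1
    rw [← h] at h2
    exact disjoint_cell_time hij (hI hi).1.1 h2
  refine ⟨I.image p, ?_, ?_, ?_⟩
  · intro q hq q' hq' h
    obtain ⟨i, hi, rfl⟩ := Finset.mem_image.1 (Finset.mem_coe.1 hq)
    obtain ⟨j, hj, rfl⟩ := Finset.mem_image.1 (Finset.mem_coe.1 hq')
    rw [hinj hi hj h]
  · intro q hq h
    obtain ⟨i, hi, rfl⟩ := Finset.mem_image.1 hq
    have h1 := (hI hi).1.1.1
    rw [h] at h1
    exact not_lt_bot h1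
  · rw [Finset.sum_image fun i hi j hj h => hinj hi hj (by rw [h])]
    have hcover : (univ ×ˢ Iio (m : ℝ≥0) : Set (Horizon T × ℝ≥0)) =
        {⊥} ×ˢ Iio (m : ℝ≥0) ∪ ⋃ i ∈ Finset.range (n + 1), cell T m n i := by
      ext q
      simp only [mem_prod, mem_univ, true_and, mem_union, mem_singleton_iff, mem_iUnion,
        Finset.mem_range, exists_prop]
      constructor
      · intro hq
        by_cases h : q.1 = ⊥
        · exact Or.inl ⟨h, hq⟩
        · obtain ⟨i, hi, h1⟩ := exists_mem_cell_time n h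
          exact Or.inr ⟨i, hi, h1, hq⟩
      · rintro (⟨_, h⟩ | ⟨i, _, h⟩)
        · exact h
        · exact h.2
    have hae : (univ ×ˢ Iio (m : ℝ≥0) : Set (Horizon T × ℝ≥0)) =ᵐ[x]
        (⋃ i ∈ Finset.range (n + 1), cell T m n i : Set (Horizon T × ℝ≥0)) := by
      rw [hcover]
      exact union_ae_eq_right_of_ae_eq_empty (ae_eq_empty.2 hbot)
    rw [Measure.restrict_congr_set hae]
    have hdisj : Set.PairwiseDisjoint (↑(Finset.range (n + 1))) (cell T m n) := by
      intro i _ j _ hij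
      refine Set.disjoint_left.2 fun q hi hj => disjoint_cell_time hij hi.1 hj.1
    have hsum : x.restrict (⋃ i ∈ Finset.range (n + 1), cell T m n i) =
        ∑ i ∈ Finset.range (n + 1), x.restrict (cell T m n i) := by
      ext B hB
      rw [Measure.restrict_apply hB, inter_iUnion₂, measure_biUnion_finset]
      · simp [Measure.coe_finsetSum, Measure.restrict_apply hB]
      · exact fun i hi j hj hij => (hdisj hi hj hij).mono inter_subset_right inter_subset_right
      · exact fun i _ => hB.inter (measurableSet_cell m n i)
    rw [hsum, Finset.sum_congr rfl fun i hi => ((hI hi).2).symm, Finset.sum_filter_ne_zero]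

/-- The inclusion of `[0, T] × [0, ∞)` into the plane. -/
noncomputable def toPlane (p : Horizon T × ℝ≥0) : ℝ × ℝ := (((p.1 : ℝ≥0) : ℝ), (p.2 : ℝ))

theorem measurableEmbedding_toPlane : MeasurableEmbedding (toPlane (T := T)) :=
  measurableEmbedding_coe_horizon.prodMap measurableEmbedding_coe_nnreal

/-- The driving noise on `[0, T] × [0, ∞)` cut out of a planar configuration. -/
noncomputable def noise (T : ℝ≥0) (X : Measure (ℝ × ℝ)) : Measure (Horizon T × ℝ≥0) :=
  X.comap toPlane

theorem noise_apply (X : Measure (ℝ × ℝ)) (B : Set (Horizon T × ℝ≥0)) :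
    noise T X B = X (toPlane '' B) :=
  measurableEmbedding_toPlane.comap_apply _ _

theorem measurable_noise : Measurable (noise T) := by
  refine Measure.measurable_of_measurable_coe _ fun B hB => ?_
  simp_rw [noise_apply]
  exact Measure.measurable_coe (measurableEmbedding_toPlane.measurableSet_image.2 hB)

theorem toPlane_image_prod (S : Set (Horizon T)) (D : Set ℝ≥0) :
    toPlane '' (S ×ˢ D) = ((fun t : Horizon T => ((t : ℝ≥0) : ℝ)) '' S) ×ˢ
      ((fun z : ℝ≥0 => (z : ℝ)) '' D) :=
  (prod_image_image_eq (m₁ := fun t : Horizon T => ((t : ℝ≥0) : ℝ))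
    (m₂ := fun z : ℝ≥0 => (z : ℝ))).symm

theorem volume_image_toPlane (S : Set (Horizon T)) (D : Set ℝ≥0) :
    volume (toPlane '' (S ×ˢ D)) = lebesgue T S * levelMeasure D := by
  rw [toPlane_image_prod, Measure.volume_eq_prod, Measure.prod_prod, lebesgue_apply,
    levelMeasure_apply]

/-! ### Poisson noise is a driving noise -/

theorem toPlane_image_Iic_subset (t : Horizon T) :
    toPlane '' (Iic t ×ˢ univ) ⊆ Icc (0 : ℝ) (t : ℝ≥0) ×ˢ univ := by
  rintro _ ⟨p, hp, rfl⟩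
  exact ⟨⟨p.1.1.2, by exact_mod_cast (show p.1 ≤ t from hp.1)⟩, mem_univ _⟩

theorem disjoint_toPlane_image_Ioi (t : Horizon T) (D : Set ℝ≥0) :
    Disjoint (Icc (0 : ℝ) (t : ℝ≥0) ×ˢ (univ : Set ℝ)) (toPlane '' (Ioi t ×ˢ D)) := by
  refine Set.disjoint_left.2 ?_
  rintro _ h1 ⟨p, hp, rfl⟩
  have h2 : ((p.1 : ℝ≥0) : ℝ) ≤ ((t : ℝ≥0) : ℝ) := h1.1.2
  exact absurd (show t < p.1 from hp.1) (not_lt.2 (by exact_mod_cast h2))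

theorem noise_strip_lt_top {X : Measure (ℝ × ℝ)} [IsLocallyFiniteMeasure X] (n : ℕ) :
    noise T X (strip T n) < ∞ := by
  rw [noise_apply]
  have hsub : toPlane '' (strip T n) ⊆ Icc (0 : ℝ) T ×ˢ Icc (n : ℝ) (n + 1) := by
    rintro _ ⟨p, hp, rfl⟩
    refine ⟨⟨p.1.1.2, by exact_mod_cast p.1.2⟩, ?_, ?_⟩
    · exact_mod_cast hp.2.1
    · exact_mod_cast hp.2.2.le
  exact (measure_mono hsub).trans_lt (isCompact_Icc.prod isCompact_Icc).measure_lt_top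

section PoissonNoise

variable {Ω : Type*} [mΩ : MeasurableSpace Ω] {P : Measure Ω} {X : Ω → Measure (ℝ × ℝ)}

theorem IsPoissonRandomMeasure.isAdaptedNoise (hX : IsPoissonRandomMeasure P X volume) :
    IsAdaptedNoise (randomMeasureFiltration T X hX.measurable) fun ω => noise T (X ω) where
  finite ω n := by
    have := hX.locallyFinite ω
    exact noise_strip_lt_top n
  adapted t := by
    refine Measure.measurable_of_measurable_coe _ fun B hB => ?_
    have hm : MeasurableSet (toPlane '' (B ∩ Iic t ×ˢ univ)) :=
      measurableEmbedding_toPlane.measurableSet_image.2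
        (hB.inter (measurableSet_Iic.prod MeasurableSet.univ))
    have key (ω : Ω) : (noise T (X ω)).restrict (Iic t ×ˢ univ) B =
        (X ω).restrict (Icc (0 : ℝ) (t : ℝ≥0) ×ˢ univ) (toPlane '' (B ∩ Iic t ×ˢ univ)) := by
      rw [Measure.restrict_apply hB, noise_apply, Measure.restrict_apply hm, inter_eq_left.2
        ((image_mono inter_subset_right).trans (toPlane_image_Iic_subset t))]
    simp_rw [key]
    exact (Measure.measurable_coe hm).comp (comap_measurable _)

theorem IsPoissonRandomMeasure.lintegral_noise_prod (hX : IsPoissonRandomMeasure P X volume)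
    {S : Set (Horizon T)} {D : Set ℝ≥0} (hS : MeasurableSet S) (hD : MeasurableSet D)
    (hfin : levelMeasure D ≠ ∞) :
    ∫⁻ ω, noise T (X ω) (S ×ˢ D) ∂P = lebesgue T S * levelMeasure D := by
  simp_rw [noise_apply]
  rw [hX.lintegral_apply (measurableEmbedding_toPlane.measurableSet_image.2 (hS.prod hD)),
    volume_image_toPlane]
  rw [volume_image_toPlane]
  exact ENNReal.mul_ne_top (measure_ne_top _ _) hfin

theorem levelMeasure_Iio_natCast (m : ℕ) : levelMeasure (Iio (m : ℝ≥0)) = m := by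
  have hIio : Iio (m : ℝ≥0) = Ico 0 (m : ℝ≥0) := by ext; simp
  rw [hIio, levelMeasure_Ico]
  simp

theorem volume_toPlane_cell_le (m n i : ℕ) :
    volume (toPlane '' (cell T m n i)) ≤ ((T * m / (n + 1) : ℝ≥0) : ℝ≥0∞) := by
  refine le_trans (le_of_eq ?_) (measure_cell_le m n i)
  rw [cell, volume_image_toPlane, Measure.prod_prod]

/-- Subdividing the time axis into `n + 1` equal slices, the probability that some slice carries
two points below level `m` is at most `(T m)² / (n + 1)`. -/
theorem IsPoissonRandomMeasure.ae_exists_cell_le_one [IsProbabilityMeasure P]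
    (hX : IsPoissonRandomMeasure P X volume) (m : ℕ) :
    ∀ᵐ ω ∂P, ∃ n : ℕ, ∀ i < n + 1, noise T (X ω) (cell T m n i) ≤ 1 := by
  have hbad (n : ℕ) : P {ω | ¬ ∃ n : ℕ, ∀ i < n + 1, noise T (X ω) (cell T m n i) ≤ 1} ≤
      (((T * m) ^ 2 / (n + 1) : ℝ≥0) : ℝ≥0∞) := by
    have hsub : {ω | ¬ ∃ n : ℕ, ∀ i < n + 1, noise T (X ω) (cell T m n i) ≤ 1} ⊆
        ⋃ i ∈ Finset.range (n + 1), {ω | 1 < X ω (toPlane '' cell T m n i)} := by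
      intro ω hω
      simp only [mem_ofPred_eq] at hω
      push Not at hω
      obtain ⟨i, hi, h⟩ := hω n
      rw [noise_apply] at h
      exact mem_iUnion₂.2 ⟨i, Finset.mem_range.2 hi, h⟩
    calc P {ω | ¬ ∃ n : ℕ, ∀ i < n + 1, noise T (X ω) (cell T m n i) ≤ 1}
        ≤ ∑ i ∈ Finset.range (n + 1), P {ω | 1 < X ω (toPlane '' cell T m n i)} :=
          (measure_mono hsub).trans (measure_biUnion_finset_le _ _)
      _ ≤ ∑ _i ∈ Finset.range (n + 1), ((T * m / (n + 1) : ℝ≥0) : ℝ≥0∞) ^ 2 := by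
          refine Finset.sum_le_sum fun i _ => ?_
          refine (hX.measure_one_lt_le (measurableEmbedding_toPlane.measurableSet_image.2
            (measurableSet_cell m n i))
            (ne_top_of_le_ne_top ENNReal.coe_ne_top (volume_toPlane_cell_le m n i))).trans ?_
          gcongr
          exact volume_toPlane_cell_le m n i
      _ = (((T * m) ^ 2 / (n + 1) : ℝ≥0) : ℝ≥0∞) := by
          rw [Finset.sum_const, Finset.card_range, nsmul_eq_mul, ← ENNReal.coe_pow,
            ← ENNReal.coe_natCast, ← ENNReal.coe_mul]
          congr 1
          push_cast
          field_simp
  rw [ae_iff]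
  have hlim : Filter.Tendsto (fun n : ℕ => (((T * m) ^ 2 / (n + 1) : ℝ≥0) : ℝ≥0∞))
      Filter.atTop (nhds 0) := by
    rw [← ENNReal.coe_zero, ENNReal.tendsto_coe]
    refine NNReal.tendsto_coe.1 ?_
    push_cast
    exact (tendsto_const_div_atTop_nhds_zero_nat ((T * m : ℝ) ^ 2)).comp (Filter.tendsto_add_atTop_nat 1) |>.congr
      fun n => by simp
  exact le_antisymm (ge_of_tendsto' hlim hbad) zero_le

end PoissonNoise

/-- The restriction of a Poisson random measure to `[0, T] × [0, ∞)` drives a point process, for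
any filtration which contains its own and enlarges it by independent information only. -/
theorem IsPoissonRandomMeasure.isDrivingNoise {Ω : Type*} {𝒢 : MeasurableSpace Ω}
    [mΩ : MeasurableSpace Ω] {P : Measure Ω} [IsProbabilityMeasure P] {X : Ω → Measure (ℝ × ℝ)}
    (hX : IsPoissonRandomMeasure P X volume) {𝓕 : Filtration (Horizon T) mΩ} (h𝒢 : 𝒢 ≤ mΩ)
    (hind : Indep 𝒢 (MeasurableSpace.comap X inferInstance) P)
    (hle : randomMeasureFiltration T X hX.measurable ≤ 𝓕)
    (hge : ∀ t, 𝓕 t ≤ 𝒢 ⊔ randomMeasureFiltration T X hX.measurable t) :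
    IsDrivingNoise P 𝓕 fun ω => noise T (X ω) where
  toIsAdaptedNoise := hX.isAdaptedNoise.mono hle
  campbell C hC := by
    refine campbell_of_indep (hX.isAdaptedNoise.mono hle)
      (measurable_noise.comp hX.measurable) (fun S D hS hD => hX.lintegral_noise_prod hS hD)
      (fun t D hD => ?_) hC
    simp_rw [noise_apply]
    have hB : MeasurableSet (toPlane '' (Ioi t ×ˢ D)) :=
      measurableEmbedding_toPlane.measurableSet_image.2 (measurableSet_Ioi.prod hD)
    have hA : MeasurableSet (Icc (0 : ℝ) (t : ℝ≥0) ×ˢ (univ : Set ℝ)) :=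
      measurableSet_Icc.prod MeasurableSet.univ
    refine indep_of_indep_of_le_left (indep_sup_of_indep h𝒢 hX.measurable.comap_le ?_ ?_ hind
      (hX.indep_restrict hA hB (disjoint_toPlane_image_Ioi t D))) (hge t)
    · exact Measurable.comap_le ((measurable_measure_restrict hA).comp (comap_measurable _))
    · exact Measurable.comap_le ((Measure.measurable_coe hB).comp (comap_measurable _))
  simple := by
    have hcellfin (m n i : ℕ) : volume (toPlane '' (cell T m n i)) ≠ ∞ :=
      ne_top_of_le_ne_top ENNReal.coe_ne_top (volume_toPlane_cell_le m n i)
    rw [ae_all_iff]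
    intro m
    have h1 : ∀ᵐ ω ∂P, ∀ n i, ∃ k : ℕ, noise T (X ω) (cell T m n i) = k := by
      simp_rw [noise_apply]
      exact ae_all_iff.2 fun n => ae_all_iff.2 fun i => hX.ae_exists_nat
        (measurableEmbedding_toPlane.measurableSet_image.2 (measurableSet_cell m n i))
        (hcellfin m n i)
    have h2 : ∀ᵐ ω ∂P, ∀ n i,
        ∀ B ∈ MeasurableSpace.countableGeneratingSet (Horizon T × ℝ≥0),
          ∃ k : ℕ, noise T (X ω) (B ∩ cell T m n i) = k := by
      simp_rw [noise_apply]
      refine ae_all_iff.2 fun n => ae_all_iff.2 fun i =>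
        (ae_ball_iff (MeasurableSpace.countable_countableGeneratingSet)).2 fun B hB => ?_
      refine hX.ae_exists_nat (measurableEmbedding_toPlane.measurableSet_image.2
        ((MeasurableSpace.measurableSet_countableGeneratingSet hB).inter
          (measurableSet_cell m n i))) ?_
      exact ne_top_of_le_ne_top (hcellfin m n i)
        (measure_mono (image_mono inter_subset_right))
    have h3 : ∀ᵐ ω ∂P, noise T (X ω) ({⊥} ×ˢ Iio (m : ℝ≥0)) = 0 := by
      have hm : MeasurableSet (({⊥} : Set (Horizon T)) ×ˢ Iio (m : ℝ≥0)) :=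
        (measurableSet_singleton _).prod measurableSet_Iio
      refine (lintegral_eq_zero_iff
        ((Measure.measurable_coe hm).comp (measurable_noise.comp hX.measurable))).1 ?_
      have := hX.lintegral_noise_prod (measurableSet_singleton (⊥ : Horizon T))
        (measurableSet_Iio (a := (m : ℝ≥0))) (by rw [levelMeasure_Iio_natCast]; simp)
      rw [measure_singleton, zero_mul] at this
      exact this
    filter_upwards [h1, h2, h3, hX.ae_exists_cell_le_one (T := T) m] with ω g1 g2 g3 ⟨n, g4⟩
    exact exists_finset_restrict (MeasurableSpace.generateFrom_countableGeneratingSet).symm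
      g4 (g1 n) (g2 n) g3

/-! ### The past of an adapted point process -/

theorem restrict_Iio_sum_dirac (S : Finset (Horizon T)) (t : Horizon T) :
    (∑ s ∈ S, Measure.dirac s : Measure (Horizon T)).restrict (Iio t) =
      ∑ s ∈ S.filter (· < t), Measure.dirac s := by
  classical
  induction S using Finset.induction_on with
  | empty => simp
  | insert a S ha ih =>
    rw [Finset.sum_insert ha, Measure.restrict_add, ih, Finset.filter_insert,
      restrict_dirac]
    by_cases h : a < t
    · rw [if_pos (show a ∈ Iio t from h), if_pos h, Finset.sum_insert (by simp [ha])]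
    · rw [if_neg (show a ∉ Iio t from h), if_neg h, zero_add]

theorem lintegral_sum_dirac (S : Finset (Horizon T)) (f : Horizon T → ℝ≥0∞) :
    ∫⁻ s, f s ∂(∑ s ∈ S, Measure.dirac s : Measure (Horizon T)) = ∑ s ∈ S, f s := by
  rw [lintegral_finsetSum_measure]
  simp

/-- The increments of a functional along a finite configuration telescope. -/
theorem add_sum_restrict_Iio (F : Measure (Horizon T) → ℝ≥0∞) (S : Finset (Horizon T)) :
    F (∑ s ∈ S, Measure.dirac s) +
        ∑ s ∈ S, F ((∑ u ∈ S, Measure.dirac u : Measure (Horizon T)).restrict (Iio s)) =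
      F 0 + ∑ s ∈ S, F ((∑ u ∈ S, Measure.dirac u : Measure (Horizon T)).restrict (Iio s) +
        Measure.dirac s) := by
  classical
  simp_rw [restrict_Iio_sum_dirac]
  induction S using Finset.induction_on_max with
  | empty => simp
  | insert m S hm ih =>
    have hmS : m ∉ S := fun h => lt_irrefl _ (hm m h)
    have h1 : (insert m S).filter (· < m) = S := by
      ext u
      simp only [Finset.mem_filter, Finset.mem_insert]
      exact ⟨fun h => h.1.resolve_left h.2.ne, fun h => ⟨Or.inr h, hm u h⟩⟩
    have h2 (s : Horizon T) (hs : s ∈ S) :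
        (insert m S).filter (· < s) = S.filter (· < s) := by
      rw [Finset.filter_insert, if_neg (hm s hs).le.not_gt]
    have h3 (f : Measure (Horizon T) → Horizon T → ℝ≥0∞) :
        ∑ s ∈ insert m S, f (∑ u ∈ (insert m S).filter (· < s), Measure.dirac u) s =
          f (∑ u ∈ S, Measure.dirac u) m +
            ∑ s ∈ S, f (∑ u ∈ S.filter (· < s), Measure.dirac u) s := by
      rw [Finset.sum_insert hmS, h1]
      congr 1
      exact Finset.sum_congr rfl fun s hs => by rw [h2 s hs]
    rw [h3 fun η _ => F η, h3 fun η s => F (η + Measure.dirac s), Finset.sum_insert hmS, ih,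
      add_comm (Measure.dirac m), add_left_comm]

/-- The telescoping identity up to time `t`. -/
theorem restrict_Iio_add_setLIntegral (F : Measure (Horizon T) → ℝ≥0∞) {N : Measure (Horizon T)}
    {S : Finset (Horizon T)} (hN : N = ∑ s ∈ S, Measure.dirac s) (t : Horizon T) :
    F (N.restrict (Iio t)) + ∫⁻ s in Iio t, F (N.restrict (Iio s)) ∂N =
      F 0 + ∫⁻ s in Iio t, F (N.restrict (Iio s) + Measure.dirac s) ∂N := by
  have hNt : N.restrict (Iio t) = ∑ s ∈ S.filter (· < t), Measure.dirac s := by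
    rw [hN, restrict_Iio_sum_dirac]
  have hres (s : Horizon T) (hs : s ∈ S.filter (· < t)) :
      (∑ u ∈ S.filter (· < t), Measure.dirac u : Measure (Horizon T)).restrict (Iio s) =
        N.restrict (Iio s) := by
    rw [← hNt, Measure.restrict_restrict measurableSet_Iio, inter_eq_left.2
      (Iio_subset_Iio (Finset.mem_filter.1 hs).2.le)]
  have h := add_sum_restrict_Iio F (S.filter (· < t))
  have h1 (f : Measure (Horizon T) → Horizon T → ℝ≥0∞) :
      ∑ s ∈ S.filter (· < t),
        f ((∑ u ∈ S.filter (· < t), Measure.dirac u : Measure (Horizon T)).restrict (Iio s)) s =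
      ∑ s ∈ S.filter (· < t), f (N.restrict (Iio s)) s :=
    Finset.sum_congr rfl fun s hs => by rw [hres s hs]
  rw [h1 fun η _ => F η, h1 fun η s => F (η + Measure.dirac s)] at h
  rw [hNt, lintegral_sum_dirac, lintegral_sum_dirac]
  exact h

section Past

variable {Ω : Type*} [mΩ : MeasurableSpace Ω] {P : Measure Ω} {𝓕 : Filtration (Horizon T) mΩ}
  {N : Ω → Measure (Horizon T)}

theorem IsAdaptedPointProcess.measurable (hN : IsAdaptedPointProcess P 𝓕 N) : Measurable N := by
  have h := hN.adapted ⊤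
  simp only [Iic_top, Measure.restrict_univ] at h
  exact h.mono (𝓕.le _) le_rfl

/-- The strict past of an adapted point process is predictable. -/
theorem IsAdaptedPointProcess.measurable_restrict_Iio (hN : IsAdaptedPointProcess P 𝓕 N) :
    Measurable[𝓕.predictable] fun p : Horizon T × Ω => (N p.2).restrict (Iio p.1) := by
  obtain ⟨D, hDc, hD⟩ := TopologicalSpace.exists_countable_dense (Horizon T)
  have : Countable D := hDc
  refine @Measure.measurable_of_measurable_coe _ _ _ 𝓕.predictable _ fun B hB => ?_
  have key : (fun p : Horizon T × Ω => (N p.2).restrict (Iio p.1) B) = fun p =>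
      ⨆ q : D, (Ioi (q : Horizon T) ×ˢ univ).indicator
        (fun p : Horizon T × Ω => (N p.2).restrict (Iic (q : Horizon T)) B) p := by
    funext ⟨t, ω⟩
    have h := setLIntegral_Iio_eq_iSup hD hDc (N ω) (measurable_one.indicator hB) t
    simp only [lintegral_indicator_one hB] at h
    rw [h]
    refine iSup_congr fun q => ?_
    by_cases hq : (q : Horizon T) < t
    · rw [if_pos hq, indicator_of_mem (by exact ⟨hq, mem_univ _⟩)]
    · rw [if_neg hq, indicator_of_notMem (by exact fun h => hq h.1)]
  rw [key]
  refine Measurable.iSup (mδ := 𝓕.predictable) fun q => ?_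
  refine measurable_indicator_Ioi_predictable (q : Horizon T) ?_
  exact ((Measure.measurable_coe hB).comp (hN.adapted q)).comp
    (@measurable_snd _ _ _ (𝓕 (q : Horizon T)))

theorem IsAdaptedPointProcess.measurable_restrict_Iio_add_dirac
    (hN : IsAdaptedPointProcess P 𝓕 N) :
    Measurable[𝓕.predictable] fun p : Horizon T × Ω =>
      (N p.2).restrict (Iio p.1) + Measure.dirac p.1 := by
  refine @Measure.measurable_of_measurable_coe _ _ _ 𝓕.predictable _ fun B hB => ?_
  have h1 : Measurable[𝓕.predictable] fun p : Horizon T × Ω => (N p.2).restrict (Iio p.1) B :=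
    (Measure.measurable_coe hB).comp hN.measurable_restrict_Iio
  have h2 : Measurable[𝓕.predictable] fun p : Horizon T × Ω => Measure.dirac p.1 B :=
    ((Measure.measurable_coe hB).comp Measure.measurable_dirac).comp measurable_fst_predictable
  exact h1.add h2

/-- The compensation formula on `[0, t)`, with the expectation inside the time integral. -/
theorem HasIntensity.lintegral_setLIntegral_Iio [IsProbabilityMeasure P]
    {lam : Horizon T → Ω → ℝ≥0∞} (hN : HasIntensity P 𝓕 N lam)
    {C : Horizon T × Ω → ℝ≥0∞} (hC : Measurable[𝓕.predictable] C) (t : Horizon T) :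
    ∫⁻ ω, ∫⁻ s in Iio t, C (s, ω) ∂(N ω) ∂P =
      ∫⁻ s in Iio t, ∫⁻ ω, C (s, ω) * lam s ω ∂P ∂(lebesgue T) := by
  have hS : MeasurableSet[𝓕.predictable] {p : Horizon T × Ω | p.1 < t} :=
    measurable_fst_predictable measurableSet_Iio
  have hC' : Measurable[𝓕.predictable] ({p : Horizon T × Ω | p.1 < t}.indicator C) :=
    Measurable.indicator (m := 𝓕.predictable) hC hS
  have h := hN.compensator (fun s ω => {p : Horizon T × Ω | p.1 < t}.indicator C (s, ω))
    (by exact hC'.stronglyMeasurable)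
  have hlam : Measurable (Function.uncurry lam) :=
    (show StronglyMeasurable[𝓕.predictable] (Function.uncurry lam) from
      hN.predictable).measurable.mono predictable_le_prod le_rfl
  have hmeas : Measurable fun p : Ω × Horizon T =>
      {p : Horizon T × Ω | p.1 < t}.indicator C p.swap * lam p.2 p.1 :=
    ((hC'.mono predictable_le_prod le_rfl).comp measurable_swap).mul (hlam.comp measurable_swap)
  have h1 (ω : Ω) : ∫⁻ s in Iio t, C (s, ω) ∂(N ω) =
      ∫⁻ s, {p : Horizon T × Ω | p.1 < t}.indicator C (s, ω) ∂(N ω) := by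
    rw [← lintegral_indicator measurableSet_Iio]
    rfl
  simp_rw [h1]
  rw [h, lintegral_lintegral_swap hmeas.aemeasurable, ← lintegral_indicator measurableSet_Iio]
  refine lintegral_congr fun s => ?_
  by_cases hs : s < t
  · rw [indicator_of_mem (show s ∈ Iio t from hs)]
    refine lintegral_congr fun ω => ?_
    rw [indicator_of_mem (show (s, ω) ∈ {p : Horizon T × Ω | p.1 < t} from hs)]
  · rw [indicator_of_notMem (show s ∉ Iio t from hs)]
    simp [indicator_of_notMem (show (s, _) ∉ {p : Horizon T × Ω | p.1 < t} from hs)]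

/-- The forward equation for a functional of the past: at rate `lam`, an event at time `s` replaces
the past `η` by `η + δ_s`. The two terms of the increment stand on opposite sides of the equation,
so that all quantities are nonnegative. -/
theorem forward_equation [IsProbabilityMeasure P] {lam : Horizon T → Ω → ℝ≥0∞}
    (hp : IsAdaptedPointProcess P 𝓕 N) (hN : HasIntensity P 𝓕 N lam)
    {F : Measure (Horizon T) → ℝ≥0∞} (hF : Measurable F) (t : Horizon T) :
    ∫⁻ ω, F ((N ω).restrict (Iio t)) ∂P +
        ∫⁻ s in Iio t, ∫⁻ ω, F ((N ω).restrict (Iio s)) * lam s ω ∂P ∂(lebesgue T) =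
      F 0 + ∫⁻ s in Iio t, ∫⁻ ω, F ((N ω).restrict (Iio s) + Measure.dirac s) * lam s ω ∂P
        ∂(lebesgue T) := by
  have h1 := hN.lintegral_setLIntegral_Iio (hF.comp hp.measurable_restrict_Iio) t
  have h2 := hN.lintegral_setLIntegral_Iio (hF.comp hp.measurable_restrict_Iio_add_dirac) t
  simp only [Function.comp_apply] at h1 h2
  have h3 : Measurable fun ω => F ((N ω).restrict (Iio t)) :=
    hF.comp ((measurable_measure_restrict measurableSet_Iio).comp hp.measurable)
  rw [← h1, ← h2, ← lintegral_add_left h3]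
  have h0 : F 0 = ∫⁻ _, F 0 ∂P := by simp
  rw [h0, ← lintegral_add_left measurable_const]
  refine lintegral_congr_ae ?_
  filter_upwards [hp.counting] with ω ⟨S, _, hS⟩
  exact restrict_Iio_add_setLIntegral F hS t

/-- A point process with an intensity almost surely has no event at the final time. -/
theorem IsAdaptedPointProcess.ae_restrict_Iio_top {lam : Horizon T → Ω → ℝ≥0∞}
    (hp : IsAdaptedPointProcess P 𝓕 N) (hN : HasIntensity P 𝓕 N lam) :
    ∀ᵐ ω ∂P, (N ω).restrict (Iio ⊤) = N ω := by
  have hS : MeasurableSet ({⊤} : Set (Horizon T)) := measurableSet_singleton _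
  have hC : Measurable[𝓕.predictable] fun p : Horizon T × Ω =>
      ({⊤} : Set (Horizon T)).indicator (1 : Horizon T → ℝ≥0∞) p.1 :=
    (measurable_one.indicator hS).comp measurable_fst_predictable
  have h := hN.compensator (fun s _ => ({⊤} : Set (Horizon T)).indicator 1 s)
    (by exact hC.stronglyMeasurable)
  have h0 (ω : Ω) : ∫⁻ s, ({⊤} : Set (Horizon T)).indicator 1 s * lam s ω ∂(lebesgue T) = 0 := by
    have h1 : ∀ᵐ s ∂(lebesgue T), s ∉ ({⊤} : Set (Horizon T)) :=
      measure_eq_zero_iff_ae_notMem.1 (measure_singleton _)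
    refine (lintegral_congr_ae ?_).trans lintegral_zero
    filter_upwards [h1] with s hs
    rw [indicator_of_notMem hs, zero_mul]
  simp_rw [h0, lintegral_zero, lintegral_indicator_one hS] at h
  have h1 : ∀ᵐ ω ∂P, N ω {⊤} = 0 :=
    (lintegral_eq_zero_iff ((Measure.measurable_coe hS).comp hp.measurable)).1 h
  filter_upwards [h1] with ω hω
  refine Measure.restrict_eq_self_of_ae_mem ?_
  filter_upwards [measure_eq_zero_iff_ae_notMem.1 hω] with s hs
  exact lt_of_le_of_ne le_top hs

end Past

/-! ### Uniqueness in law -/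

/-- The mass that `[0, t)` carries after level `K` has been passed. -/
theorem measure_Iio_inter_setOf_lt_le (m : Measure (Horizon T)) [IsFiniteMeasure m] (K : ℝ≥0∞)
    (t : Horizon T) : m (Iio t ∩ {s | K < m (Iio s)}) ≤ m (Iio t) - K := by
  set S := Iio t ∩ {s | K < m (Iio s)} with hS
  obtain ⟨D, hDc, hD⟩ := TopologicalSpace.exists_countable_dense (Horizon T)
  have hIco (s : Horizon T) (hs : s ∈ S) : m (Ico s t) ≤ m (Iio t) - K := by
    rw [← Iio_sdiff_Iio, measure_sdiff (Iio_subset_Iio hs.1.le) measurableSet_Iio.nullMeasurableSet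
      (measure_ne_top _ _)]
    exact tsub_le_tsub_left hs.2.le _
  by_cases hmin : ∃ s ∈ S, ∀ s' ∈ S, s ≤ s'
  · obtain ⟨s, hs, h⟩ := hmin
    have hsub : S ⊆ Ico s t := fun s' hs' => ⟨h s' hs', hs'.1⟩
    exact (measure_mono hsub).trans (hIco s hs)
  push Not at hmin
  have hcover : S ⊆ ⋃ q : ↥(D ∩ S), Ico (q : Horizon T) t := by
    intro s hs
    obtain ⟨s', hs', hlt⟩ := hmin s hs
    obtain ⟨q, hqD, hq⟩ := hD.exists_between hlt
    exact mem_iUnion.2 ⟨⟨q, hqD, hq.2.trans hs.1, hs'.2.trans_le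
      (measure_mono (Iio_subset_Iio hq.1.le))⟩, hq.2.le, hs.1⟩
  have : Countable ↥(D ∩ S) := (hDc.mono inter_subset_left).to_subtype
  have hdir : Directed (· ⊆ ·) fun q : ↥(D ∩ S) => Ico (q : Horizon T) t :=
    directed_of_isDirected_ge fun q q' h => Ico_subset_Ico_left h
  refine (measure_mono hcover).trans ?_
  rw [hdir.measure_iUnion]
  exact iSup_le fun q => hIco q q.2.2

/-- Grönwall's lemma in homogeneous form, for a bounded function that need not be measurable. Each
stretch of time carrying mass at most `1 / 2` contributes a contraction. -/
theorem eq_zero_of_le_setLIntegral_Iio (m : Measure (Horizon T)) [IsFiniteMeasure m]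
    {δ : Horizon T → ℝ≥0∞} (hone : ∀ t, δ t ≤ 1)
    (h : ∀ t, δ t ≤ ∫⁻ s in Iio t, δ s ∂m) (t : Horizon T) : δ t = 0 := by
  have key (k : ℕ) : ∀ t, m (Iio t) ≤ k / 2 → δ t = 0 := by
    induction k with
    | zero =>
      intro t ht
      have h0 : m (Iio t) = 0 := by simpa using ht
      have := h t
      rw [setLIntegral_measure_zero _ _ h0] at this
      exact le_antisymm this zero_le
    | succ k ih =>
      set M : ℝ≥0∞ := ⨆ t : {t : Horizon T // m (Iio t) ≤ (k + 1 : ℕ) / 2}, δ t with hM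
      have hA : MeasurableSet {s : Horizon T | (k : ℝ≥0∞) / 2 < m (Iio s)} :=
        measurableSet_lt measurable_const
          (Monotone.measurable fun s s' hs => measure_mono (Iio_subset_Iio hs))
      have hhalf (t : Horizon T) (ht : m (Iio t) ≤ (k + 1 : ℕ) / 2) : δ t ≤ M / 2 := by
        calc δ t ≤ ∫⁻ s in Iio t, δ s ∂m := h t
          _ ≤ ∫⁻ s in Iio t, {s : Horizon T | (k : ℝ≥0∞) / 2 < m (Iio s)}.indicator
                (fun _ => M) s ∂m := by
              refine setLIntegral_mono' measurableSet_Iio fun s hs => ?_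
              by_cases hs' : (k : ℝ≥0∞) / 2 < m (Iio s)
              · rw [indicator_of_mem (by exact hs')]
                exact le_iSup (fun t : {t : Horizon T // m (Iio t) ≤ (k + 1 : ℕ) / 2} => δ t)
                  ⟨s, (measure_mono (Iio_subset_Iio (le_of_lt hs))).trans ht⟩
              · rw [ih s (not_lt.1 hs')]
                exact zero_le
          _ = M * m (Iio t ∩ {s | (k : ℝ≥0∞) / 2 < m (Iio s)}) := by
              rw [lintegral_indicator_const hA, Measure.restrict_apply hA, inter_comm]
          _ ≤ M * (1 / 2) := by
              gcongr
              refine (measure_Iio_inter_setOf_lt_le m _ t).trans ?_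
              refine (tsub_le_tsub_right ht _).trans ?_
              rw [tsub_le_iff_left, ← ENNReal.add_div]
              push_cast
              exact le_rfl
          _ = M / 2 := by rw [one_div, div_eq_mul_inv]
      have hM1 : M ≤ 1 := iSup_le fun t => hone t
      have hM2 : M ≤ M / 2 := iSup_le fun t => hhalf t t.2
      have hM0 : M = 0 := by
        by_contra hne
        exact absurd hM2 (not_le.2 (ENNReal.half_lt_self hne (ne_top_of_le_ne_top ENNReal.one_ne_top hM1)))
      intro t ht
      have := hhalf t ht
      rw [hM0, ENNReal.zero_div] at this
      exact le_antisymm this zero_le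
  obtain ⟨k, hk⟩ := ENNReal.exists_nat_gt (ENNReal.mul_ne_top (measure_ne_top m (Iio t))
    ENNReal.ofNat_ne_top : m (Iio t) * 2 ≠ ∞)
  exact key k t ((ENNReal.le_div_iff_mul_le (Or.inl two_ne_zero)
    (Or.inl ENNReal.ofNat_ne_top)).2 hk.le)

/-- The functionals with values in `[0, 1]` that vanish unless the total mass of
the jumps of the excitation is at most `K`. On such configurations the self-exciting intensity is
at most `ν + K`. -/
structure IsTestFunctional (θ : Horizon T → Param) (K : ℝ≥0) (F : Measure (Horizon T) → ℝ≥0∞) :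
    Prop where
  measurable : Measurable F
  le_one : ∀ η, F η ≤ 1
  eq_zero : ∀ η, K < ∫⁻ s, ((θ s).2.1 : ℝ≥0∞) ∂η → F η = 0

theorem hawkesIntensity_le (θ : Horizon T → Param) (η : Measure (Horizon T)) (t : Horizon T) :
    hawkesIntensity θ η t ≤ (θ t).1 + ∫⁻ s, ((θ s).2.1 : ℝ≥0∞) ∂η := by
  rw [hawkesIntensity_eq]
  refine add_le_add le_rfl ?_
  refine le_trans (b := ∫⁻ s in Iio t, ((θ s).2.1 : ℝ≥0∞) ∂η) ?_ (setLIntegral_le_lintegral _ _)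
  refine setLIntegral_mono' (measurableSet_Iio (a := t)) fun s hs => ?_
  have h1 : 0 ≤ ((θ s).2.2 : ℝ) * (((t : ℝ≥0) : ℝ) - ((s : ℝ≥0) : ℝ)) :=
    mul_nonneg (NNReal.coe_nonneg _) (sub_nonneg.2 (by exact_mod_cast (le_of_lt hs : s ≤ t)))
  have h2 : ENNReal.ofReal (Real.exp (-(((θ s).2.2 : ℝ) *
      (((t : ℝ≥0) : ℝ) - ((s : ℝ≥0) : ℝ))))) ≤ 1 :=
    ENNReal.ofReal_le_one.2 (Real.exp_le_one_iff.2 (neg_nonpos.2 h1))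
  exact (mul_le_mul_right h2 _).trans_eq (mul_one _)

/-- The intensity at time `t` only depends on the strict past of `t`. -/
theorem hawkesIntensity_restrict_Iio (θ : Horizon T → Param) (η : Measure (Horizon T))
    (t : Horizon T) : hawkesIntensity θ (η.restrict (Iio t)) t = hawkesIntensity θ η t := by
  rw [hawkesIntensity_eq, hawkesIntensity_eq, Measure.restrict_restrict measurableSet_Iio,
    inter_self]

theorem measurable_hawkesIntensity_measure {θ : Horizon T → Param} (hθ : Measurable θ)
    (t : Horizon T) : Measurable fun η : Measure (Horizon T) => hawkesIntensity θ η t := by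
  simp_rw [hawkesIntensity_eq]
  refine Measurable.const_add ?_ _
  exact (Measure.measurable_lintegral (measurable_excitation hθ measurable_const
    measurable_id)).comp (measurable_measure_restrict measurableSet_Iio)

/-- The terms of the forward equation, normalised by `ν + K`, are again expectations of test
functionals. The cases `κ = 0` and `κ = δ_t` correspond to the past before and after an event. -/
theorem IsTestFunctional.mul_hawkesIntensity {θ : Horizon T → Param} (hθ : Measurable θ) {K : ℝ≥0}
    (hK : K ≠ 0) {F : Measure (Horizon T) → ℝ≥0∞} (hF : IsTestFunctional θ K F)
    (κ : Measure (Horizon T)) (t : Horizon T) :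
    IsTestFunctional θ K fun η => F (η + κ) * hawkesIntensity θ η t / ((θ t).1 + K) where
  measurable := by
    have h1 : Measurable fun η : Measure (Horizon T) => η + κ := by
      refine Measure.measurable_of_measurable_coe _ fun B hB => ?_
      exact (Measure.measurable_coe hB).add measurable_const
    exact ((hF.measurable.comp h1).mul (measurable_hawkesIntensity_measure hθ t)).div_const _
  le_one η := by
    have hK0 : ((θ t).1 : ℝ≥0∞) + K ≠ 0 := by simp [hK]
    refine ENNReal.div_le_of_le_mul ?_
    rw [one_mul]
    by_cases h : (K : ℝ≥0∞) < ∫⁻ s, ((θ s).2.1 : ℝ≥0∞) ∂(η + κ)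
    · rw [hF.eq_zero _ h, zero_mul]
      exact zero_le
    · rw [lintegral_add_measure] at h
      calc F (η + κ) * hawkesIntensity θ η t ≤ 1 * ((θ t).1 + ∫⁻ s, ((θ s).2.1 : ℝ≥0∞) ∂η) :=
            mul_le_mul' (hF.le_one _) (hawkesIntensity_le θ η t)
        _ ≤ (θ t).1 + K := by
            rw [one_mul]
            gcongr
            exact le_self_add.trans (not_lt.1 h)
  eq_zero η h := by
    rw [hF.eq_zero, zero_mul, ENNReal.zero_div]
    rw [lintegral_add_measure]
    exact h.trans_le le_self_add

section Uniqueness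

variable {Ω : Type*} [mΩ : MeasurableSpace Ω] {P : Measure Ω} {𝓕 : Filtration (Horizon T) mΩ}
  {θ : Horizon T → Param} {N : Ω → Measure (Horizon T)} {K : ℝ≥0}
  {F : Measure (Horizon T) → ℝ≥0∞}

theorem mul_lintegral_mul_hawkesIntensity (hK : K ≠ 0) (F : Measure (Horizon T) → ℝ≥0∞)
    (N : Ω → Measure (Horizon T)) (κ : Measure (Horizon T)) (s : Horizon T) :
    ((θ s).1 + K) * ∫⁻ ω, F ((N ω).restrict (Iio s) + κ) *
        hawkesIntensity θ ((N ω).restrict (Iio s)) s / ((θ s).1 + K) ∂P =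
      ∫⁻ ω, F ((N ω).restrict (Iio s) + κ) * hawkesIntensity θ (N ω) s ∂P := by
  have hK0 : ((θ s).1 : ℝ≥0∞) + K ≠ 0 := by simp [hK]
  have hK1 : ((θ s).1 : ℝ≥0∞) + K ≠ ∞ := by simp
  rw [← lintegral_const_mul' _ _ hK1]
  refine lintegral_congr fun ω => ?_
  rw [hawkesIntensity_restrict_Iio, ENNReal.mul_div_cancel hK0 hK1]

theorem HasIntensity.measurable_lintegral_mul [SFinite P] {lam : Horizon T → Ω → ℝ≥0∞}
    (hN : HasIntensity P 𝓕 N lam) {C : Horizon T × Ω → ℝ≥0∞} (hC : Measurable[𝓕.predictable] C) :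
    Measurable fun s => ∫⁻ ω, C (s, ω) * lam s ω ∂P := by
  have hlam : Measurable (Function.uncurry lam) :=
    (show StronglyMeasurable[𝓕.predictable] (Function.uncurry lam) from
      hN.predictable).measurable.mono predictable_le_prod le_rfl
  exact Measurable.lintegral_prod_right' ((hC.mono predictable_le_prod le_rfl).mul hlam)

/-- One step of the comparison of two Hawkes processes with the same deterministic parameter: by
the forward equation, the discrepancy at time `t` is at most the integral over `[0, t)` of twice
the earlier discrepancies, weighted by the bound `ν + K` on the intensity. -/
theorem IsHawkesProcess.lintegral_le_add {Ω' : Type*} [mΩ' : MeasurableSpace Ω'] {P' : Measure Ω'}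
    {𝓖 : Filtration (Horizon T) mΩ'} {N' : Ω' → Measure (Horizon T)}
    [IsProbabilityMeasure P] [IsProbabilityMeasure P'] (hθ : Measurable θ)
    (hbase : ∫⁻ t, ((θ t).1 : ℝ≥0∞) ∂(lebesgue T) < ∞)
    (hN : IsHawkesProcess P 𝓕 (fun t _ => θ t) N) (hN' : IsHawkesProcess P' 𝓖 (fun t _ => θ t) N')
    (hK : K ≠ 0) {δ : Horizon T → ℝ≥0∞}
    (h1 : ∀ G, IsTestFunctional θ K G → ∀ s, ∫⁻ ω, G ((N ω).restrict (Iio s)) ∂P ≤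
      ∫⁻ ω, G ((N' ω).restrict (Iio s)) ∂P' + δ s)
    (h2 : ∀ G, IsTestFunctional θ K G → ∀ s, ∫⁻ ω, G ((N' ω).restrict (Iio s)) ∂P' ≤
      ∫⁻ ω, G ((N ω).restrict (Iio s)) ∂P + δ s)
    (hF : IsTestFunctional θ K F) (t : Horizon T) :
    ∫⁻ ω, F ((N ω).restrict (Iio t)) ∂P ≤ ∫⁻ ω, F ((N' ω).restrict (Iio t)) ∂P' +
      2 * ∫⁻ s in Iio t, ((θ s).1 + K) * δ s ∂(lebesgue T) := by
  set ε := ∫⁻ s in Iio t, ((θ s).1 + K) * δ s ∂(lebesgue T)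
  have e1 := HawkesExistence.forward_equation hN.pointProcess hN.intensity hF.measurable t
  have e2 := HawkesExistence.forward_equation hN'.pointProcess hN'.intensity hF.measurable t
  set A := ∫⁻ s in Iio t, ∫⁻ ω, F ((N ω).restrict (Iio s)) *
    hawkesIntensity (fun s => θ s) (N ω) s ∂P ∂(lebesgue T) with hAdef
  have hA : A ≠ ∞ := by
    have hle : A ≤ ∫⁻ s, (((θ s).1 : ℝ≥0∞) + K) ∂(lebesgue T) := by
      refine (setLIntegral_le_lintegral _ _).trans (lintegral_mono fun s => ?_)
      have h := mul_lintegral_mul_hawkesIntensity (θ := θ) (P := P) hK F N 0 s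
      simp only [add_zero] at h
      rw [← h]
      refine (mul_le_mul_right (lintegral_mono (g := fun _ => 1) fun ω => ?_) _).trans_eq
        (by simp)
      have := (hF.mul_hawkesIntensity hθ hK 0 s).le_one ((N ω).restrict (Iio s))
      simpa only [add_zero] using this
    refine ne_top_of_le_ne_top ?_ hle
    rw [lintegral_add_right _ measurable_const, lintegral_const]
    exact ENNReal.add_ne_top.2 ⟨hbase.ne, ENNReal.mul_ne_top ENNReal.coe_ne_top (measure_ne_top _ _)⟩
  have hstep1 : ∫⁻ s in Iio t, ∫⁻ ω, F ((N' ω).restrict (Iio s)) *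
      hawkesIntensity (fun s => θ s) (N' ω) s ∂P' ∂(lebesgue T) ≤ A + ε := by
    have hmeas := hN.intensity.measurable_lintegral_mul
      (hF.measurable.comp hN.pointProcess.measurable_restrict_Iio)
    simp only [Function.comp_apply] at hmeas
    rw [hAdef, ← lintegral_add_left hmeas]
    refine lintegral_mono fun s => ?_
    have g1 := mul_lintegral_mul_hawkesIntensity (θ := θ) (P := P) hK F N 0 s
    have g2 := mul_lintegral_mul_hawkesIntensity (θ := θ) (P := P') hK F N' 0 s
    simp only [add_zero] at g1 g2
    rw [← g1, ← g2, ← mul_add]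
    gcongr
    have := h2 _ (hF.mul_hawkesIntensity hθ hK 0 s) s
    simpa only [add_zero] using this
  have hstep2 : ∫⁻ s in Iio t, ∫⁻ ω, F ((N ω).restrict (Iio s) + Measure.dirac s) *
      hawkesIntensity (fun s => θ s) (N ω) s ∂P ∂(lebesgue T) ≤
      ∫⁻ s in Iio t, ∫⁻ ω, F ((N' ω).restrict (Iio s) + Measure.dirac s) *
        hawkesIntensity (fun s => θ s) (N' ω) s ∂P' ∂(lebesgue T) + ε := by
    have hmeas := hN'.intensity.measurable_lintegral_mul
      (hF.measurable.comp hN'.pointProcess.measurable_restrict_Iio_add_dirac)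
    simp only [Function.comp_apply] at hmeas
    rw [← lintegral_add_left hmeas]
    refine lintegral_mono fun s => ?_
    have g1 := mul_lintegral_mul_hawkesIntensity (θ := θ) (P := P) hK F N (Measure.dirac s) s
    have g2 := mul_lintegral_mul_hawkesIntensity (θ := θ) (P := P') hK F N' (Measure.dirac s) s
    rw [← g1, ← g2, ← mul_add]
    gcongr
    exact h1 _ (hF.mul_hawkesIntensity hθ hK (Measure.dirac s) s) s
  refine (ENNReal.add_le_add_iff_right hA).1 ?_
  calc ∫⁻ ω, F ((N ω).restrict (Iio t)) ∂P + A
      ≤ (F 0 + ∫⁻ s in Iio t, ∫⁻ ω, F ((N' ω).restrict (Iio s) + Measure.dirac s) *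
        hawkesIntensity (fun s => θ s) (N' ω) s ∂P' ∂(lebesgue T)) + ε := by
        rw [e1, add_assoc]
        gcongr
    _ ≤ ∫⁻ ω, F ((N' ω).restrict (Iio t)) ∂P' + (A + ε) + ε := by
        rw [← e2]
        gcongr
    _ = ∫⁻ ω, F ((N' ω).restrict (Iio t)) ∂P' + 2 * ε + A := by
        rw [two_mul]
        abel

/-- The expectations of test functionals of the past are determined by the parameter: Grönwall's
lemma applies to the supremum over all test functionals of the discrepancy at time `t`. -/
theorem IsHawkesProcess.lintegral_restrict_Iio_eq {Ω' : Type*} [mΩ' : MeasurableSpace Ω']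
    {P' : Measure Ω'} {𝓖 : Filtration (Horizon T) mΩ'} {N' : Ω' → Measure (Horizon T)}
    [IsProbabilityMeasure P] [IsProbabilityMeasure P'] (hθ : Measurable θ)
    (hbase : ∫⁻ t, ((θ t).1 : ℝ≥0∞) ∂(lebesgue T) < ∞)
    (hN : IsHawkesProcess P 𝓕 (fun t _ => θ t) N) (hN' : IsHawkesProcess P' 𝓖 (fun t _ => θ t) N')
    (hK : K ≠ 0) (hF : IsTestFunctional θ K F) (t : Horizon T) :
    ∫⁻ ω, F ((N ω).restrict (Iio t)) ∂P = ∫⁻ ω, F ((N' ω).restrict (Iio t)) ∂P' := by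
  let φ (G : Measure (Horizon T) → ℝ≥0∞) (s : Horizon T) := ∫⁻ ω, G ((N ω).restrict (Iio s)) ∂P
  let φ' (G : Measure (Horizon T) → ℝ≥0∞) (s : Horizon T) := ∫⁻ ω, G ((N' ω).restrict (Iio s)) ∂P'
  let δ : Horizon T → ℝ≥0∞ := fun s => ⨆ G : {G // IsTestFunctional θ K G},
    (φ G s - φ' G s) ⊔ (φ' G s - φ G s)
  let w : Horizon T → ℝ≥0∞ := fun s => 2 * ((θ s).1 + K)
  have hw : Measurable w := (hθ.fst.coe_nnreal_ennreal.add_const _).const_mul _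
  let m : Measure (Horizon T) := (lebesgue T).withDensity w
  have hm : IsFiniteMeasure m := by
    refine isFiniteMeasure_withDensity ?_
    have : ∫⁻ s, w s ∂(lebesgue T) = 2 * (∫⁻ t, ((θ t).1 : ℝ≥0∞) ∂(lebesgue T) +
        K * lebesgue T univ) := by
      rw [← lintegral_const, ← lintegral_add_right _ measurable_const, ← lintegral_const_mul]
      exact hθ.fst.coe_nnreal_ennreal.add_const _
    rw [this]
    exact ENNReal.mul_ne_top ENNReal.ofNat_ne_top (ENNReal.add_ne_top.2
      ⟨hbase.ne, ENNReal.mul_ne_top ENNReal.coe_ne_top (measure_ne_top _ _)⟩)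
  have h1 (G) (hG : IsTestFunctional θ K G) (s) : φ G s ≤ φ' G s + δ s := by
    rw [← tsub_le_iff_left]
    exact le_sup_left.trans (le_iSup (fun G : {G // IsTestFunctional θ K G} =>
      (φ G s - φ' G s) ⊔ (φ' G s - φ G s)) ⟨G, hG⟩)
  have h2 (G) (hG : IsTestFunctional θ K G) (s) : φ' G s ≤ φ G s + δ s := by
    rw [← tsub_le_iff_left]
    exact le_sup_right.trans (le_iSup (fun G : {G // IsTestFunctional θ K G} =>
      (φ G s - φ' G s) ⊔ (φ' G s - φ G s)) ⟨G, hG⟩)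
  have hint (t : Horizon T) : 2 * ∫⁻ s in Iio t, ((θ s).1 + K) * δ s ∂(lebesgue T) =
      ∫⁻ s in Iio t, δ s ∂m := by
    rw [setLIntegral_withDensity_eq_setLIntegral_mul_non_measurable _ hw _ measurableSet_Iio,
      ← lintegral_const_mul' _ _ ENNReal.ofNat_ne_top]
    · simp only [Pi.mul_apply, w, mul_assoc]
    · exact ae_of_all _ fun s => ENNReal.mul_lt_top ENNReal.ofNat_lt_top (by simp)
  have hone (G) (hG : IsTestFunctional θ K G) (s) : φ G s ≤ 1 ∧ φ' G s ≤ 1 :=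
    ⟨(lintegral_mono fun ω => hG.le_one _).trans_eq (by simp),
      (lintegral_mono fun ω => hG.le_one _).trans_eq (by simp)⟩
  have hδ := eq_zero_of_le_setLIntegral_Iio m (δ := δ)
    (fun s => iSup_le fun G => sup_le (tsub_le_self.trans (hone G G.2 s).1)
      (tsub_le_self.trans (hone G G.2 s).2))
    (fun s => iSup_le fun G => sup_le
      (tsub_le_iff_left.2 (hint s ▸ hN.lintegral_le_add hθ hbase hN' hK h1 h2 G.2 s))
      (tsub_le_iff_left.2 (hint s ▸ hN'.lintegral_le_add hθ hbase hN hK h2 h1 G.2 s))) t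
  refine le_antisymm ?_ ?_
  · have := h1 F hF t
    rwa [hδ, add_zero] at this
  · have := h2 F hF t
    rwa [hδ, add_zero] at this

theorem IsHawkesProcess.ae_lintegral_lt_top (hN : IsHawkesProcess P 𝓕 (fun t _ => θ t) N) :
    ∀ᵐ ω ∂P, ∫⁻ s, ((θ s).2.1 : ℝ≥0∞) ∂(N ω) < ∞ := by
  filter_upwards [hN.pointProcess.counting] with ω ⟨S, _, hS⟩
  rw [hS, lintegral_sum_dirac]
  exact ENNReal.sum_lt_top.2 fun s _ => ENNReal.coe_lt_top

/-- The restriction of a functional to the configurations on which the total mass of the jumps of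
the excitation is at most `n + 1`. -/
noncomputable def cutoff (θ : Horizon T → Param) (F : Measure (Horizon T) → ℝ≥0∞) (n : ℕ) :
    Measure (Horizon T) → ℝ≥0∞ :=
  {η | ∫⁻ s, ((θ s).2.1 : ℝ≥0∞) ∂η ≤ ((n + 1 : ℕ) : ℝ≥0)}.indicator F

theorem isTestFunctional_cutoff (hθ : Measurable θ) (hF : Measurable F) (hone : ∀ η, F η ≤ 1)
    (n : ℕ) : IsTestFunctional θ ((n + 1 : ℕ) : ℝ≥0) (cutoff θ F n) where
  measurable := hF.indicator (measurableSet_le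
    (Measure.measurable_lintegral hθ.snd.fst.coe_nnreal_ennreal) measurable_const)
  le_one η := (indicator_le_self _ _ _).trans (hone η)
  eq_zero η h := indicator_of_notMem (by exact not_le.2 h) _

theorem monotone_cutoff (θ : Horizon T → Param) (F : Measure (Horizon T) → ℝ≥0∞) :
    Monotone (cutoff θ F) := by
  refine fun n n' h η => indicator_le_indicator_of_subset (fun η hη => ?_) (fun _ => zero_le) η
  have h1 : ∫⁻ s, ((θ s).2.1 : ℝ≥0∞) ∂η ≤ (((n + 1 : ℕ) : ℝ≥0) : ℝ≥0∞) := hη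
  refine h1.trans ?_
  gcongr

theorem iSup_cutoff (θ : Horizon T → Param) (F : Measure (Horizon T) → ℝ≥0∞)
    {η : Measure (Horizon T)} (h : ∫⁻ s, ((θ s).2.1 : ℝ≥0∞) ∂η < ∞) :
    ⨆ n, cutoff θ F n η = F η := by
  refine le_antisymm (iSup_le fun n => indicator_le_self _ _ _) ?_
  obtain ⟨n, hn⟩ := ENNReal.exists_nat_gt h.ne
  refine le_iSup_of_le n ?_
  have hmem : ∫⁻ s, ((θ s).2.1 : ℝ≥0∞) ∂η ≤ (((n + 1 : ℕ) : ℝ≥0) : ℝ≥0∞) := by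
    refine hn.le.trans ?_
    push_cast
    exact le_self_add
  rw [cutoff, indicator_of_mem (by exact hmem)]

theorem IsHawkesProcess.map_apply_eq_iSup (hθ : Measurable θ)
    (hN : IsHawkesProcess P 𝓕 (fun t _ => θ t) N) {B : Set (Measure (Horizon T))}
    (hB : MeasurableSet B) :
    P.map N B = ⨆ n, ∫⁻ ω, cutoff θ (B.indicator 1) n ((N ω).restrict (Iio ⊤)) ∂P := by
  have hNm := hN.pointProcess.measurable
  have hone (η : Measure (Horizon T)) : B.indicator (1 : Measure (Horizon T) → ℝ≥0∞) η ≤ 1 :=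
    indicator_le_self' (by simp) η
  have hm (n : ℕ) : Measurable fun ω => cutoff θ (B.indicator 1) n ((N ω).restrict (Iio ⊤)) :=
    (isTestFunctional_cutoff hθ (measurable_one.indicator hB) hone n).measurable.comp
      ((measurable_measure_restrict measurableSet_Iio).comp hNm)
  rw [← lintegral_indicator_one hB, lintegral_map (measurable_one.indicator hB) hNm,
    ← lintegral_iSup hm fun n n' h ω => monotone_cutoff θ _ h _]
  refine lintegral_congr_ae ?_
  filter_upwards [hN.ae_lintegral_lt_top, hN.pointProcess.ae_restrict_Iio_top hN.intensity]
    with ω h1 h2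
  rw [h2]
  exact (iSup_cutoff θ (B.indicator 1) h1).symm

/-- Two Hawkes processes with the same deterministic parameter have the same law. -/
theorem IsHawkesProcess.map_eq_map {Ω' : Type*} [mΩ' : MeasurableSpace Ω']
    {P' : Measure Ω'} {𝓖 : Filtration (Horizon T) mΩ'} {N' : Ω' → Measure (Horizon T)}
    [IsProbabilityMeasure P] [IsProbabilityMeasure P'] (hθ : Measurable θ)
    (hbase : ∫⁻ t, ((θ t).1 : ℝ≥0∞) ∂(lebesgue T) < ∞)
    (hN : IsHawkesProcess P 𝓕 (fun t _ => θ t) N)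
    (hN' : IsHawkesProcess P' 𝓖 (fun t _ => θ t) N') : P.map N = P'.map N' := by
  ext B hB
  rw [hN.map_apply_eq_iSup hθ hB, hN'.map_apply_eq_iSup hθ hB]
  exact iSup_congr fun n => hN.lintegral_restrict_Iio_eq hθ hbase hN' (by positivity)
    (isTestFunctional_cutoff hθ (measurable_one.indicator hB)
      (fun η => indicator_le_self' (by simp) η) n) ⊤

end Uniqueness

/-! ### Conditioning on the parameter -/

/-- The conditional expectation of a function of two independent variables given the first. -/
theorem condExp_ae_eq_integral_of_indepFun {Ω α β : Type*} [mΩ : MeasurableSpace Ω]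
    [mα : MeasurableSpace α] [MeasurableSpace β] {P : Measure Ω} [IsProbabilityMeasure P]
    {U : Ω → α} {V : Ω → β} (hU : Measurable U) (hV : Measurable V) (hUV : IndepFun U V P)
    {φ : α × β → ℝ} (hφ : Measurable φ) {K : ℝ} (hK : ∀ p, |φ p| ≤ K) :
    P[fun ω => φ (U ω, V ω) | mα.comap U] =ᵐ[P] fun ω => ∫ ω', φ (U ω, V ω') ∂P := by
  have hPU : IsProbabilityMeasure (P.map U) := Measure.isProbabilityMeasure_map hU.aemeasurable
  have hPV : IsProbabilityMeasure (P.map V) := Measure.isProbabilityMeasure_map hV.aemeasurable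
  have hlaw := (indepFun_iff_map_prod_eq_prod_map_map hU.aemeasurable hV.aemeasurable).1 hUV
  let ψ : α → ℝ := fun a => ∫ b, φ (a, b) ∂(P.map V)
  have hψ : StronglyMeasurable ψ := hφ.stronglyMeasurable.integral_prod_right'
  have hψK (a : α) : ‖ψ a‖ ≤ K := by
    refine (norm_integral_le_of_norm_le_const (ae_of_all _ fun b => hK (a, b))).trans_eq ?_
    simp
  have hψeq (ω : Ω) : ∫ ω', φ (U ω, V ω') ∂P = ψ (U ω) :=
    (integral_map (f := fun b => φ (U ω, b)) hV.aemeasurable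
      (hφ.comp measurable_prodMk_left).aestronglyMeasurable).symm
  simp_rw [hψeq]
  have hint : Integrable (fun ω => ψ (U ω)) P :=
    Integrable.of_bound (hψ.comp_measurable hU).aestronglyMeasurable K (ae_of_all _ fun ω => hψK _)
  have hintφ : Integrable φ ((P.map U).prod (P.map V)) :=
    Integrable.of_bound hφ.aestronglyMeasurable K (ae_of_all _ hK)
  refine (ae_eq_condExp_of_forall_setIntegral_eq hU.comap_le ?_ (fun s _ _ => hint.integrableOn)
    ?_ ?_).symm
  · exact Integrable.of_bound (hφ.comp (hU.prodMk hV)).aestronglyMeasurable K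
      (ae_of_all _ fun ω => hK _)
  · rintro _ ⟨A, hA, rfl⟩ -
    have h1 : ∫ ω in U ⁻¹' A, ψ (U ω) ∂P = ∫ a in A, ψ a ∂(P.map U) :=
      (setIntegral_map hA hψ.aestronglyMeasurable hU.aemeasurable).symm
    have h2 : ∫ ω in U ⁻¹' A, φ (U ω, V ω) ∂P =
        ∫ p in A ×ˢ univ, φ p ∂(P.map fun ω => (U ω, V ω)) := by
      rw [setIntegral_map (hA.prod MeasurableSet.univ) hφ.aestronglyMeasurable
        (hU.prodMk hV).aemeasurable]
      congr 2
      ext ω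
      simp
    rw [h1, h2, hlaw, setIntegral_prod _ hintφ.integrableOn]
    simp [ψ]
  · exact (hψ.comp_measurable (comap_measurable U)).aestronglyMeasurable

/-- A process that is jointly measurable given its own path and an independent variable agrees,
for almost every path, at almost every time, with a jointly measurable function of time and path.
The independent variable is frozen at a suitable value: since at each fixed time the process is a
function of the path alone, almost every value is suitable. The evaluation `(t, y) ↦ y t` is itself
not jointly measurable on the space of all paths. -/
theorem exists_measurable_of_path {Ω E β : Type*} [mΩ : MeasurableSpace Ω] [mE : MeasurableSpace E]
    [MeasurableSpace β] [StandardBorelSpace β] [Nonempty β] {P : Measure Ω}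
    [IsProbabilityMeasure P] {θ : Horizon T → Ω → β} {X : Ω → E} (hθm : ∀ t, Measurable (θ t))
    (hX : Measurable X) (hind : IndepFun (fun ω t => θ t ω) X P)
    (hθ : Measurable[Prod.instMeasurableSpace
      (m₂ := MeasurableSpace.comap (fun ω => (X ω, fun t => θ t ω)) inferInstance)]
      (Function.uncurry θ)) :
    ∃ h : Horizon T → (Horizon T → β) → β, Measurable (Function.uncurry h) ∧
      ∀ᵐ ω ∂P, ∀ᵐ t ∂(lebesgue T), h t (fun s => θ s ω) = θ t ω := by
  have hY : Measurable fun ω t => θ t ω := measurable_pi_iff.2 hθm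
  let W : Ω → E × (Horizon T → β) := fun ω => (X ω, fun t => θ t ω)
  have hW : Measurable W := hX.prodMk hY
  have hθ' : Measurable (Function.uncurry θ) :=
    hθ.mono (sup_le_sup_left (MeasurableSpace.comap_mono hW.comap_le) _) le_rfl
  have hcomap : (Prod.instMeasurableSpace
      (m₂ := MeasurableSpace.comap W inferInstance) : MeasurableSpace (Horizon T × Ω)) =
      MeasurableSpace.comap (Prod.map id W) inferInstance := by
    have := MeasurableSpace.comap_prodMap (mα := (inferInstance : MeasurableSpace (Horizon T)))
      (mβ := (inferInstance : MeasurableSpace (E × (Horizon T → β)))) id W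
    rw [MeasurableSpace.comap_id] at this
    exact this.symm
  rw [hcomap] at hθ
  obtain ⟨H, hH, hHeq⟩ := hθ.exists_eq_measurable_comp
  have hHθ (t : Horizon T) (ω : Ω) : H (t, W ω) = θ t ω := (congrFun hHeq (t, ω)).symm
  have hPX : IsProbabilityMeasure (P.map X) := Measure.isProbabilityMeasure_map hX.aemeasurable
  have hPY : IsProbabilityMeasure (P.map fun ω t => θ t ω) :=
    Measure.isProbabilityMeasure_map hY.aemeasurable
  have hlaw := (indepFun_iff_map_prod_eq_prod_map_map hX.aemeasurable hY.aemeasurable).1 hind.symm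
  have hfix (t : Horizon T) : ∀ᵐ q ∂((P.map X).prod P),
      H (t, (q.1, fun s => θ s q.2)) = θ t q.2 := by
    have hm : MeasurableSet {w : E × (Horizon T → β) | H (t, w) = w.2 t} :=
      measurableSet_eq_fun (hH.comp measurable_prodMk_left)
        ((measurable_pi_apply t).comp measurable_snd)
    have h1 : ∀ᵐ w ∂(P.map W), H (t, w) = w.2 t :=
      (ae_map_iff hW.aemeasurable hm).2 (ae_of_all _ fun ω => hHθ t ω)
    have h2 : P.map W = ((P.map X).prod P).map (Prod.map id fun ω t => θ t ω) := by
      rw [← Measure.map_prod_map _ _ measurable_id hY, Measure.map_id]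
      exact hlaw
    rw [h2] at h1
    exact ae_of_ae_map (measurable_id.prodMap hY).aemeasurable h1
  have hjoint : MeasurableSet {z : Horizon T × (E × Ω) |
      H (z.1, (z.2.1, fun s => θ s z.2.2)) = θ z.1 z.2.2} := by
    refine measurableSet_eq_fun (hH.comp (measurable_fst.prodMk
      (measurable_snd.fst.prodMk (hY.comp measurable_snd.snd)))) ?_
    exact hθ'.comp (measurable_fst.prodMk measurable_snd.snd)
  have h1 := Measure.ae_ae_of_ae_prod ((Measure.ae_ae_comm hjoint).1
    (ae_of_all (lebesgue T) hfix))
  obtain ⟨n, hn⟩ := h1.exists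
  refine ⟨fun t y => H (t, (n, y)), hH.comp (measurable_fst.prodMk
    (measurable_const.prodMk measurable_snd)), hn⟩

/-- Processes that are jointly measurable with respect to the initial information are predictable. -/
theorem prod_bot_le_predictable {Ω : Type*} [mΩ : MeasurableSpace Ω]
    (𝓕 : Filtration (Horizon T) mΩ) :
    (Prod.instMeasurableSpace (m₂ := 𝓕 ⊥) : MeasurableSpace (Horizon T × Ω)) ≤ 𝓕.predictable := by
  refine sup_le measurable_fst_predictable.comap_le ?_
  rintro _ ⟨A, hA, rfl⟩
  have h : (Prod.snd ⁻¹' A : Set (Horizon T × Ω)) = {⊥} ×ˢ A ∪ Ioi ⊥ ×ˢ A := by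
    ext ⟨t, ω⟩
    simp only [mem_preimage, mem_union, mem_prod, mem_singleton_iff, mem_Ioi, bot_lt_iff_ne_bot]
    tauto
  rw [h]
  exact (measurableSet_predictable_singleton_bot_prod hA).union
    (measurableSet_predictable_Ioi_prod hA)

/-- The Hawkes path is a measurable function of a measurably parametrized parameter and of a
locally finite planar configuration. -/
theorem measurable_hawkesPath_noise {α : Type*} [MeasurableSpace α] {h : Horizon T → α → Param}
    (hh : Measurable (Function.uncurry h)) :
    Measurable fun p : α × {n : Measure (ℝ × ℝ) // IsLocallyFiniteMeasure n} =>
      hawkesPath (fun t => h t p.1) (noise T p.2.1) := by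
  let 𝓕 : Filtration (Horizon T) (inferInstance : MeasurableSpace
    (α × {n : Measure (ℝ × ℝ) // IsLocallyFiniteMeasure n})) := Filtration.const _ _ le_rfl
  have hx : IsAdaptedNoise 𝓕 fun p => noise T p.2.1 := by
    refine ⟨fun p n => ?_, fun t => ?_⟩
    · have := p.2.2
      exact noise_strip_lt_top n
    · exact (measurable_measure_restrict (measurableSet_Iic.prod MeasurableSet.univ)).comp
        (measurable_noise.comp (measurable_subtype_coe.comp measurable_snd))
  have hθ : Measurable[𝓕.predictable] (Function.uncurry fun t p => h t p.1) := by
    refine Measurable.mono ?_ (prod_bot_le_predictable 𝓕) le_rfl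
    exact hh.comp (measurable_fst.prodMk measurable_snd.fst)
  have := hx.thin_adapted (hx.measurable_limitRate_predictable hθ) ⊤
  simp only [Iic_top, Measure.restrict_univ] at this
  exact this

/-- Changing the parameter on a set of times that carries no noise does not change the path. -/
theorem IsDrivingNoise.ae_hawkesPath_congr {Ω : Type*} [mΩ : MeasurableSpace Ω] {P : Measure Ω}
    {𝓕 : Filtration (Horizon T) mΩ} {x : Ω → Measure (Horizon T × ℝ≥0)}
    [IsProbabilityMeasure P] (hx : IsDrivingNoise P 𝓕 x) (hxm : Measurable x)
    {θ θ' : Horizon T → Ω → Param} (hθ : Measurable[𝓕.predictable] (Function.uncurry θ))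
    (hθ' : Measurable[𝓕.predictable] (Function.uncurry θ'))
    (h : ∀ᵐ ω ∂P, ∀ᵐ t ∂(lebesgue T), θ t ω = θ' t ω) :
    ∀ᵐ ω ∂P, hawkesPath (fun t => θ t ω) (x ω) = hawkesPath (fun t => θ' t ω) (x ω) := by
  have hbad : MeasurableSet[𝓕.predictable]
      {p : Horizon T × Ω | Function.uncurry θ p ≠ Function.uncurry θ' p} :=
    (measurableSet_eq_fun hθ hθ').compl
  have hC : Measurable[Prod.instMeasurableSpace (m₁ := 𝓕.predictable)]
      (fun q : (Horizon T × Ω) × ℝ≥0 =>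
        {p : Horizon T × Ω | Function.uncurry θ p ≠ Function.uncurry θ' p}.indicator
          (fun _ => (1 : ℝ≥0∞)) q.1) :=
    (Measurable.indicator (m := 𝓕.predictable)
      (@measurable_const _ _ _ 𝓕.predictable _) hbad).comp (@measurable_fst _ _ 𝓕.predictable _)
  have hc := hx.campbell _ hC
  have hsec (ω : Ω) : MeasurableSet {t | θ t ω ≠ θ' t ω} :=
    measurable_prodMk_right (predictable_le_prod _ hbad)
  have hrhs : ∫⁻ ω, ∫⁻ s, ∫⁻ _z, {p : Horizon T × Ω | Function.uncurry θ p ≠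
      Function.uncurry θ' p}.indicator (fun _ => (1 : ℝ≥0∞)) (s, ω) ∂levelMeasure ∂(lebesgue T) ∂P
      = 0 := by
    refine (lintegral_congr_ae ?_).trans lintegral_zero
    filter_upwards [h] with ω hω
    refine (lintegral_congr_ae ?_).trans lintegral_zero
    filter_upwards [hω] with t ht
    rw [indicator_of_notMem (by simpa using ht)]
    exact lintegral_zero
  have hlhs (ω : Ω) : ∫⁻ p, {p : Horizon T × Ω | Function.uncurry θ p ≠
      Function.uncurry θ' p}.indicator (fun _ => (1 : ℝ≥0∞)) (p.1, ω) ∂(x ω) =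
      x ω ({t | θ t ω ≠ θ' t ω} ×ˢ univ) := by
    rw [← lintegral_indicator_one ((hsec ω).prod MeasurableSet.univ)]
    refine lintegral_congr fun p => ?_
    by_cases hp : θ p.1 ω = θ' p.1 ω
    · rw [indicator_of_notMem (by simpa using hp), indicator_of_notMem (by simpa using hp)]
    · rw [indicator_of_mem (by exact hp), indicator_of_mem (by exact ⟨hp, mem_univ _⟩)]
      rfl
  have hmeas := measurable_lintegral_of_partition hxm measurableSet_strip pairwise_disjoint_strip
    iUnion_strip hx.finite (f := fun y => {p : Horizon T × Ω | Function.uncurry θ p ≠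
      Function.uncurry θ' p}.indicator (fun _ => (1 : ℝ≥0∞)) (y.2.1, y.1))
    ((measurable_const.indicator (predictable_le_prod _ hbad)).comp
      (measurable_snd.fst.prodMk measurable_fst))
  filter_upwards [(lintegral_eq_zero_iff hmeas).1 (hc.trans hrhs)] with ω hω
  have h0 : x ω ({t | θ t ω ≠ θ' t ω} ×ˢ univ) = 0 := (hlhs ω).symm.trans hω
  exact hawkesPath_congr (hsec ω) h0 fun t ht => not_not.1 ht

theorem natural_top_eq_comap {Ω β : Type*} [mΩ : MeasurableSpace Ω] [TopologicalSpace β]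
    [TopologicalSpace.MetrizableSpace β] [mβ : MeasurableSpace β] [BorelSpace β]
    {θ : Horizon T → Ω → β} (hθ : ∀ t, StronglyMeasurable (θ t)) :
    Filtration.natural θ hθ ⊤ = MeasurableSpace.comap (fun ω t => θ t ω) inferInstance := by
  rw [MeasurableSpace.comap_process_pi]
  exact le_antisymm (iSup₂_le fun t _ => le_iSup (fun t => MeasurableSpace.comap (θ t) mβ) t)
    (iSup_le fun t => le_iSup₂ (f := fun (j : Horizon T) (_ : j ≤ ⊤) =>
      MeasurableSpace.comap (θ j) mβ) t le_top)

theorem predictable_le_prod_of_le {Ω : Type*} {m : MeasurableSpace Ω} [mΩ : MeasurableSpace Ω]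
    {𝓕 : Filtration (Horizon T) mΩ} (h : ∀ t, 𝓕 t ≤ m) :
    𝓕.predictable ≤ Prod.instMeasurableSpace (m₂ := m) :=
  measurableSpace_le_predictable_of_measurableSet
    (fun A hA => (measurableSet_singleton _).prod (h _ A hA))
    (fun i A hA => measurableSet_Ioi.prod (h i A hA))

/-- The conditional law of the thinning construction given the parameter path: conditionally on
`θ`, the configuration `hawkesPath θ x` has the law obtained by freezing the parameter path. -/
theorem condExp_hawkesPath_ae_eq {Ω : Type*} [mΩ : MeasurableSpace Ω] {P : Measure Ω}
    [IsProbabilityMeasure P] {θ : Horizon T → Ω → Param} (hθ : ∀ t, StronglyMeasurable (θ t))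
    {X : Ω → Measure (ℝ × ℝ)} (hX : IsPoissonRandomMeasure P X volume)
    (hind : IndepFun (fun ω t => θ t ω) X P)
    (hpred : Measurable[(Filtration.natural θ hθ ⊔
      randomMeasureFiltration T X hX.measurable).predictable] (Function.uncurry θ))
    {f : Measure (Horizon T) → ℝ} (hf : Measurable f) {K : ℝ} (hK : ∀ μ, |f μ| ≤ K) :
    P[fun ω => f (hawkesPath (fun t => θ t ω) (noise T (X ω))) | Filtration.natural θ hθ ⊤] =ᵐ[P]
      fun ω => ∫ ω', f (hawkesPath (fun t => θ t ω) (noise T (X ω'))) ∂P := by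
  have hY : Measurable fun ω t => θ t ω := measurable_pi_iff.2 fun t => (hθ t).measurable
  have htop := natural_top_eq_comap hθ
  let 𝓝 := randomMeasureFiltration T X hX.measurable
  have h𝓝 (t : Horizon T) : 𝓝 t ≤ MeasurableSpace.comap X inferInstance :=
    Measurable.comap_le ((measurable_measure_restrict
      (measurableSet_Icc.prod MeasurableSet.univ)).comp (comap_measurable X))
  have hnat (t : Horizon T) : Filtration.natural θ hθ t ≤
      MeasurableSpace.comap (fun ω t => θ t ω) inferInstance :=
    ((Filtration.natural θ hθ).mono le_top).trans htop.le
  -- A jointly measurable version of `θ`, determined by the path.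
  obtain ⟨h, hh, hhθ⟩ := exists_measurable_of_path (fun t => (hθ t).measurable) hX.measurable hind
    (hpred.mono (predictable_le_prod_of_le fun t => sup_le
      ((hnat t).trans (Measurable.comap_le (measurable_snd.comp (comap_measurable _))))
      ((h𝓝 t).trans (Measurable.comap_le (measurable_fst.comp (comap_measurable _))))) le_rfl)
  -- In `ℋ` the whole path of `θ` is known at time `0`, so that the version is predictable too.
  let ℋ : Filtration (Horizon T) mΩ := Filtration.const _
    (MeasurableSpace.comap (fun ω t => θ t ω) inferInstance) hY.comap_le ⊔ 𝓝
  have hxℋ : IsDrivingNoise P ℋ fun ω => noise T (X ω) :=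
    hX.isDrivingNoise hY.comap_le hind le_sup_right fun t => le_rfl
  have hx𝓝 : IsDrivingNoise P 𝓝 fun ω => noise T (X ω) :=
    hX.isDrivingNoise hY.comap_le hind le_rfl fun t => le_sup_right
  have hxm : Measurable fun ω => noise T (X ω) := measurable_noise.comp hX.measurable
  have hθℋ : Measurable[ℋ.predictable] (Function.uncurry θ) :=
    hpred.mono (predictable_mono (sup_le_sup_right (fun t => hnat t) _)) le_rfl
  have hθ'ℋ : Measurable[ℋ.predictable] (Function.uncurry fun t ω => h t fun s => θ s ω) := by
    refine Measurable.mono ?_ (prod_bot_le_predictable ℋ) le_rfl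
    have hsnd : Measurable[Prod.instMeasurableSpace (m₂ := ℋ ⊥)]
        fun z : Horizon T × Ω => fun s => θ s z.2 :=
      (Measurable.mono (comap_measurable fun ω t => θ t ω) le_sup_left le_rfl).comp
        (@measurable_snd _ _ _ (ℋ ⊥))
    exact hh.comp ((@measurable_fst _ _ _ (ℋ ⊥)).prodMk hsnd)
  have hpath := hxℋ.ae_hawkesPath_congr hxm hθ'ℋ hθℋ hhθ
  -- Joint measurability in the path and in the configuration, then conditioning by independence.
  let V : Ω → {n : Measure (ℝ × ℝ) // IsLocallyFiniteMeasure n} :=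
    fun ω => ⟨X ω, hX.locallyFinite ω⟩
  have hV : Measurable V := hX.measurable.subtype_mk
  have hUV : IndepFun (fun ω t => θ t ω) V P := by
    rw [IndepFun_iff_Indep] at hind ⊢
    refine indep_of_indep_of_le_right hind ?_
    rintro _ ⟨_, ⟨B, hB, rfl⟩, rfl⟩
    exact ⟨B, hB, rfl⟩
  have hcond := condExp_ae_eq_integral_of_indepFun hY hV hUV
    (hf.comp (measurable_hawkesPath_noise hh)) fun p => hK _
  rw [htop]
  refine (condExp_congr_ae ?_).trans (hcond.trans ?_)
  · filter_upwards [hpath] with ω hω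
    simp only [Function.comp_apply, V]
    rw [hω]
  · filter_upwards [hhθ] with ω hω
    have hm {u : Horizon T → Param} (hu : Measurable u) :
        Measurable[𝓝.predictable] (Function.uncurry fun t (_ : Ω) => u t) :=
      hu.comp measurable_fst_predictable
    have h1 := hx𝓝.ae_hawkesPath_congr hxm (hm (u := fun t => h t fun s => θ s ω)
      (hh.comp measurable_prodMk_right)) (hm (measurable_section_of_predictable hpred ω))
      (ae_of_all _ fun _ => hω)
    refine integral_congr_ae ?_
    filter_upwards [h1] with ω' hω'
    simp only [Function.comp_apply, V]
    rw [hω']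

end HawkesExistence

theorem mainTheorem1 {Ω : Type*} [mΩ : MeasurableSpace Ω] (P : Measure Ω)
    [IsProbabilityMeasure P] (T : ℝ≥0) (hT : 0 < T)
    (θ : HawkesExistence.Horizon T → Ω → HawkesExistence.Param)
    (hθ : ∀ t, StronglyMeasurable (θ t))
    (Nbar : Ω → Measure (ℝ × ℝ))
    (hNbar : HawkesExistence.IsPoissonRandomMeasure P Nbar volume)
    (hindep : IndepFun (fun ω t => θ t ω) Nbar P)
    (hpred : IsStronglyPredictable
      (Filtration.natural θ hθ ⊔
        HawkesExistence.randomMeasureFiltration T Nbar hNbar.measurable) θ)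
    (hratio : ∀ᵐ ω ∂P, (⨆ t, ((θ t ω).2.1 : ℝ≥0∞) / ((θ t ω).2.2 : ℝ≥0∞)) < 1)
    (hbase : ∀ᵐ ω ∂P, (∫⁻ t, ((θ t ω).1 : ℝ≥0∞) ∂(HawkesExistence.lebesgue T)) < ∞) :
    ∃ N : Ω → Measure (HawkesExistence.Horizon T),
      HawkesExistence.IsHawkesProcess P
        (Filtration.natural θ hθ ⊔
          HawkesExistence.randomMeasureFiltration T Nbar hNbar.measurable) θ N ∧
      (∀ᵐ ω ∂P, ∃ M : Ω → Measure (HawkesExistence.Horizon T),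
        HawkesExistence.IsHawkesProcess P
          (HawkesExistence.randomMeasureFiltration T Nbar hNbar.measurable)
          (fun t _ => θ t ω) M) ∧
      ∀ f : Measure (HawkesExistence.Horizon T) → ℝ, Measurable f → (∃ K, ∀ μ, |f μ| ≤ K) →
        ∀ᵐ ω ∂P, ∀ (Ω' : Type*) (mΩ' : MeasurableSpace Ω') (P' : Measure Ω')
          (𝓖 : Filtration (HawkesExistence.Horizon T) mΩ')
          (M : Ω' → Measure (HawkesExistence.Horizon T)),
          IsProbabilityMeasure P' →
          HawkesExistence.IsHawkesProcess P' 𝓖 (fun t _ => θ t ω) M →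
          (P[fun ω => f (N ω) | Filtration.natural θ hθ ⊤]) ω = ∫ ω', f (M ω') ∂P' := by
  have hind : Indep (Filtration.natural θ hθ ⊤) (MeasurableSpace.comap Nbar inferInstance) P := by
    rw [HawkesExistence.natural_top_eq_comap hθ]
    exact (IndepFun_iff_Indep _ _ _).1 hindep
  have hθp : Measurable[(Filtration.natural θ hθ ⊔
      HawkesExistence.randomMeasureFiltration T Nbar hNbar.measurable).predictable]
      (Function.uncurry θ) :=
    (show StronglyMeasurable[(Filtration.natural θ hθ ⊔ HawkesExistence.randomMeasureFiltration T
      Nbar hNbar.measurable).predictable] (Function.uncurry θ) from hpred).measurable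
  have hdet (ω : Ω) : Measurable[(HawkesExistence.randomMeasureFiltration T Nbar
      hNbar.measurable).predictable] (Function.uncurry fun t (_ : Ω) => θ t ω) :=
    (HawkesExistence.measurable_section_of_predictable hθp ω).comp
      HawkesExistence.measurable_fst_predictable
  have hx := hNbar.isDrivingNoise ((Filtration.natural θ hθ).le ⊤) hind
    (le_sup_right (a := Filtration.natural θ hθ)) fun t =>
      sup_le_sup_right ((Filtration.natural θ hθ).mono le_top) _
  have hx' := hNbar.isDrivingNoise ((Filtration.natural θ hθ).le ⊤) hind
    (le_refl (HawkesExistence.randomMeasureFiltration T Nbar hNbar.measurable))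
    fun t => le_sup_right
  -- With the parameter path frozen, the same construction gives a Hawkes process.
  have hfrozen : ∀ᵐ ω ∂P, HawkesExistence.IsHawkesProcess P
      (HawkesExistence.randomMeasureFiltration T Nbar hNbar.measurable) (fun t _ => θ t ω)
      fun ω' => HawkesExistence.hawkesPath (fun t => θ t ω)
        (HawkesExistence.noise T (Nbar ω')) := by
    filter_upwards [hratio, hbase] with ω h1 h2
    exact hx'.isHawkesProcess (hdet ω) (ae_of_all _ fun _ => h1) (ae_of_all _ fun _ => h2)
  refine ⟨fun ω => HawkesExistence.hawkesPath (fun t => θ t ω)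
    (HawkesExistence.noise T (Nbar ω)), hx.isHawkesProcess hθp hratio hbase,
    hfrozen.mono fun ω h => ⟨_, h⟩, ?_⟩
  rintro f hf ⟨K, hK⟩
  filter_upwards [hfrozen, hbase,
    HawkesExistence.condExp_hawkesPath_ae_eq hθ hNbar hindep hθp hf hK] with ω hω hbω hcond
  intro Ω' mΩ' P' 𝓖 M hP' hM
  have hlaw := hω.map_eq_map (HawkesExistence.measurable_section_of_predictable hθp ω) hbω hM
  rw [hcond, ← integral_map (f := f) hM.pointProcess.measurable.aemeasurable
    hf.aestronglyMeasurable, ← hlaw, integral_map hω.pointProcess.measurable.aemeasurable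
    hf.aestronglyMeasurable]
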